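/- **Setting.** Indices $j\in\{1,2\}$ label two layers. Let $A_1,A_2\in\mathrm{GL}_2(\mathbb R)$ with $A_1^{-1}-A_2^{-1}$ invertible, $\mathcal R_j=A_j\mathbb Z^2$, $\Gamma_j=A_j[0,1)^2$, $A_{\mathcal M}=(A_1^{-1}-A_2^{-1})^{-1}$, $\Gamma_{\mathcal M}=A_{\mathcal M}[0,1)^2$. The lattices are incommensurate: $G_1+G_2=0$ with $G_j\in 2\pi A_j^{-T}\mathbb Z^2$ only for $G_1=G_2=0$. Let $\mathcal A_j$ be finite sets, $\tau_j^{(\alpha)}\in\mathbb R^2$ for $\alpha\in\mathcal A_j$, $\gamma_j\in\Gamma_j$, and $\Omega_j=\mathcal R_j\times\mathcal A_j$, $\Omega=\Omega_1\sqcup\Omega_2$. For $\omega=(R,\alpha)\in\Omega_j$ and $x\in\mathbb R^2$ write $\omega+x=(R+x,\alpha)$. Displacements have values in $\mathbb R^d$, in which the plane $\mathbb R^2$ is isometrically and linearly embedded (e.g. $d=2$ or $d=3$). *Displacements.* $\bar W^{1,2}_{\mathrm{per}}$ is the space of $\mathbf u=(u_1,u_2)$, $u_j=(u_j(\cdot,\alpha))_{\alpha\in\mathcal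 A_j}$, whose components are $A_{\mathcal M}\mathbb Z^2$-periodic, mean-zero functions in $W^{1,2}_{\mathrm{loc}}(\mathbb R^2;\mathbb R^d)$, with the topology of $\|\nabla\mathbf u\|_{L^2(\Gamma_{\mathcal M})}$ (equivalently, by the Poincaré inequality, the $W^{1,2}(\Gamma_{\mathcal M})$ topology). For $\kappa>0$ let $K_\kappa$ be the set of $\mathbf u\in\bar W^{1,2}_{\mathrm{per}}$ such that for all $j$, all $R\in\mathcal R_j$, $R'\in\mathcal R_{3-j}$, all $\alpha,\alpha'\in\mathcal A_j$, $\beta\in\mathcal A_{3-j}$: $$\|\nabla u_j(\cdot,\alpha)\|_\infty\le\kappa,\quad \|u_j(\cdot+R,\alpha')-u_j(\cdot,\alpha)\|_\infty\le\kappa,\quad \|u_{3-j}(A_{3-j}A_j^{-1}\cdot+R',\beta)-u_j(\cdot,\alpha)\|_\infty\le\kappa .$$ *Stencils.* Put $Y_j(x,\alpha)=x+\tau_j^{(\alpha)}+u_j(x,\alpha)$ and $$\Delta_j[u_j](x,\alpha)=\big(u_j(\omega+x)-u_j(x,\alpha)\big)_{\omega\in\Omega_j},\qquad \Delta_{j,3-j}[\mathbf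 u](x,\alpha)=\big(Y_{3-j}(\omega+A_{3-j}A_j^{-1}x+\gamma_{3-j})-Y_j(x+\gamma_j,\alpha)\big)_{\omega\in\Omega_{3-j}} .$$ For $r\ge0$ let $\mathfrak D_j^{\kappa,r}$ be the set of $\mathbf a\in(\mathbb R^d)^{\Omega_j}$ with $|a_\omega|\le\kappa\max\{1,|R|\}+r$ for all $\omega=(R,\alpha)\in\Omega_j$. *Potentials.* For $\alpha\in\mathcal A_j$ let $V^{\rm mono}_{j,\alpha}:(\mathbb R^d)^{\Omega_j}\to\mathbb R$ and $V^{\rm inter}_{j,\alpha}:(\mathbb R^d)^{\Omega_{3-j}}\to\mathbb R$ be given, the latter invariant under $(a_\omega)_\omega\mapsto(a_{\omega+R})_\omega$ for $R\in\mathcal R_{3-j}$. Subscripts $;\omega_1\ldots\omega_\ell$ denote mixed partial derivatives. For $k\in\mathbb N$ say that *the decay conditions of order $k$ hold on $\mathfrak D^{\kappa,r}$* if for all $j$ and $\alpha\in\mathcal A_j$: * at every point of $\mathfrak D_j^{\kappa,r}$, $V^{\rm mono}_{j,\alpha}$ is $C^k$ in any finitely many coordinates, and its partial derivatives of orders $0,\dots,k$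 are continuous on $\mathfrak D_j^{\kappa,r}$ with respect to coordinatewise convergence; the same holds for $V^{\rm inter}_{j,\alpha}$ on $\{\Delta_{j,3-j}[\mathbf 0](x,\alpha)+\mathbf a: x\in\Gamma_{\mathcal M},\ \mathbf a\in\mathfrak D_{3-j}^{\kappa,r}\}$, and $V^{\rm inter}_{j,\alpha}$ is bounded on this set; $V^{\rm mono}_{j,\alpha}(\mathbf 0)=0$; * for $1\le\ell\le k$, with $\mathbf h$ ranging over $\ell$-tuples of unit vectors of $\mathbb R^d$, $$\sum_{\omega_1,\dots,\omega_\ell\in\Omega_j}\ \sup_{\mathbf h,\ \mathbf a\in\mathfrak D_j^{\kappa,r}}\ \sum_{\alpha\in\mathcal A_j}\Big(\prod_{n=1}^\ell w_{j,\alpha}(\omega_n)\Big)\big|V^{\rm mono}_{j,\alpha;\omega_1\ldots\omega_\ell}(\mathbf a)[\mathbf h]\big|<\infty,$$ $$\sum_{\omega_1,\dots,\omega_\ell\in\Omega_{3-j}}\ \sup_{\mathbf h,\ \mathbf a\in\mathfrak D_{3-j}^{\kappa,r},\ x\in\Gamma_{\mathcal M}}\ \sum_{\alpha\in\mathcal A_j}\big|V^{\rm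 inter}_{j,\alpha;\omega_1\ldots\omega_\ell}(\Delta_{j,3-j}[\mathbf 0](x,\alpha)+\mathbf a)[\mathbf h]\big|<\infty,$$ where $w_{j,\alpha}(R,\alpha')=|R|$ if $R\ne0$, $w_{j,\alpha}(0,\alpha')=1$ if $\alpha'\neq\alpha$, and $w_{j,\alpha}(0,\alpha)=0$. *Energies.* Let $$\phi^{\rm mono}_j[u_j](x)=\tfrac1{|\Gamma_j|}\sum_{\alpha}V^{\rm mono}_{j,\alpha}(\Delta_j[u_j](x,\alpha)),\qquad \phi^{\rm inter}_j[\mathbf u](x)=\tfrac1{|\Gamma_j|}\sum_{\alpha}V^{\rm inter}_{j,\alpha}(\Delta_{j,3-j}[\mathbf u](x,\alpha)),$$ $$e^{\rm tot}(\mathbf u)=\sum_{j=1}^2\frac1{|\Gamma_{\mathcal M}|}\int_{\Gamma_{\mathcal M}}\big(\phi_j^{\rm mono}[u_j]+\phi_j^{\rm inter}[\mathbf u]\big)dx .$$ For $\boldsymbol{\delta u}:\Omega\to\mathbb R^d$ and $R\in\mathcal R_j$ let $$\Delta\Phi^{\rm mono}_j(R)=\sum_\alpha\Big(V^{\rm mono}_{j,\alpha}\big(\Delta_j[u_j+\delta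 u_j](R,\alpha)\big)-V^{\rm mono}_{j,\alpha}\big(\Delta_j[u_j](R,\alpha)\big)\Big),$$ $$\Delta\Phi^{\rm inter}_j(R)=\sum_\alpha\Big(V^{\rm inter}_{j,\alpha}\big(\Delta_{j,3-j}[\mathbf u+\boldsymbol{\delta u}](R,\alpha)\big)-V^{\rm inter}_{j,\alpha}\big(\Delta_{j,3-j}[\mathbf u](R,\alpha)\big)\Big),$$ where $\delta u_j$ displaces the atom with label $\omega\in\Omega_j$ by $\delta u_j(\omega)$ in addition to $\mathbf u$ (taken in its continuous version), so that the stencil entries with label $\omega$ change by $\delta u_j(\omega+R)-\delta u_j(R,\alpha)$ and $\delta u_{3-j}(\omega+A_{3-j}A_j^{-1}R)-\delta u_j(R,\alpha)$, respectively. Put $$\Delta E^{\rm tot}_{\mathbf u}(\boldsymbol{\delta u})=\sum_{j=1}^2\sum_{R\in\mathcal R_j}\Delta\Phi_j^{\rm mono}(R)+\sum_{j=1}^2\sum_{R\in\mathcal R_j}\Delta\Phi_j^{\rm inter}(R).$$ **Proposition.** Let $\kappa>0$ and $k\ge5$, and let the decay conditions of order $k$ hold on $\mathfrak D^{\kappa,0}$.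 1. (i) $\phi^{\rm mono}_j[u_j],\ \phi^{\rm inter}_j[\mathbf u]\in L^1(\Gamma_{\mathcal M})$ for all $\mathbf u\in K_\kappa$ and $j=1,2$. (ii) $e^{\rm tot}\in C^k(K_\kappa)$, where $K_\kappa\subset\bar W^{1,2}_{\mathrm{per}}$. 2. Let $\mathbf u\in K_\kappa$. Then $\mathbf u$ has a continuous version, and: (i) $\Delta\Phi^{\rm mono}_j,\ \Delta\Phi^{\rm inter}_j\in\ell^1(\mathcal R_j)$, $j=1,2$, for every finitely supported $\boldsymbol{\delta u}$. (ii), (iii) If the decay conditions of order $k$ hold on $\mathfrak D^{\kappa,r}$ for every $r\ge0$, then $\Delta E^{\rm tot}_{\mathbf u}$ extends from the finitely supported $\boldsymbol{\delta u}$ to a unique continuous functional on $\ell^1(\Omega;\mathbb R^d)$, and this extension is of class $C^k$. More generally, for $\rho>0$, if the decay conditions of order $k$ hold on $\mathfrak D^{\kappa,r}$ for every $0\le r<\rho$, then the same is true on the open ball of radius $\rho$ about $0$ in $\ell^1(\Omega;\mathbb R^d)$ (extending from the finitely supported elements of the ball). -/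

import Mathlib

open MeasureTheory Set
open scoped ENNReal NNReal

/-- The plane `ℝ²`. -/
abbrev Plane : Type := EuclideanSpace ℝ (Fin 2)

/-- The space `ℝ^d` in which displacements take their values. -/
abbrev Vec (d : ℕ) : Type := EuclideanSpace ℝ (Fin d)

/-! ### Lattices -/

/-- The lattice vector `A n`, for `n ∈ ℤ²`. -/
noncomputable def latticePoint (A : Matrix (Fin 2) (Fin 2) ℝ) (n : Fin 2 → ℤ) : Plane :=
  A.toEuclideanLin (WithLp.toLp 2 fun i => (n i : ℝ))

/-- The half-open unit cell `A [0,1)²`. -/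
noncomputable def unitCell (A : Matrix (Fin 2) (Fin 2) ℝ) : Set Plane :=
  A.toEuclideanLin '' {y : Plane | ∀ i, 0 ≤ y i ∧ y i < 1}

/-- The representative of `x` in the unit cell `A [0,1)²` modulo the lattice `A ℤ²`. -/
noncomputable def cellFract (A : Matrix (Fin 2) (Fin 2) ℝ) (x : Plane) : Plane :=
  A.toEuclideanLin (WithLp.toLp 2 fun i => Int.fract (A⁻¹.toEuclideanLin x i))

/-- The index set `Ω_j = ℛ_j × 𝒜_j` of atoms of layer `j`; the lattice vector `R_j = A_j n` is
recorded by its integer coordinates `n`.  Layers are indexed by `Fin 2`, and `1 - j` is the layer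
opposite to `j`. -/
abbrev Site (𝒜 : Fin 2 → Type*) (j : Fin 2) : Type _ := (Fin 2 → ℤ) × 𝒜 j

/-- The geometry of an incommensurate bilayer with sublattice index sets `𝒜 j`. -/
structure Bilayer (𝒜 : Fin 2 → Type*) (d : ℕ) where
  /-- primitive translation vectors of layer `j`, as columns -/
  A : Fin 2 → Matrix (Fin 2) (Fin 2) ℝ
  isUnit_det : ∀ j, IsUnit (A j).det
  /-- the moiré lattice exists -/
  isUnit_det_moire : IsUnit ((A 0)⁻¹ - (A 1)⁻¹).det
  /-- the two reciprocal lattices `2π A_j⁻ᵀ ℤ²` meet only in `0` -/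
  incommensurate : ∀ n m : Fin 2 → ℤ,
    latticePoint ((2 * Real.pi) • ((A 0)⁻¹).transpose) n +
      latticePoint ((2 * Real.pi) • ((A 1)⁻¹).transpose) m = 0 → n = 0 ∧ m = 0
  /-- shift vectors of the sublattices -/
  τ : ∀ j, 𝒜 j → Plane
  /-- origins of the layers -/
  γ : Fin 2 → Plane
  γ_mem : ∀ j, γ j ∈ unitCell (A j)
  /-- the embedding of the plane of the layers into the space of atomic positions: the identity
  for in-plane displacements (`d = 2`), `x ↦ (x, 0)` for `d = 3` -/
  plane : Plane →ₗᵢ[ℝ] Vec d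

/-! ### Periodic Sobolev functions -/

/-- A function on the plane that is periodic with respect to the lattice `M ℤ²`. -/
def IsLatticePeriodic {β : Type*} (M : Matrix (Fin 2) (Fin 2) ℝ) (f : Plane → β) : Prop :=
  ∀ (n : Fin 2 → ℤ) (x : Plane), f (x + latticePoint M n) = f x

theorem unitCell_subset_compact (M : Matrix (Fin 2) (Fin 2) ℝ) :
    ∃ K : Set Plane, IsCompact K ∧ unitCell M ⊆ K := by
  refine ⟨M.toEuclideanLin '' (Metric.closedBall 0 2), ?_, ?_⟩
  · exact (isCompact_closedBall _ _).image (LinearMap.continuous_of_finiteDimensional _)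
  · refine image_mono fun y hy => ?_
    rw [mem_closedBall_zero_iff, EuclideanSpace.norm_eq]
    rw [Real.sqrt_le_left (by norm_num)]
    have h0 := hy 0
    have h1 := hy 1
    simp only [Fin.sum_univ_two, Real.norm_eq_abs, sq_abs]
    nlinarith [h0.1, h0.2, h1.1, h1.2]

instance isFiniteMeasure_unitCell (M : Matrix (Fin 2) (Fin 2) ℝ) :
    IsFiniteMeasure (volume.restrict (unitCell M)) := by
  obtain ⟨K, hK, hsub⟩ := unitCell_subset_compact M
  exact isFiniteMeasure_restrict.2 ((measure_mono hsub).trans_lt hK.measure_lt_top).ne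

theorem integrable_smul_unitCell {F : Type*} [NormedAddCommGroup F] [NormedSpace ℝ F]
    (M : Matrix (Fin 2) (Fin 2) ℝ) {φ : Plane → ℝ} (hφ : Continuous φ) {f : Plane → F}
    (hf : Integrable f (volume.restrict (unitCell M))) :
    Integrable (fun x => φ x • f x) (volume.restrict (unitCell M)) := by
  obtain ⟨K, hK, hsub⟩ := unitCell_subset_compact M
  obtain ⟨C, hC⟩ := hK.exists_bound_of_continuousOn hφ.continuousOn
  refine Integrable.mono (hf.norm.const_mul C) (hφ.aestronglyMeasurable.smul hf.1) ?_
  have hK' : ∀ᵐ x ∂(volume.restrict (unitCell M)), x ∈ K := by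
    have hle : volume.restrict (unitCell M) ≤ volume.restrict K := Measure.restrict_mono hsub le_rfl
    exact hle.absolutelyContinuous.ae_le (ae_restrict_mem hK.measurableSet)
  filter_upwards [hK'] with x hx
  have hCx := hC x hx
  rw [norm_smul, norm_mul, norm_norm]
  exact mul_le_mul_of_nonneg_right (hCx.trans (le_abs_self C)) (norm_nonneg _)

/-- `g` is the weak gradient of the `M ℤ²`-periodic function `f` (both given on the unit cell):
`∫ (∂_e φ) f = - ∫ φ (g e)` for all smooth periodic `φ` and all directions `e`. -/
def IsPeriodicWeakGradient {d : ℕ} (M : Matrix (Fin 2) (Fin 2) ℝ) (f : Plane → Vec d)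
    (g : Plane → Plane →L[ℝ] Vec d) : Prop :=
  ∀ φ : Plane → ℝ, ContDiff ℝ (⊤ : ℕ∞) φ → IsLatticePeriodic M φ → ∀ e : Plane,
    ∫ x in unitCell M, fderiv ℝ φ x e • f x = - ∫ x in unitCell M, φ x • g x e

/-- The space `W̄^{1,2}_per` of `M ℤ²`-periodic, mean-zero functions in `W^{1,2}_loc(ℝ²; ℝ^d)`, as
the space of pairs (function, weak gradient) of square integrable functions on the unit cell.
Its norm is `max ‖f‖₂ ‖∇f‖₂`, which on mean-zero functions is equivalent to `‖∇f‖₂`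
(Poincaré–Wirtinger). -/
noncomputable def PeriodicSobolev (M : Matrix (Fin 2) (Fin 2) ℝ) (d : ℕ) :
    Submodule ℝ (Lp (Vec d) 2 (volume.restrict (unitCell M)) ×
      Lp (Plane →L[ℝ] Vec d) 2 (volume.restrict (unitCell M))) where
  carrier := {p | IsPeriodicWeakGradient M (fun x => p.1 x) (fun x => p.2 x) ∧
    ∫ x in unitCell M, p.1 x = 0}
  zero_mem' := by
    have hz := Lp.coeFn_zero (Vec d) 2 (volume.restrict (unitCell M))
    have hz' := Lp.coeFn_zero (Plane →L[ℝ] Vec d) 2 (volume.restrict (unitCell M))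
    refine ⟨fun φ hφ hper e => ?_, ?_⟩
    · rw [integral_eq_zero_of_ae, integral_eq_zero_of_ae, neg_zero]
      · filter_upwards [hz'] with x hx
        rw [Prod.snd_zero, hx]
        simp
      · filter_upwards [hz] with x hx
        rw [Prod.fst_zero, hx]
        simp
    · refine integral_eq_zero_of_ae ?_
      filter_upwards [hz] with x hx
      rw [Prod.fst_zero, hx]
  add_mem' := by
    rintro p q ⟨hp, hp0⟩ ⟨hq, hq0⟩
    have ip := (Lp.memLp p.1).integrable one_le_two
    have iq := (Lp.memLp q.1).integrable one_le_two
    have jp := (Lp.memLp p.2).integrable one_le_two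
    have jq := (Lp.memLp q.2).integrable one_le_two
    refine ⟨fun φ hφ hper e => ?_, ?_⟩
    · have hφ' : Continuous fun x => fderiv ℝ φ x e :=
        (hφ.continuous_fderiv (by simp)).clm_apply continuous_const
      have h1 : ∫ x in unitCell M, fderiv ℝ φ x e • (p + q).1 x =
          ∫ x in unitCell M, (fderiv ℝ φ x e • p.1 x + fderiv ℝ φ x e • q.1 x) := by
        refine integral_congr_ae ?_
        filter_upwards [Lp.coeFn_add p.1 q.1] with x hx
        rw [Prod.fst_add, hx, Pi.add_apply, smul_add]
      have h2 : ∫ x in unitCell M, φ x • (p + q).2 x e =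
          ∫ x in unitCell M, (φ x • p.2 x e + φ x • q.2 x e) := by
        refine integral_congr_ae ?_
        filter_upwards [Lp.coeFn_add p.2 q.2] with x hx
        rw [Prod.snd_add, hx, Pi.add_apply, add_apply, smul_add]
      rw [h1, h2, integral_add (integrable_smul_unitCell M hφ' ip)
        (integrable_smul_unitCell M hφ' iq),
        integral_add (integrable_smul_unitCell M hφ.continuous (jp.apply_continuousLinearMap e))
        (integrable_smul_unitCell M hφ.continuous (jq.apply_continuousLinearMap e)),
        hp φ hφ hper e, hq φ hφ hper e, neg_add]
    · have h1 : ∫ x in unitCell M, (p + q).1 x = ∫ x in unitCell M, (p.1 x + q.1 x) := by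
        refine integral_congr_ae ?_
        filter_upwards [Lp.coeFn_add p.1 q.1] with x hx
        rw [Prod.fst_add, hx, Pi.add_apply]
      rw [h1, integral_add ip iq, hp0, hq0, add_zero]
  smul_mem' := by
    rintro c p ⟨hp, hp0⟩
    refine ⟨fun φ hφ hper e => ?_, ?_⟩
    · have h1 : ∫ x in unitCell M, fderiv ℝ φ x e • (c • p).1 x =
          ∫ x in unitCell M, c • (fderiv ℝ φ x e • p.1 x) := by
        refine integral_congr_ae ?_
        filter_upwards [Lp.coeFn_smul c p.1] with x hx
        rw [Prod.smul_fst, hx, Pi.smul_apply, smul_comm]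
      have h2 : ∫ x in unitCell M, φ x • (c • p).2 x e =
          ∫ x in unitCell M, c • (φ x • p.2 x e) := by
        refine integral_congr_ae ?_
        filter_upwards [Lp.coeFn_smul c p.2] with x hx
        rw [Prod.smul_snd, hx, Pi.smul_apply, smul_apply, smul_comm]
      rw [h1, h2, integral_smul, integral_smul, hp φ hφ hper e, smul_neg]
    · have h1 : ∫ x in unitCell M, (c • p).1 x = ∫ x in unitCell M, c • p.1 x := by
        refine integral_congr_ae ?_
        filter_upwards [Lp.coeFn_smul c p.1] with x hx
        rw [Prod.smul_fst, hx, Pi.smul_apply]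
      rw [h1, integral_smul, hp0, smul_zero]

open Classical in
/-- The periodic extension to the plane of an element of the periodic Sobolev space; it is the
continuous representative if there is one. -/
noncomputable def representative {M : Matrix (Fin 2) (Fin 2) ℝ} {d : ℕ}
    (v : PeriodicSobolev M d) : Plane → Vec d :=
  if h : ∃ f : Plane → Vec d, Continuous f ∧
      f =ᵐ[volume] fun x => v.1.1 (cellFract M x) then h.choose
  else fun x => v.1.1 (cellFract M x)

/-! ### Displacements -/

section Geometry

variable {𝒜 : Fin 2 → Type*} {d : ℕ}

/-- The matrix `A_ℳ = (A₁⁻¹ - A₂⁻¹)⁻¹` of primitive moiré translation vectors. -/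
noncomputable def Bilayer.moire (S : Bilayer 𝒜 d) : Matrix (Fin 2) (Fin 2) ℝ :=
  ((S.A 0)⁻¹ - (S.A 1)⁻¹)⁻¹

/-- The moiré cell `Γ_ℳ`. -/
noncomputable def Bilayer.moireCell (S : Bilayer 𝒜 d) : Set Plane := unitCell S.moire

/-- The linear map `x ↦ A_{3-j} A_j⁻¹ x`. -/
noncomputable def Bilayer.transfer (S : Bilayer 𝒜 d) (j : Fin 2) : Plane →ₗ[ℝ] Plane :=
  (S.A (1 - j) * (S.A j)⁻¹).toEuclideanLin

/-- The lattice vector `R_j ∈ ℛ_j` with integer coordinates `n`. -/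
noncomputable def Bilayer.R (S : Bilayer 𝒜 d) (j : Fin 2) (n : Fin 2 → ℤ) : Plane :=
  latticePoint (S.A j) n

/-- The space `W̄^{1,2}_per` of pairs `(u₁, u₂)`, with `u_j` having one component per sublattice. -/
abbrev Bilayer.Displacement (S : Bilayer 𝒜 d) : Type _ :=
  ∀ j : Fin 2, 𝒜 j → PeriodicSobolev S.moire d

/-- The displacement `u_j(x, α_j)` as a function on the plane. -/
noncomputable def Bilayer.field (S : Bilayer 𝒜 d) (u : S.Displacement) (j : Fin 2) (x : Plane)
    (α : 𝒜 j) : Vec d :=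
  representative (u j α) x

/-- The set `K_κ` of admissible displacements. -/
def Bilayer.admissible (S : Bilayer 𝒜 d) (κ : ℝ) : Set S.Displacement :=
  {u |
    (∀ (j : Fin 2) (α : 𝒜 j), ∀ᵐ x ∂(volume.restrict S.moireCell), ‖(u j α).1.2 x‖ ≤ κ) ∧
    (∀ (j : Fin 2) (n : Fin 2 → ℤ) (α α' : 𝒜 j), ∀ᵐ x : Plane,
      ‖S.field u j (x + S.R j n) α' - S.field u j x α‖ ≤ κ) ∧
    (∀ (j : Fin 2) (n : Fin 2 → ℤ) (α : 𝒜 j) (α' : 𝒜 (1 - j)), ∀ᵐ x : Plane,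
      ‖S.field u (1 - j) (S.transfer j x + S.R (1 - j) n) α' - S.field u j x α‖ ≤ κ)}

/-! ### Difference stencils and potentials -/

/-- The monolayer stencil `Δ_j[U](x, α) = (U(ω + x) - U(x, α))_ω`. -/
noncomputable def Bilayer.monoStencil (S : Bilayer 𝒜 d) (j : Fin 2) (U : Plane → 𝒜 j → Vec d)
    (x : Plane) (α : 𝒜 j) : Site 𝒜 j → Vec d :=
  fun ω => U (S.R j ω.1 + x) ω.2 - U x α

/-- The atomic position `Y_j(x, α) = x + τ_j^{(α)} + U_j(x, α)`. -/
noncomputable def Bilayer.position (S : Bilayer 𝒜 d) (U : ∀ j, Plane → 𝒜 j → Vec d) (j : Fin 2)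
    (x : Plane) (α : 𝒜 j) : Vec d :=
  S.plane (x + S.τ j α) + U j x α

/-- The interlayer stencil
`Δ_{j,3-j}[U](x, α) = (Y_{3-j}(ω + A_{3-j} A_j⁻¹ x + γ_{3-j}) - Y_j(x + γ_j, α))_ω`,
indexed by the atoms `ω` of the opposite layer. -/
noncomputable def Bilayer.interStencil (S : Bilayer 𝒜 d) (j : Fin 2)
    (U : ∀ j, Plane → 𝒜 j → Vec d) (x : Plane) (α : 𝒜 j) : Site 𝒜 (1 - j) → Vec d :=
  fun ω => S.position U (1 - j) (S.R (1 - j) ω.1 + S.transfer j x + S.γ (1 - j)) ω.2 -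
    S.position U j (x + S.γ j) α

/-- Monolayer and interlayer site potentials; the latter are translation invariant. -/
structure SitePotentials (𝒜 : Fin 2 → Type*) (d : ℕ) where
  mono : ∀ j : Fin 2, 𝒜 j → (Site 𝒜 j → Vec d) → ℝ
  inter : ∀ j : Fin 2, 𝒜 j → (Site 𝒜 (1 - j) → Vec d) → ℝ
  inter_translation : ∀ (j : Fin 2) (α : 𝒜 j) (a : Site 𝒜 (1 - j) → Vec d) (n : Fin 2 → ℤ),
    inter j α (fun ω => a (ω.1 + n, ω.2)) = inter j α a

open Classical in
/-- `V` near `a`, as a function of finitely many coordinates `ω₁, …, ω_ℓ` of the stencil: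
`(b₁, …, b_ℓ) ↦ V(a + ∑ₙ bₙ e_{ωₙ})`. -/
noncomputable def stencilSlice {σ : Type*} {d : ℕ} (V : (σ → Vec d) → ℝ) (a : σ → Vec d) {ℓ : ℕ}
    (ω : Fin ℓ → σ) (b : Fin ℓ → Vec d) : ℝ :=
  V (a + ∑ n, Pi.single (ω n) (b n))

/-- The mixed partial derivative `V_{;ω₁…ω_ℓ}(a)[h₁, …, h_ℓ]`. -/
noncomputable def mixedPartial {σ : Type*} {d : ℕ} (V : (σ → Vec d) → ℝ) (a : σ → Vec d) {ℓ : ℕ}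
    (ω : Fin ℓ → σ) (h : Fin ℓ → Vec d) : ℝ :=
  iteratedFDeriv ℝ ℓ (stencilSlice V a ω) 0 fun n => Pi.single n (h n)

/-- `V` is `C^k` on a set `𝔖` of stencils: at the points of `𝔖` it is `C^k` in any finite number of
coordinates, and its partial derivatives of order at most `k` (including `V` itself) are continuous
on `𝔖` for coordinatewise convergence of stencils. -/
def StencilSmoothOn {σ : Type*} {d : ℕ} (k : ℕ) (V : (σ → Vec d) → ℝ) (𝔖 : Set (σ → Vec d)) :
    Prop :=
  (∀ a ∈ 𝔖, ∀ (ℓ : ℕ) (ω : Fin ℓ → σ), ContDiffAt ℝ k (stencilSlice V a ω) 0) ∧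
    ∀ ℓ ≤ k, ∀ (ω : Fin ℓ → σ) (h : Fin ℓ → Vec d),
      ContinuousOn (fun a => mixedPartial V a ω h) 𝔖

/-- The stencil set `𝔇_j^{κ,r}`: stencils with `|a_ω| ≤ κ max(1, |R_j|) + r` for all
`ω = (R_j, α_j)`.  For `r = 0` this is the set `𝔇_j^κ`. -/
def Bilayer.stencils (S : Bilayer 𝒜 d) (κ r : ℝ) (j : Fin 2) : Set (Site 𝒜 j → Vec d) :=
  {a | ∀ ω : Site 𝒜 j, ‖a ω‖ ≤ κ * max 1 ‖S.R j ω.1‖ + r}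

/-- The interlayer stencils `Δ_{j,3-j}[0](x, α) + a` with `x ∈ Γ_ℳ` and `a ∈ 𝔇_{3-j}^{κ,r}`. -/
def Bilayer.interStencils (S : Bilayer 𝒜 d) (κ r : ℝ) (j : Fin 2) (α : 𝒜 j) :
    Set (Site 𝒜 (1 - j) → Vec d) :=
  {b | ∃ x ∈ S.moireCell, ∃ a ∈ S.stencils κ r (1 - j), b = S.interStencil j 0 x α + a}

open Classical in
/-- The weight of the atom `ω = (R_j, β)` as seen from the atom `(0, α)`: it is `|R_j|` if
`R_j ≠ 0`, `1` for another atom of the same cell, and `0` for the atom `(0, α)` itself (the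
corresponding entry of a monolayer stencil vanishes). -/
noncomputable def Bilayer.weight (S : Bilayer 𝒜 d) (j : Fin 2) (α : 𝒜 j) (ω : Site 𝒜 j) : ℝ :=
  if ω.1 = 0 then (if ω.2 = α then 0 else 1) else ‖S.R j ω.1‖

variable [∀ j, Fintype (𝒜 j)]

/-- The monolayer site potential norm `m^{mono}_{ℓ,j}(ω₁, …, ω_ℓ)`. -/
noncomputable def Bilayer.monoNorm (S : Bilayer 𝒜 d) (V : SitePotentials 𝒜 d) (κ r : ℝ)
    (j : Fin 2) {ℓ : ℕ} (ω : Fin ℓ → Site 𝒜 j) : ℝ≥0∞ :=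
  ⨆ (h : Fin ℓ → Vec d) (_ : ∀ n, ‖h n‖ = 1) (a : Site 𝒜 j → Vec d) (_ : a ∈ S.stencils κ r j),
    ∑ α : 𝒜 j, ENNReal.ofReal
      ((∏ n, S.weight j α (ω n)) * |mixedPartial (V.mono j α) a ω h|)

/-- The interlayer site potential norm `m^{inter}_{ℓ,j}(ω₁, …, ω_ℓ)`, for atoms of the opposite
layer. -/
noncomputable def Bilayer.interNorm (S : Bilayer 𝒜 d) (V : SitePotentials 𝒜 d) (κ r : ℝ)
    (j : Fin 2) {ℓ : ℕ} (ω : Fin ℓ → Site 𝒜 (1 - j)) : ℝ≥0∞ :=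
  ⨆ (h : Fin ℓ → Vec d) (_ : ∀ n, ‖h n‖ = 1) (a : Site 𝒜 (1 - j) → Vec d)
    (_ : a ∈ S.stencils κ r (1 - j)) (x : Plane) (_ : x ∈ S.moireCell),
    ∑ α : 𝒜 j, ENNReal.ofReal
      |mixedPartial (V.inter j α) (S.interStencil j 0 x α + a) ω h|

/-- Smoothness and decay of order `k` of the site potentials on the stencils in `𝔇^{κ,r}`. -/
structure Bilayer.Decay (S : Bilayer 𝒜 d) (V : SitePotentials 𝒜 d) (κ r : ℝ) (k : ℕ) : Prop where
  mono_smooth : ∀ (j : Fin 2) (α : 𝒜 j), StencilSmoothOn k (V.mono j α) (S.stencils κ r j)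
  inter_smooth : ∀ (j : Fin 2) (α : 𝒜 j),
    StencilSmoothOn k (V.inter j α) (S.interStencils κ r j α)
  mono_summable : ∀ (j : Fin 2) (ℓ : ℕ), 1 ≤ ℓ → ℓ ≤ k →
    ∑' ω : Fin ℓ → Site 𝒜 j, S.monoNorm V κ r j ω < ∞
  inter_summable : ∀ (j : Fin 2) (ℓ : ℕ), 1 ≤ ℓ → ℓ ≤ k →
    ∑' ω : Fin ℓ → Site 𝒜 (1 - j), S.interNorm V κ r j ω < ∞
  mono_zero : ∀ (j : Fin 2) (α : 𝒜 j), V.mono j α 0 = 0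
  inter_bounded : ∀ (j : Fin 2) (α : 𝒜 j), ∃ C : ℝ, ∀ b ∈ S.interStencils κ r j α,
    |V.inter j α b| ≤ C

/-! ### Energies -/

/-- The monolayer site potential density `φ_j^{mono}[u_j]`. -/
noncomputable def Bilayer.monoDensity (S : Bilayer 𝒜 d) (V : SitePotentials 𝒜 d)
    (u : S.Displacement) (j : Fin 2) (x : Plane) : ℝ :=
  (volume.real (unitCell (S.A j)))⁻¹ *
    ∑ α : 𝒜 j, V.mono j α (S.monoStencil j (S.field u j) x α)

/-- The interlayer site potential density `φ_{j,γ}^{inter}[u]`. -/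
noncomputable def Bilayer.interDensity (S : Bilayer 𝒜 d) (V : SitePotentials 𝒜 d)
    (u : S.Displacement) (j : Fin 2) (x : Plane) : ℝ :=
  (volume.real (unitCell (S.A j)))⁻¹ *
    ∑ α : 𝒜 j, V.inter j α (S.interStencil j (S.field u) x α)

/-- The total energy density `e^{tot}_γ(u)`. -/
noncomputable def Bilayer.energyDensity (S : Bilayer 𝒜 d) (V : SitePotentials 𝒜 d)
    (u : S.Displacement) : ℝ :=
  ∑ j : Fin 2, ((⨍ x in S.moireCell, S.monoDensity V u j x) +
    ⨍ x in S.moireCell, S.interDensity V u j x)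

/-- The disjoint union `Ω = Ω₁ ⊔ Ω₂` of the index sets of all atoms. -/
abbrev AllSites (𝒜 : Fin 2 → Type*) : Type _ := Σ j : Fin 2, Site 𝒜 j

/-- The offset `Δ_j[δu_j](R_j, α)` of the monolayer stencil at the atom `(R_j, α)`, `R_j = A_j n`,
caused by the lattice perturbation `δu`. -/
def monoOffset {𝒜 : Fin 2 → Type*} {d : ℕ} (δ : AllSites 𝒜 → Vec d) (j : Fin 2)
    (n : Fin 2 → ℤ) (α : 𝒜 j) : Site 𝒜 j → Vec d :=
  fun ω => δ ⟨j, (ω.1 + n, ω.2)⟩ - δ ⟨j, (n, α)⟩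

/-- The offset of the interlayer stencil at the atom `(R_j, α)`, `R_j = A_j n`, caused by the
lattice perturbation `δu`; note that `A_{3-j} A_j⁻¹ R_j = A_{3-j} n`. -/
def interOffset {𝒜 : Fin 2 → Type*} {d : ℕ} (δ : AllSites 𝒜 → Vec d) (j : Fin 2)
    (n : Fin 2 → ℤ) (α : 𝒜 j) : Site 𝒜 (1 - j) → Vec d :=
  fun ω => δ ⟨1 - j, (ω.1 + n, ω.2)⟩ - δ ⟨j, (n, α)⟩

/-- The monolayer offset site potential `ΔΦ_j^{mono}[δu_j; u_j](R_j)`, `R_j = A_j n`. -/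
noncomputable def Bilayer.monoOffsetPotential (S : Bilayer 𝒜 d) (V : SitePotentials 𝒜 d)
    (u : S.Displacement) (δ : AllSites 𝒜 → Vec d) (j : Fin 2) (n : Fin 2 → ℤ) : ℝ :=
  ∑ α : 𝒜 j, (V.mono j α (S.monoStencil j (S.field u j) (S.R j n) α + monoOffset δ j n α) -
    V.mono j α (S.monoStencil j (S.field u j) (S.R j n) α))

/-- The interlayer offset site potential `ΔΦ_{j,γ}^{inter}[δu; u](R_j)`, `R_j = A_j n`. -/
noncomputable def Bilayer.interOffsetPotential (S : Bilayer 𝒜 d) (V : SitePotentials 𝒜 d)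
    (u : S.Displacement) (δ : AllSites 𝒜 → Vec d) (j : Fin 2) (n : Fin 2 → ℤ) : ℝ :=
  ∑ α : 𝒜 j, (V.inter j α (S.interStencil j (S.field u) (S.R j n) α + interOffset δ j n α) -
    V.inter j α (S.interStencil j (S.field u) (S.R j n) α))

/-- The total offset energy `ΔE^{tot}_{γ;u}(δu)`. -/
noncomputable def Bilayer.offsetEnergy (S : Bilayer 𝒜 d) (V : SitePotentials 𝒜 d)
    (u : S.Displacement) (δ : AllSites 𝒜 → Vec d) : ℝ :=
  ∑ j : Fin 2, ((∑' n : Fin 2 → ℤ, S.monoOffsetPotential V u δ j n) +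
    ∑' n : Fin 2 → ℤ, S.interOffsetPotential V u δ j n)

/-- The space `ℓ¹` of summable lattice perturbations of the two layers. -/
abbrev SummablePerturbation (𝒜 : Fin 2 → Type*) (d : ℕ) : Type _ :=
  lp (fun _ : AllSites 𝒜 => Vec d) 1

/-- `F` is continuous on `U` and agrees there with `E` at all finitely supported perturbations. -/
def IsContinuousExtensionOn {𝒜 : Fin 2 → Type*} {d : ℕ} (E : (AllSites 𝒜 → Vec d) → ℝ)
    (U : Set (SummablePerturbation 𝒜 d)) (F : SummablePerturbation 𝒜 d → ℝ) : Prop :=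
  ContinuousOn F U ∧
    ∀ δ ∈ U, (Function.support (δ : AllSites 𝒜 → Vec d)).Finite → F δ = E δ

/-- `E` has a unique extension from the finitely supported perturbations in `U` to a continuous
functional on `U`, and this extension is of class `C^k` on `U`. -/
def HasUniqueSmoothExtensionOn {𝒜 : Fin 2 → Type*} {d : ℕ} (k : ℕ)
    (E : (AllSites 𝒜 → Vec d) → ℝ) (U : Set (SummablePerturbation 𝒜 d)) : Prop :=
  ∃ F : SummablePerturbation 𝒜 d → ℝ, IsContinuousExtensionOn E U F ∧
    (∀ G : SummablePerturbation 𝒜 d → ℝ, IsContinuousExtensionOn E U G → EqOn G F U) ∧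
    ContDiffOn ℝ k F U

end Geometry

/-! Both energies are integrals, over a measure space, of a site potential evaluated at stencils
that depend affinely on the unknown: the measure is Lebesgue measure on the moiré cell for the
energy density, and counting measure on `ℤ²` for the offset energy. One abstract theorem,
`SmoothIntegrand.contDiffOn_integral`, serves both. The candidate for the `ℓ`-th derivative is the
sum, over `ℓ`-tuples `ω` of stencil coordinates, of the forms `v ↦ ∫ G ω u ∏ₙ L (ω n) (v n)`. Here
`G ω u` is a weighted mixed partial derivative of the potential along the stencils of `u`, and `L i
v` is a coordinate of the stencil of `v` divided by its weight. A Hölder inequality bounds each form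
by an `L^q` norm of `G ω u`, and the decay conditions make the sum over `ω` converge absolutely.
Since the domain is convex but need not be open, differentiability comes from the mean value theorem
along segments (`contDiffOn_of_hasDerivAt_segment`).

The potentials depend on infinitely many entries and are smooth only in finitely many of them at a
time. The chain rule in an infinite direction, `hasDerivAt_coordPartial_segment`, is obtained by
truncating the direction to finitely many sites, integrating the finite chain rule, and passing to
the limit by dominated convergence.

For the energy density, `q = 2`. The `ℓ` stencil factors are estimated in `L^{2ℓ}`, which the planar
Sobolev embedding `exists_eLpNorm_le_norm` controls by the `W^{1,2}` norm. The gradient bound makes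
admissible displacements Lipschitz (`exists_lipschitz_representative`), so that `W^{1,2}`
convergence inside the admissible set is uniform convergence
(`Bilayer.eventually_norm_field_sub_le`) and the partial derivatives converge boundedly.
Incommensurability enters through Kronecker's theorem: the lattice of a layer and the moiré lattice
together are dense, so the interlayer bound by `κ` holds between arbitrary points
(`Bilayer.norm_field_sub_opposite_le`), in particular between the points shifted by the origins `γ`.
Hence all stencils lie in the sets on which decay is assumed.

For the offset energy, `q = ∞`. One stencil factor is summed in `ℓ¹`, the others are bounded
uniformly, and continuity uniformly over all sites follows from uniform continuity on compact sets
of stencils. Interlayer stencils at lattice points are not centred in the moiré cell, but a moiré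
translation only relabels the opposite layer (`Bilayer.interStencil_add_moire`), so translation
invariance of the potential brings them back. Uniqueness of the extension is density of the finitely
supported perturbations. For these, decay on `𝔇^{κ,0}` already gives summability: all but finitely
many sites see the perturbation only at distances where the linear growth of `𝔇^{κ,0}` leaves room
for it. -/

open Filter Topology

/-! ### Differentiating an integral of a series of partial derivatives -/

section SmoothIntegrand

variable {X W I : Type*} [MeasurableSpace X] [NormedAddCommGroup W] [NormedSpace ℝ W]

/-- A family of integrands `G ω u` (`ω` a tuple of indices, `u` in a convex set `K`), such that the
derivative of `G ω` in the direction `v` is `∑ i, L i v * G (i, ω)`, with the bounds that allow to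
integrate and sum all terms. -/
structure SmoothIntegrand (μ : Measure X) (K : Set W) (k : ℕ) (q : ℝ≥0∞) (L : I → W → X → ℝ)
    (G : ∀ ℓ, (Fin ℓ → I) → W → X → ℝ) (M : ∀ ℓ, (Fin ℓ → I) → ℝ) : Prop where
  convex : Convex ℝ K
  one_fin : eLpNorm (fun _ : X => (1 : ℝ)) q μ ≠ ∞
  L_meas : ∀ i v, AEStronglyMeasurable (L i v) μ
  L_add : ∀ i v w, L i (v + w) =ᵐ[μ] fun x => L i v x + L i w x
  L_smul : ∀ i (c : ℝ) v, L i (c • v) =ᵐ[μ] fun x => c * L i v x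
  hoelder : ∀ ℓ, 1 ≤ ℓ → ℓ ≤ k → ∃ C : ℝ≥0, ∀ (ω : Fin ℓ → I) (v : Fin ℓ → W) (g : X → ℝ),
    AEStronglyMeasurable g μ →
    ∫⁻ x, ‖g x * ∏ n, L (ω n) (v n) x‖ₑ ∂μ ≤ C * eLpNorm g q μ * ∏ n, ‖v n‖ₑ
  M_nonneg : ∀ ℓ ω, 0 ≤ M ℓ ω
  M_summable : ∀ ℓ, 1 ≤ ℓ → ℓ ≤ k → Summable (M ℓ)
  G_meas : ∀ ℓ ≤ k, ∀ ω, ∀ u ∈ K, AEStronglyMeasurable (G ℓ ω u) μ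
  G_bound : ∀ ℓ, 1 ≤ ℓ → ℓ ≤ k → ∀ ω, ∀ u ∈ K, ∀ v ∈ K, ∀ᵐ x ∂μ, ∀ t ∈ Icc (0 : ℝ) 1,
    |G ℓ ω (u + t • (v - u)) x| ≤ M ℓ ω
  G_int : ∃ u ∈ K, Integrable (G 0 Fin.elim0 u) μ
  G_cont : ∀ u ∈ K, ∀ v ∈ K, ∀ᵐ x ∂μ,
    ContinuousOn (fun t : ℝ => G 0 Fin.elim0 (u + t • (v - u)) x) (Icc 0 1)
  G_deriv : ∀ ℓ < k, ∀ ω, ∀ u ∈ K, ∀ v ∈ K, ∀ᵐ x ∂μ, ∀ t ∈ Ioo (0 : ℝ) 1,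
    HasDerivAt (fun t : ℝ => G ℓ ω (u + t • (v - u)) x)
      (∑' i, L i (v - u) x * G (ℓ + 1) (Fin.cons i ω) (u + t • (v - u)) x) t
  G_tendsto : ∀ ℓ, 1 ≤ ℓ → ℓ ≤ k → ∀ ω, ∀ u ∈ K,
    Tendsto (fun u' => eLpNorm (fun x => G ℓ ω u' x - G ℓ ω u x) q μ) (𝓝[K] u) (𝓝 0)

open Classical in
/-- The multilinear form `v ↦ ∫ g ∏ₙ L (ω n) (v n)`. -/
noncomputable def integralForm (μ : Measure X) (L : I → W → X → ℝ) {ℓ : ℕ} (ω : Fin ℓ → I)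
    (g : X → ℝ) : ContinuousMultilinearMap ℝ (fun _ : Fin ℓ => W) ℝ :=
  if h : ∃ A : ContinuousMultilinearMap ℝ (fun _ : Fin ℓ => W) ℝ,
    ∀ v, A v = ∫ x, g x * ∏ n, L (ω n) (v n) x ∂μ then h.choose else 0

theorem prod_apply_update {W : Type*} {ℓ : ℕ} (f : Fin ℓ → W → ℝ) (v : Fin ℓ → W) (i : Fin ℓ)
    (a : W) : ∏ n, f n (Function.update v i a n) = f i a * ∏ n ∈ Finset.univ \ {i}, f n (v n) := by
  have : (fun n => f n (Function.update v i a n)) =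
      Function.update (fun n => f n (v n)) i (f i a) := by
    funext n
    rw [Function.apply_update (fun n => f n)]
  rw [this, Finset.prod_update_of_mem (Finset.mem_univ i)]

/-- `L` is additive and homogeneous only almost everywhere, which is enough for multilinearity after
integration. The bound supplies continuity, and with it the existence that puts `integralForm` on
its non-default branch. -/
theorem integralForm_apply_of_bound {μ : Measure X} {L : I → W → X → ℝ}
    (L_add : ∀ i v w, L i (v + w) =ᵐ[μ] fun x => L i v x + L i w x)
    (L_smul : ∀ i (c : ℝ) v, L i (c • v) =ᵐ[μ] fun x => c * L i v x) {ℓ : ℕ} {ω : Fin ℓ → I}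
    {g : X → ℝ} (hint : ∀ v : Fin ℓ → W, Integrable (fun x => g x * ∏ n, L (ω n) (v n) x) μ)
    {C : ℝ} (hC : 0 ≤ C)
    (hbd : ∀ v : Fin ℓ → W, |∫ x, g x * ∏ n, L (ω n) (v n) x ∂μ| ≤ C * ∏ n, ‖v n‖) :
    (∀ v, integralForm μ L ω g v = ∫ x, g x * ∏ n, L (ω n) (v n) x ∂μ) ∧
      ‖integralForm μ L ω g‖ ≤ C := by
  have key : ∃ A : ContinuousMultilinearMap ℝ (fun _ : Fin ℓ => W) ℝ,
      ∀ v, A v = ∫ x, g x * ∏ n, L (ω n) (v n) x ∂μ := by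
    let A : MultilinearMap ℝ (fun _ : Fin ℓ => W) ℝ :=
      { toFun := fun v => ∫ x, g x * ∏ n, L (ω n) (v n) x ∂μ
        map_update_add' := by
          intro inst v i a b
          obtain rfl := Subsingleton.elim inst (instDecidableEqFin ℓ)
          rw [← integral_add (hint _) (hint _)]
          refine integral_congr_ae ?_
          filter_upwards [L_add (ω i) a b] with x hx
          rw [prod_apply_update (fun n w => L (ω n) w x), prod_apply_update (fun n w => L (ω n) w x),
            prod_apply_update (fun n w => L (ω n) w x), hx]
          ring
        map_update_smul' := by
          intro inst v i c a
          obtain rfl := Subsingleton.elim inst (instDecidableEqFin ℓ)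
          rw [smul_eq_mul, ← integral_const_mul]
          refine integral_congr_ae ?_
          filter_upwards [L_smul (ω i) c a] with x hx
          rw [prod_apply_update (fun n w => L (ω n) w x), prod_apply_update (fun n w => L (ω n) w x),
            hx]
          ring }
    exact ⟨A.mkContinuous C hbd, fun v => rfl⟩
  have happ : ∀ v, integralForm μ L ω g v = ∫ x, g x * ∏ n, L (ω n) (v n) x ∂μ := by
    rw [integralForm, dif_pos key]
    exact key.choose_spec
  refine ⟨happ, ContinuousMultilinearMap.opNorm_le_bound hC fun v => ?_⟩
  rw [happ]
  exact hbd v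

/-- On a convex set, a family of continuous multilinear forms that are the successive derivatives
along all segments is a Taylor series. -/
theorem contDiffOn_of_hasDerivAt_segment {K : Set W} (hK : Convex ℝ K) {k : ℕ} {f : W → ℝ}
    (hk : 1 ≤ k)
    (p : W → ∀ ℓ : ℕ, ContinuousMultilinearMap ℝ (fun _ : Fin ℓ => W) ℝ) (hp0 : ∀ u ∈ K, p u 0 Fin.elim0 = f u)
    (hcont : ∀ ℓ, 1 ≤ ℓ → ℓ ≤ k → ContinuousOn (fun u => p u ℓ) K)
    (hseg : ∀ u ∈ K, ∀ v ∈ K, ContinuousOn (fun t : ℝ => f (u + t • (v - u))) (Icc 0 1))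
    (hder : ∀ ℓ < k, ∀ u ∈ K, ∀ v ∈ K, ∀ w : Fin ℓ → W, ∀ t ∈ Ioo (0 : ℝ) 1,
      HasDerivAt (fun t : ℝ => p (u + t • (v - u)) ℓ w)
        (p (u + t • (v - u)) (ℓ + 1) (Fin.cons (v - u) w)) t) :
    ContDiffOn ℝ k f K := by
  have hmem : ∀ u ∈ K, ∀ v ∈ K, ∀ t ∈ Icc (0 : ℝ) 1, u + t • (v - u) ∈ K := fun u hu v hv t ht =>
    hK.add_smul_sub_mem hu hv ht
  have hpath : ∀ u v : W, Continuous fun t : ℝ => u + t • (v - u) := fun u v => by fun_prop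
  have hc : ∀ ℓ < k, ∀ u ∈ K, ∀ v ∈ K, ∀ w : Fin ℓ → W,
      ContinuousOn (fun t : ℝ => p (u + t • (v - u)) ℓ w) (Icc 0 1) := by
    intro ℓ hℓ u hu v hv w
    -- Order zero is treated apart: there continuity is known along segments only.
    rcases Nat.eq_zero_or_pos ℓ with rfl | hpos
    · refine (hseg u hu v hv).congr fun t ht => ?_
      change _ = f _
      rw [← hp0 _ (hmem u hu v hv t ht), Subsingleton.elim w Fin.elim0]
    · have h1 : ContinuousOn (fun t : ℝ => p (u + t • (v - u)) ℓ) (Icc 0 1) :=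
        (hcont ℓ hpos hℓ.le).comp (hpath u v).continuousOn (fun t ht => hmem u hu v hv t ht)
      exact (ContinuousMultilinearMap.apply ℝ (fun _ : Fin ℓ => W) ℝ w).continuous.comp_continuousOn h1
  have hfd : ∀ ℓ < k, ∀ u ∈ K, HasFDerivWithinAt (fun u => p u ℓ) (p u (ℓ + 1)).curryLeft K u := by
    intro ℓ hℓ u hu
    rw [hasFDerivWithinAt_iff_isLittleO, Asymptotics.isLittleO_iff]
    intro ε hε
    have h1 := hcont (ℓ + 1) (by omega) hℓ u hu
    rw [Metric.continuousWithinAt_iff] at h1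
    obtain ⟨δ, hδ, h1⟩ := h1 ε hε
    filter_upwards [inter_mem_nhdsWithin K (Metric.ball_mem_nhds u hδ)] with v hv
    refine ContinuousMultilinearMap.opNorm_le_bound (by positivity) fun w => ?_
    -- The intermediate point depends on `w`, but the bound `ε` on the increment of the next
    -- coefficient holds on the whole segment.
    obtain ⟨ξ, hξ, hslope⟩ := exists_hasDerivAt_eq_slope (fun t : ℝ => p (u + t • (v - u)) ℓ w) _
      zero_lt_one (hc ℓ hℓ u hu v hv.1 w) (hder ℓ hℓ u hu v hv.1 w)
    simp only [zero_smul, add_zero, one_smul, add_sub_cancel, sub_zero, div_one] at hslope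
    have hd : dist (u + ξ • (v - u)) u < δ := by
      rw [dist_eq_norm, add_sub_cancel_left, norm_smul, Real.norm_of_nonneg hξ.1.le]
      have h2 : ‖v - u‖ < δ := by simpa [dist_eq_norm] using hv.2
      nlinarith [norm_nonneg (v - u), hξ.2]
    have h3 := h1 (hmem u hu v hv.1 ξ ⟨hξ.1.le, hξ.2.le⟩) hd
    have h4 : (p v ℓ - p u ℓ - (p u (ℓ + 1)).curryLeft (v - u)) w =
        (p (u + ξ • (v - u)) (ℓ + 1) - p u (ℓ + 1)) (Fin.cons (v - u) w) := by
      simp only [_root_.sub_apply, ContinuousMultilinearMap.curryLeft_apply]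
      rw [hslope]
    rw [h4]
    refine (ContinuousMultilinearMap.le_opNorm _ _).trans ?_
    rw [Fin.prod_univ_succ, mul_assoc]
    simp only [Fin.cons_zero, Fin.cons_succ]
    rw [dist_eq_norm] at h3
    gcongr
  have hT : HasFTaylorSeriesUpToOn k f (fun u => p u) K := by
    refine ⟨fun u hu => ?_, fun m hm u hu => ?_, fun m hm => ?_⟩
    · rw [← hp0 u hu, ContinuousMultilinearMap.curry0]
      congr 1
      exact Subsingleton.elim _ _
    · exact hfd m (by exact_mod_cast hm) u hu
    · rcases Nat.eq_zero_or_pos m with rfl | h0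
      -- Continuity at order zero on all of `K` is not assumed; it follows from differentiability.
      · exact fun u hu => (hfd 0 hk u hu).continuousWithinAt
      · exact hcont m h0 (by exact_mod_cast hm)
  exact hT.contDiffOn

namespace SmoothIntegrand

variable {μ : Measure X} {K : Set W} {k : ℕ} {q : ℝ≥0∞} {L : I → W → X → ℝ}
  {G : ∀ ℓ, (Fin ℓ → I) → W → X → ℝ} {M : ∀ ℓ, (Fin ℓ → I) → ℝ}

theorem segment_mem (H : SmoothIntegrand μ K k q L G M) {u v : W} (hu : u ∈ K) (hv : v ∈ K) {t : ℝ}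
    (ht : t ∈ Icc (0 : ℝ) 1) : u + t • (v - u) ∈ K :=
  H.convex.add_smul_sub_mem hu hv ht

/-- The constant depends on neither `ω` nor `g`. The first makes the forms summable over `ω`; the
second allows `g` to be a difference of two coefficients, which gives continuity in `u`. -/
theorem exists_form_bound (H : SmoothIntegrand μ K k q L G M) {ℓ : ℕ} (h1 : 1 ≤ ℓ) (hk : ℓ ≤ k) :
    ∃ C : ℝ≥0, ∀ (ω : Fin ℓ → I) (g : X → ℝ), AEStronglyMeasurable g μ → eLpNorm g q μ ≠ ∞ →
      (∀ v : Fin ℓ → W, Integrable (fun x => g x * ∏ n, L (ω n) (v n) x) μ) ∧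
      (∀ v : Fin ℓ → W, integralForm μ L ω g v = ∫ x, g x * ∏ n, L (ω n) (v n) x ∂μ) ∧
      ‖integralForm μ L ω g‖ ≤ C * (eLpNorm g q μ).toReal := by
  obtain ⟨C, hC⟩ := H.hoelder ℓ h1 hk
  refine ⟨C, fun ω g hg hfin => ?_⟩
  have hmeas : ∀ v : Fin ℓ → W, AEStronglyMeasurable (fun x => g x * ∏ n, L (ω n) (v n) x) μ :=
    fun v => hg.mul (Finset.aestronglyMeasurable_fun_prod _ fun n _ => H.L_meas _ _)
  have hlt : ∀ v : Fin ℓ → W, (C * eLpNorm g q μ * ∏ n, ‖v n‖ₑ : ℝ≥0∞) ≠ ∞ := fun v =>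
    ENNReal.mul_ne_top (ENNReal.mul_ne_top ENNReal.coe_ne_top hfin)
      (ENNReal.prod_ne_top fun n _ => enorm_ne_top)
  have hint : ∀ v : Fin ℓ → W, Integrable (fun x => g x * ∏ n, L (ω n) (v n) x) μ := fun v =>
    ⟨hmeas v, (hC ω v g hg).trans_lt (hlt v).lt_top⟩
  refine ⟨hint, integralForm_apply_of_bound H.L_add H.L_smul hint (by positivity) fun v => ?_⟩
  rw [← Real.norm_eq_abs]
  refine (norm_integral_le_lintegral_norm _).trans ?_
  have h2 : (C * eLpNorm g q μ * ∏ n, ‖v n‖ₑ : ℝ≥0∞).toReal =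
      C * (eLpNorm g q μ).toReal * ∏ n, ‖v n‖ := by
    simp [ENNReal.toReal_mul, ENNReal.toReal_prod]
  rw [← h2]
  refine ENNReal.toReal_mono (hlt v) (le_of_eq_of_le ?_ (hC ω v g hg))
  simp only [ofReal_norm]

theorem bound_at (H : SmoothIntegrand μ K k q L G M) {ℓ : ℕ} (h1 : 1 ≤ ℓ) (hk : ℓ ≤ k)
    (ω : Fin ℓ → I) {u : W} (hu : u ∈ K) : ∀ᵐ x ∂μ, |G ℓ ω u x| ≤ M ℓ ω := by
  filter_upwards [H.G_bound ℓ h1 hk ω u hu u hu] with x hx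
  simpa using hx 0 (by simp)

theorem eLpNorm_le (H : SmoothIntegrand μ K k q L G M) {ℓ : ℕ} (h1 : 1 ≤ ℓ) (hk : ℓ ≤ k)
    (ω : Fin ℓ → I) {u : W} (hu : u ∈ K) :
    eLpNorm (G ℓ ω u) q μ ≤ ENNReal.ofReal (M ℓ ω) * eLpNorm (fun _ : X => (1 : ℝ)) q μ := by
  have h2 := eLpNorm_le_mul_eLpNorm_of_ae_le_mul (f := G ℓ ω u) (g := fun _ : X => (1 : ℝ))
    (c := M ℓ ω) (μ := μ) (by simpa using H.bound_at h1 hk ω hu) q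
  exact h2

theorem eLpNorm_ne_top (H : SmoothIntegrand μ K k q L G M) {ℓ : ℕ} (h1 : 1 ≤ ℓ) (hk : ℓ ≤ k)
    (ω : Fin ℓ → I) {u : W} (hu : u ∈ K) : eLpNorm (G ℓ ω u) q μ ≠ ∞ :=
  ((H.eLpNorm_le h1 hk ω hu).trans_lt (ENNReal.mul_ne_top ENNReal.ofReal_ne_top H.one_fin).lt_top).ne

theorem exists_norm_form_le (H : SmoothIntegrand μ K k q L G M) {ℓ : ℕ} (h1 : 1 ≤ ℓ) (hk : ℓ ≤ k) :
    ∃ C : ℝ, 0 ≤ C ∧ ∀ (ω : Fin ℓ → I), ∀ u ∈ K, ‖integralForm μ L ω (G ℓ ω u)‖ ≤ C * M ℓ ω := by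
  obtain ⟨C, hC⟩ := H.exists_form_bound h1 hk
  refine ⟨C * (eLpNorm (fun _ : X => (1 : ℝ)) q μ).toReal, by positivity, fun ω u hu => ?_⟩
  refine (hC ω _ (H.G_meas ℓ hk ω u hu) (H.eLpNorm_ne_top h1 hk ω hu)).2.2.trans ?_
  have h2 := ENNReal.toReal_mono (ENNReal.mul_ne_top ENNReal.ofReal_ne_top H.one_fin)
    (H.eLpNorm_le h1 hk ω hu)
  rw [ENNReal.toReal_mul, ENNReal.toReal_ofReal (H.M_nonneg ℓ ω)] at h2
  calc (C : ℝ) * _ ≤ C * (M ℓ ω * (eLpNorm (fun _ : X => (1 : ℝ)) q μ).toReal) := by gcongr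
    _ = _ := by ring

/-- Uniform convergence of the series is given by the majorants `M`. Each term is continuous because
the form is linear in its coefficient, with norm bounded by the `L^q` norm of the coefficient. -/
theorem continuousOn_tsum_form (H : SmoothIntegrand μ K k q L G M) {ℓ : ℕ} (h1 : 1 ≤ ℓ)
    (hk : ℓ ≤ k) : ContinuousOn (fun u => ∑' ω, integralForm μ L ω (G ℓ ω u)) K := by
  obtain ⟨C, hC⟩ := H.exists_form_bound h1 hk
  obtain ⟨C', -, hC'⟩ := H.exists_norm_form_le h1 hk
  refine continuousOn_tsum (fun ω u hu => ?_) ((H.M_summable ℓ h1 hk).mul_left C')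
    fun ω u hu => hC' ω u hu
  rw [ContinuousWithinAt, tendsto_iff_norm_sub_tendsto_zero]
  have hT := H.G_tendsto ℓ h1 hk ω u hu
  have hT' : Tendsto (fun u' => (C : ℝ) * (eLpNorm (fun x => G ℓ ω u' x - G ℓ ω u x) q μ).toReal)
      (𝓝[K] u) (𝓝 0) := by
    simpa using ((ENNReal.tendsto_toReal ENNReal.zero_ne_top).comp hT).const_mul (C : ℝ)
  refine squeeze_zero' (Eventually.of_forall fun _ => norm_nonneg _) ?_ hT'
  have hfin : ∀ᶠ u' in 𝓝[K] u, eLpNorm (fun x => G ℓ ω u' x - G ℓ ω u x) q μ < ∞ :=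
    hT.eventually (gt_mem_nhds ENNReal.zero_lt_top)
  filter_upwards [hfin, self_mem_nhdsWithin] with u' hu'fin hu'
  obtain ⟨i1, a1, -⟩ := hC ω _ (H.G_meas ℓ hk ω u hu) (H.eLpNorm_ne_top h1 hk ω hu)
  obtain ⟨i2, a2, -⟩ := hC ω _ (H.G_meas ℓ hk ω u' hu') (H.eLpNorm_ne_top h1 hk ω hu')
  obtain ⟨i3, a3, n3⟩ := hC ω _ ((H.G_meas ℓ hk ω u' hu').sub (H.G_meas ℓ hk ω u hu)) hu'fin.ne
  refine le_of_eq_of_le (congrArg _ ?_) n3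
  ext v
  rw [_root_.sub_apply, a1, a2, a3, ← integral_sub (i2 v) (i1 v)]
  congr 1
  funext x
  simp only [Pi.sub_apply]
  ring

/-- The majorant for differentiation under the integral: the Hölder bound with `g = 1`, summed
against `M`. It does not involve the parameter along the segment, since `M` does not. -/
theorem exists_bound (H : SmoothIntegrand μ K k q L G M) [Countable I] {ℓ : ℕ} (hk : ℓ < k)
    (ω : Fin ℓ → I) (c : W) (w : Fin ℓ → W) :
    (∑' i, ∫⁻ x, ENNReal.ofReal (M (ℓ + 1) (Fin.cons i ω)) *
      ‖L i c x * ∏ n, L (ω n) (w n) x‖ₑ ∂μ) ≠ ∞ ∧ ∃ b : X → ℝ, Integrable b μ ∧ ∀ᵐ x ∂μ,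
      Summable (fun i => M (ℓ + 1) (Fin.cons i ω) * |L i c x * ∏ n, L (ω n) (w n) x|) ∧
      ∑' i, M (ℓ + 1) (Fin.cons i ω) * |L i c x * ∏ n, L (ω n) (w n) x| ≤ b x := by
  obtain ⟨C, hC⟩ := H.hoelder (ℓ + 1) (by omega) hk
  have hm : ∀ i, AEStronglyMeasurable (fun x => L i c x * ∏ n, L (ω n) (w n) x) μ := fun i =>
    (H.L_meas _ _).mul (Finset.aestronglyMeasurable_fun_prod _ fun n _ => H.L_meas _ _)
  have hm' : ∀ i, AEMeasurable (fun x => ENNReal.ofReal (M (ℓ + 1) (Fin.cons i ω)) *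
      ‖L i c x * ∏ n, L (ω n) (w n) x‖ₑ) μ := fun i => ((hm i).enorm).const_mul _
  have hle : ∀ i, ∫⁻ x, ENNReal.ofReal (M (ℓ + 1) (Fin.cons i ω)) *
      ‖L i c x * ∏ n, L (ω n) (w n) x‖ₑ ∂μ ≤ ENNReal.ofReal (M (ℓ + 1) (Fin.cons i ω)) *
      (C * eLpNorm (fun _ : X => (1 : ℝ)) q μ * (‖c‖ₑ * ∏ n, ‖w n‖ₑ)) := by
    intro i
    rw [lintegral_const_mul'' _ (hm i).enorm]
    gcongr
    have h := hC (Fin.cons i ω) (Fin.cons c w) (fun _ => (1 : ℝ)) aestronglyMeasurable_const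
    simpa only [one_mul, Fin.prod_univ_succ, Fin.cons_zero, Fin.cons_succ] using h
  have hS : Summable fun i => M (ℓ + 1) (Fin.cons i ω) :=
    (H.M_summable (ℓ + 1) (by omega) hk).comp_injective
      (i := fun i : I => (Fin.cons i ω : Fin (ℓ + 1) → I)) (fun i j h => by
        simpa using congrFun h 0)
  have hfin : (∑' i, ∫⁻ x, ENNReal.ofReal (M (ℓ + 1) (Fin.cons i ω)) *
      ‖L i c x * ∏ n, L (ω n) (w n) x‖ₑ ∂μ) ≠ ∞ := by
    refine ((ENNReal.tsum_le_tsum hle).trans_lt ?_).ne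
    rw [ENNReal.tsum_mul_right]
    refine ENNReal.mul_lt_top ?_ ?_
    · rw [← ENNReal.ofReal_tsum_of_nonneg (fun i => H.M_nonneg _ _) hS]
      exact ENNReal.ofReal_lt_top
    · exact ENNReal.mul_lt_top (ENNReal.mul_lt_top ENNReal.coe_lt_top H.one_fin.lt_top)
        (ENNReal.mul_lt_top enorm_lt_top (ENNReal.prod_lt_top fun n _ => enorm_lt_top))
  refine ⟨hfin, fun x => (∑' i, ENNReal.ofReal (M (ℓ + 1) (Fin.cons i ω)) *
      ‖L i c x * ∏ n, L (ω n) (w n) x‖ₑ).toReal, ?_, ?_⟩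
  · refine integrable_toReal_of_lintegral_ne_top (AEMeasurable.tsum hm') ?_
    rwa [lintegral_tsum hm']
  · have hae := ae_lt_top' (AEMeasurable.tsum hm') (by rwa [lintegral_tsum hm'])
    filter_upwards [hae] with x hx
    have heq : ∀ i, (ENNReal.ofReal (M (ℓ + 1) (Fin.cons i ω)) *
      ‖L i c x * ∏ n, L (ω n) (w n) x‖ₑ).toReal =
        M (ℓ + 1) (Fin.cons i ω) * |L i c x * ∏ n, L (ω n) (w n) x| := by
      intro i
      rw [ENNReal.toReal_mul, ENNReal.toReal_ofReal (H.M_nonneg _ _), toReal_enorm,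
        Real.norm_eq_abs]
    have hne := ENNReal.ne_top_of_tsum_ne_top hx.ne
    refine ⟨?_, le_of_eq ?_⟩
    · exact (ENNReal.summable_toReal hx.ne).congr fun i => heq i
    · rw [ENNReal.tsum_toReal_eq hne]
      exact tsum_congr fun i => (heq i).symm

theorem abs_tsum_le {X W I : Type*} {L : I → W → X → ℝ} {G : ∀ ℓ, (Fin ℓ → I) → W → X → ℝ}
    {M : ∀ ℓ, (Fin ℓ → I) → ℝ} {ℓ : ℕ}
    {ω : Fin ℓ → I} {c u : W} {w : Fin ℓ → W} {x : X} {b : ℝ}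
    (hS : Summable (fun i => M (ℓ + 1) (Fin.cons i ω) * |L i c x * ∏ n, L (ω n) (w n) x|))
    (hb : ∑' i, M (ℓ + 1) (Fin.cons i ω) * |L i c x * ∏ n, L (ω n) (w n) x| ≤ b)
    (hG : ∀ i, |G (ℓ + 1) (Fin.cons i ω) u x| ≤ M (ℓ + 1) (Fin.cons i ω)) :
    Summable (fun i => L i c x * G (ℓ + 1) (Fin.cons i ω) u x * ∏ n, L (ω n) (w n) x) ∧
    |(∑' i, L i c x * G (ℓ + 1) (Fin.cons i ω) u x) * ∏ n, L (ω n) (w n) x| ≤ b := by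
  have hle : ∀ i, ‖L i c x * G (ℓ + 1) (Fin.cons i ω) u x * ∏ n, L (ω n) (w n) x‖ ≤
      M (ℓ + 1) (Fin.cons i ω) * |L i c x * ∏ n, L (ω n) (w n) x| := by
    intro i
    rw [mul_right_comm, mul_comm, norm_mul, Real.norm_eq_abs, Real.norm_eq_abs]
    exact mul_le_mul_of_nonneg_right (hG i) (abs_nonneg _)
  refine ⟨Summable.of_norm_bounded hS hle, ?_⟩
  rw [← tsum_mul_right, ← Real.norm_eq_abs]
  exact (tsum_of_norm_bounded hS.hasSum hle).trans hb

/-- No majorant is assumed at order zero. Integrability at one base point spreads to `K`, because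
the mean value theorem bounds the increment by the majorant of the first-order series. -/
theorem integrable_zero (H : SmoothIntegrand μ K k q L G M) [Countable I] (hk : 1 ≤ k) {u : W}
    (hu : u ∈ K) : Integrable (G 0 Fin.elim0 u) μ := by
  obtain ⟨u₀, hu₀, hint⟩ := H.G_int
  obtain ⟨-, b, hb, hbS⟩ := H.exists_bound hk Fin.elim0 (u - u₀) Fin.elim0
  have hd : Integrable (fun x => G 0 Fin.elim0 u x - G 0 Fin.elim0 u₀ x) μ := by
    refine hb.mono' ((H.G_meas 0 (by omega) _ u hu).sub (H.G_meas 0 (by omega) _ u₀ hu₀)) ?_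
    have hG := ae_all_iff.2 fun i =>
      H.G_bound 1 le_rfl hk (Fin.cons i Fin.elim0) u₀ hu₀ u hu
    filter_upwards [hbS, H.G_cont u₀ hu₀ u hu, H.G_deriv 0 hk Fin.elim0 u₀ hu₀ u hu, hG]
      with x hx hc hdx hGx
    obtain ⟨ξ, hξ, h⟩ := exists_hasDerivAt_eq_slope _ _ zero_lt_one hc hdx
    simp only [zero_smul, add_zero, one_smul, add_sub_cancel, sub_zero, div_one] at h
    rw [← h]
    have h2 := (abs_tsum_le (u := u₀ + ξ • (u - u₀)) hx.1 hx.2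
      (fun i => hGx i ξ ⟨hξ.1.le, hξ.2.le⟩)).2
    simpa using h2
  refine (hd.add hint).congr (Eventually.of_forall fun x => ?_)
  simp

theorem continuousOn_integral_segment (H : SmoothIntegrand μ K k q L G M) [Countable I]
    (hk : 1 ≤ k) {u v : W} (hu : u ∈ K) (hv : v ∈ K) :
    ContinuousOn (fun t : ℝ => ∫ x, G 0 Fin.elim0 (u + t • (v - u)) x ∂μ) (Icc 0 1) := by
  obtain ⟨-, b, hb, hbS⟩ := H.exists_bound hk Fin.elim0 (v - u) Fin.elim0
  have hG := ae_all_iff.2 fun i =>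
    H.G_bound 1 le_rfl hk (Fin.cons i Fin.elim0) u hu v hv
  have hall : ∀ᵐ x ∂μ, ∀ t ∈ Icc (0 : ℝ) 1,
      ‖G 0 Fin.elim0 (u + t • (v - u)) x‖ ≤ |G 0 Fin.elim0 u x| + b x := by
    filter_upwards [hbS, H.G_cont u hu v hv, H.G_deriv 0 hk Fin.elim0 u hu v hv, hG]
      with x hx hc hdx hGx t ht
    have hb0 : ∀ ξ ∈ Icc (0 : ℝ) 1, |∑' i, L i (v - u) x *
        G 1 (Fin.cons i Fin.elim0) (u + ξ • (v - u)) x| ≤ b x := fun ξ hξ => by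
      simpa using (abs_tsum_le (u := u + ξ • (v - u)) hx.1 hx.2 (fun i => hGx i ξ hξ)).2
    have hb1 : 0 ≤ b x := (abs_nonneg _).trans (hb0 0 (by simp))
    rcases ht.1.eq_or_lt with h0 | h0
    · rw [← h0]
      simpa using hb1
    -- The mean value theorem on `[0, t]` gives one integrable majorant for all `t`.
    · obtain ⟨ξ, hξ, h⟩ := exists_hasDerivAt_eq_slope _ _ h0
        (hc.mono (Icc_subset_Icc_right ht.2)) (fun s hs => hdx s ⟨hs.1, hs.2.trans_le ht.2⟩)
      have h3 := hb0 ξ ⟨hξ.1.le, hξ.2.le.trans ht.2⟩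
      simp only [zero_smul, add_zero, sub_zero] at h
      rw [eq_div_iff h0.ne'] at h
      have h4 : G 0 Fin.elim0 (u + t • (v - u)) x = G 0 Fin.elim0 u x + (∑' i, L i (v - u) x *
        G 1 (Fin.cons i Fin.elim0) (u + ξ • (v - u)) x) * t := by
        exact (eq_add_of_sub_eq' h.symm)
      rw [h4]
      refine (norm_add_le _ _).trans (add_le_add le_rfl ?_)
      rw [norm_mul, Real.norm_eq_abs, Real.norm_of_nonneg ht.1]
      exact (mul_le_of_le_one_right (abs_nonneg _) ht.2).trans h3
  refine continuousOn_of_dominated (fun t ht => H.G_meas 0 (by omega) _ _ (H.segment_mem hu hv ht))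
    (bound := fun x => |G 0 Fin.elim0 u x| + b x) (fun t ht => ?_)
    ((H.integrable_zero hk hu).abs.add hb) (H.G_cont u hu v hv)
  filter_upwards [hall] with x hx using hx t ht

theorem integrable_mul_prod (H : SmoothIntegrand μ K k q L G M) [Countable I] (hk : 1 ≤ k) {ℓ : ℕ}
    (hℓ : ℓ ≤ k) (ω : Fin ℓ → I) {u : W} (hu : u ∈ K) (w : Fin ℓ → W) :
    Integrable (fun x => G ℓ ω u x * ∏ n, L (ω n) (w n) x) μ := by
  rcases Nat.eq_zero_or_pos ℓ with rfl | hpos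
  · rw [Subsingleton.elim ω Fin.elim0]
    simpa using H.integrable_zero hk hu
  · obtain ⟨C, hC⟩ := H.exists_form_bound hpos hℓ
    exact (hC ω _ (H.G_meas ℓ hℓ ω u hu) (H.eLpNorm_ne_top hpos hℓ ω hu)).1 w

theorem form_apply (H : SmoothIntegrand μ K k q L G M) {ℓ : ℕ}
    (hℓ : ℓ ≤ k) (ω : Fin ℓ → I) {u : W} (hu : u ∈ K) (w : Fin ℓ → W) :
    integralForm μ L ω (G ℓ ω u) w = ∫ x, G ℓ ω u x * ∏ n, L (ω n) (w n) x ∂μ := by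
  rcases Nat.eq_zero_or_pos ℓ with rfl | hpos
  · have key : ∃ A : ContinuousMultilinearMap ℝ (fun _ : Fin 0 => W) ℝ,
        ∀ v, A v = ∫ x, G 0 ω u x * ∏ n, L (ω n) (v n) x ∂μ :=
      ⟨ContinuousMultilinearMap.constOfIsEmpty ℝ _ (∫ x, G 0 ω u x ∂μ), fun v => by simp⟩
    rw [integralForm, dif_pos key]
    exact key.choose_spec w
  · obtain ⟨C, hC⟩ := H.exists_form_bound hpos hℓ
    exact (hC ω _ (H.G_meas ℓ hℓ ω u hu) (H.eLpNorm_ne_top hpos hℓ ω hu)).2.1 w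

/-- Differentiation under the integral produces the integral of a series over the new coordinate
`i`; the same majorant justifies exchanging that series with the integral. -/
theorem hasDerivAt_form_segment (H : SmoothIntegrand μ K k q L G M) [Countable I] {ℓ : ℕ}
    (hk : ℓ < k) (ω : Fin ℓ → I) {u v : W} (hu : u ∈ K) (hv : v ∈ K) (w : Fin ℓ → W) {t : ℝ}
    (ht : t ∈ Ioo (0 : ℝ) 1) :
    HasDerivAt (fun t : ℝ => integralForm μ L ω (G ℓ ω (u + t • (v - u))) w)
      (∑' i, integralForm μ L (Fin.cons i ω : Fin (ℓ + 1) → I)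
        (G (ℓ + 1) (Fin.cons i ω) (u + t • (v - u))) (Fin.cons (v - u) w)) t := by
  obtain ⟨hfin, b, hb, hbS⟩ := H.exists_bound hk ω (v - u) w
  have hG := ae_all_iff.2 fun i => H.G_bound (ℓ + 1) (by omega) hk (Fin.cons i ω) u hu v hv
  have hIcc : ∀ {s : ℝ}, s ∈ Ioo (0 : ℝ) 1 → s ∈ Icc (0 : ℝ) 1 := fun hs => Ioo_subset_Icc_self hs
  have hutK := H.segment_mem hu hv (hIcc ht)
  have hLm : AEStronglyMeasurable (fun x => ∏ n, L (ω n) (w n) x) μ :=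
    Finset.aestronglyMeasurable_fun_prod _ fun n _ => H.L_meas _ _
  have htm : ∀ i, AEStronglyMeasurable (fun x => L i (v - u) x *
      G (ℓ + 1) (Fin.cons i ω) (u + t • (v - u)) x * ∏ n, L (ω n) (w n) x) μ := fun i =>
    ((H.L_meas _ _).mul (H.G_meas (ℓ + 1) hk _ _ hutK)).mul hLm
  have hsum : ∀ᵐ x ∂μ, Summable fun i => L i (v - u) x *
      G (ℓ + 1) (Fin.cons i ω) (u + t • (v - u)) x * ∏ n, L (ω n) (w n) x := by
    filter_upwards [hbS, hG] with x hx hGx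
    exact (abs_tsum_le hx.1 hx.2 (fun i => hGx i t (hIcc ht))).1
  have main := (hasDerivAt_integral_of_dominated_loc_of_deriv_le (μ := μ)
    (F := fun (s : ℝ) x => G ℓ ω (u + s • (v - u)) x * ∏ n, L (ω n) (w n) x)
    (F' := fun (s : ℝ) x => (∑' i, L i (v - u) x *
      G (ℓ + 1) (Fin.cons i ω) (u + s • (v - u)) x) * ∏ n, L (ω n) (w n) x)
    (bound := b) (Ioo_mem_nhds ht.1 ht.2) ?_ ?_ ?_ ?_ hb ?_).2
  · have h1 : ∫ x, (∑' i, L i (v - u) x * G (ℓ + 1) (Fin.cons i ω) (u + t • (v - u)) x) *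
        ∏ n, L (ω n) (w n) x ∂μ = ∑' i, integralForm μ L (Fin.cons i ω : Fin (ℓ + 1) → I)
        (G (ℓ + 1) (Fin.cons i ω) (u + t • (v - u))) (Fin.cons (v - u) w) := by
      simp_rw [← tsum_mul_right]
      rw [integral_tsum htm]
      · refine tsum_congr fun i => ?_
        rw [H.form_apply hk _ hutK]
        congr 1
        funext x
        rw [Fin.prod_univ_succ]
        simp only [Fin.cons_zero, Fin.cons_succ]
        ring
      · refine (lt_of_le_of_lt (ENNReal.tsum_le_tsum fun i => ?_) hfin.lt_top).ne
        refine lintegral_mono_ae ?_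
        filter_upwards [hG] with x hGx
        rw [mul_right_comm, mul_comm, enorm_mul]
        gcongr
        rw [← ofReal_norm]
        exact ENNReal.ofReal_le_ofReal (hGx i t (hIcc ht))
    rw [h1] at main
    refine main.congr_of_eventuallyEq ?_
    filter_upwards [Ioo_mem_nhds ht.1 ht.2] with s hs
    exact H.form_apply hk.le ω (H.segment_mem hu hv (hIcc hs)) w
  · filter_upwards [Ioo_mem_nhds ht.1 ht.2] with s hs
    exact (H.G_meas ℓ hk.le _ _ (H.segment_mem hu hv (hIcc hs))).mul hLm
  · exact H.integrable_mul_prod (by omega) hk.le ω hutK w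
  · simp_rw [← tsum_mul_right]
    refine aestronglyMeasurable_of_tendsto_ae (u := (atTop : Filter (Finset I)))
      (f := fun F x => ∑ i ∈ F, L i (v - u) x *
      G (ℓ + 1) (Fin.cons i ω) (u + t • (v - u)) x * ∏ n, L (ω n) (w n) x)
      (fun F => Finset.aestronglyMeasurable_fun_sum _ fun i _ => htm i) ?_
    filter_upwards [hsum] with x hx using hx.hasSum
  · filter_upwards [hbS, hG] with x hx hGx s hs
    exact (abs_tsum_le hx.1 hx.2 (fun i => hGx i s (hIcc hs))).2
  · filter_upwards [H.G_deriv ℓ hk ω u hu v hv] with x hx s hs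
    exact (hx s hs).mul_const _

/-- The series over `ω` is differentiated term by term, with the derivatives dominated uniformly on
the segment by the majorants of order `ℓ + 1`. -/
theorem hasDerivAt_tsum_form_segment (H : SmoothIntegrand μ K k q L G M) [Countable I] {ℓ : ℕ}
    (hk : ℓ < k) {u v : W} (hu : u ∈ K) (hv : v ∈ K) (w : Fin ℓ → W) {t : ℝ}
    (ht : t ∈ Ioo (0 : ℝ) 1) :
    HasDerivAt (fun t : ℝ => ∑' ω, integralForm μ L ω (G ℓ ω (u + t • (v - u))) w)
      (∑' ω, integralForm μ L ω (G (ℓ + 1) ω (u + t • (v - u))) (Fin.cons (v - u) w)) t := by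
  obtain ⟨C, hC0, hC⟩ := H.exists_norm_form_le (ℓ := ℓ + 1) (by omega) hk
  have hK : ∀ s ∈ Ioo (0 : ℝ) 1, u + s • (v - u) ∈ K := fun s hs =>
    H.segment_mem hu hv (Ioo_subset_Icc_self hs)
  -- The derivative of the term `ω` is a sum over `i`; prepending `i` to `ω` turns the double sum
  -- into one over longer tuples.
  let e : (Fin ℓ → I) × I ≃ (Fin (ℓ + 1) → I) :=
    (Equiv.prodComm _ _).trans (Fin.consEquiv fun _ => I)
  have he : ∀ ω i, e (ω, i) = Fin.cons i ω := fun _ _ => rfl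
  set c := ∏ n, ‖(Fin.cons (v - u) w : Fin (ℓ + 1) → W) n‖ with hc
  have hM : Summable fun p => C * M (ℓ + 1) (e p) * c :=
    (((e.summable_iff).2 (H.M_summable (ℓ + 1) (by omega) hk)).mul_left C).mul_right c
  have hterm : ∀ s ∈ Ioo (0 : ℝ) 1, ∀ ω' : Fin (ℓ + 1) → I,
      ‖integralForm μ L ω' (G (ℓ + 1) ω' (u + s • (v - u))) (Fin.cons (v - u) w)‖ ≤
        C * M (ℓ + 1) ω' * c := fun s hs ω' =>
    (ContinuousMultilinearMap.le_opNorm _ _).trans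
      (mul_le_mul_of_nonneg_right (hC ω' _ (hK s hs)) (Finset.prod_nonneg fun _ _ => norm_nonneg _))
  have hsum : Summable fun p => integralForm μ L (e p) (G (ℓ + 1) (e p) (u + t • (v - u)))
      (Fin.cons (v - u) w) := Summable.of_norm_bounded hM fun p => hterm t ht (e p)
  rw [← e.tsum_eq, hsum.tsum_prod]
  refine hasDerivAt_tsum_of_isPreconnected (u := fun ω => ∑' i, C * M (ℓ + 1) (e (ω, i)) * c)
    hM.prod isOpen_Ioo isPreconnected_Ioo
    (fun ω s hs => H.hasDerivAt_form_segment hk ω hu hv w hs) (fun ω s hs => ?_) ht ?_ ht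
  · exact tsum_of_norm_bounded (hM.prod_factor ω).hasSum fun i => hterm s hs _
  · rcases Nat.eq_zero_or_pos ℓ with rfl | hpos
    · exact (hasSum_fintype _).summable
    · obtain ⟨C', -, hC'⟩ := H.exists_norm_form_le hpos hk.le
      refine Summable.of_norm_bounded
        (((H.M_summable ℓ hpos hk.le).mul_left C').mul_right (∏ n, ‖w n‖)) fun ω => ?_
      exact (ContinuousMultilinearMap.le_opNorm _ _).trans
        (mul_le_mul_of_nonneg_right (hC' ω _ (hK t ht)) (Finset.prod_nonneg fun _ _ => norm_nonneg _))

theorem tsum_form_apply (H : SmoothIntegrand μ K k q L G M) {ℓ : ℕ} (hk : ℓ ≤ k) {u : W}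
    (hu : u ∈ K) (w : Fin ℓ → W) : (∑' ω, integralForm μ L ω (G ℓ ω u)) w =
      ∑' ω, integralForm μ L ω (G ℓ ω u) w := by
  have hs : Summable fun ω : Fin ℓ → I => integralForm μ L ω (G ℓ ω u) := by
    rcases Nat.eq_zero_or_pos ℓ with rfl | hpos
    · exact (hasSum_fintype _).summable
    · obtain ⟨C', -, hC'⟩ := H.exists_norm_form_le hpos hk
      exact Summable.of_norm_bounded ((H.M_summable ℓ hpos hk).mul_left C') fun ω => hC' ω u hu
  exact (ContinuousMultilinearMap.apply ℝ (fun _ : Fin ℓ => W) ℝ w).map_tsum hs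

/-- The integral of a smooth integrand is of class `C^k`. -/
theorem contDiffOn_integral (H : SmoothIntegrand μ K k q L G M) [Countable I] (hk : 1 ≤ k) :
    ContDiffOn ℝ k (fun u => ∫ x, G 0 Fin.elim0 u x ∂μ) K := by
  refine contDiffOn_of_hasDerivAt_segment H.convex hk
    (fun u ℓ => ∑' ω, integralForm μ L ω (G ℓ ω u)) (fun u hu => ?_)
    (fun ℓ h1 h2 => H.continuousOn_tsum_form h1 h2)
    (fun u hu v hv => H.continuousOn_integral_segment hk hu hv)
    (fun ℓ hℓ u hu v hv w t ht => ?_)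
  · rw [H.tsum_form_apply (Nat.zero_le k) hu, tsum_fintype, Fintype.sum_unique,
      H.form_apply (Nat.zero_le k) _ hu, Subsingleton.elim default Fin.elim0]
    simp
  · rw [H.tsum_form_apply hℓ (H.segment_mem hu hv (Ioo_subset_Icc_self ht))]
    refine (H.hasDerivAt_tsum_form_segment hℓ hu hv w ht).congr_of_eventuallyEq ?_
    filter_upwards [Ioo_mem_nhds ht.1 ht.2] with s hs
    exact H.tsum_form_apply hℓ.le (H.segment_mem hu hv (Ioo_subset_Icc_self hs)) w

end SmoothIntegrand

end SmoothIntegrand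

/-! ### Calculus for functions of infinitely many stencil entries -/

section Stencils

/-- Smoothness at one point suffices: on a small open set the derivatives within the set are the
ordinary ones. -/
theorem iteratedFDeriv_comp_right_of_contDiffAt {E F G : Type*} [NormedAddCommGroup E]
    [NormedSpace ℝ E] [NormedAddCommGroup F] [NormedSpace ℝ F] [NormedAddCommGroup G]
    [NormedSpace ℝ G] (g : G →L[ℝ] E) {f : E → F} {x : G} {i : ℕ} (hf : ContDiffAt ℝ i f (g x)) :
    iteratedFDeriv ℝ i (f ∘ g) x =
      (iteratedFDeriv ℝ i f (g x)).compContinuousLinearMap fun _ => g := by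
  obtain ⟨u, hu, hfu⟩ := hf.contDiffOn le_rfl (by simp)
  obtain ⟨s, hsu, hs, hxs⟩ := mem_nhds_iff.1 hu
  have hs' : IsOpen (g ⁻¹' s) := hs.preimage g.continuous
  have h := g.iteratedFDerivWithin_comp_right (hfu.mono hsu) hs.uniqueDiffOn hs'.uniqueDiffOn
    (x := x) hxs le_rfl
  rwa [iteratedFDerivWithin_of_isOpen i hs' hxs, iteratedFDerivWithin_of_isOpen i hs hxs] at h

variable {σ : Type*} {d : ℕ}

/-- The linear map `b ↦ ∑ₙ bₙ e_{ωₙ}`. -/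
noncomputable def spread [DecidableEq σ] (d : ℕ) {ℓ : ℕ} (ω : Fin ℓ → σ) :
    (Fin ℓ → Vec d) →ₗ[ℝ] (σ → Vec d) :=
  ∑ n, (LinearMap.single ℝ (fun _ : σ => Vec d) (ω n)) ∘ₗ LinearMap.proj n

theorem spread_apply [DecidableEq σ] {ℓ : ℕ} (ω : Fin ℓ → σ) (b : Fin ℓ → Vec d) :
    spread d ω b = ∑ n, Pi.single (ω n) (b n) := by
  simp [spread, LinearMap.sum_apply]

theorem spread_single [DecidableEq σ] {ℓ : ℕ} (ω : Fin ℓ → σ) (n : Fin ℓ) (x : Vec d) :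
    spread d ω (Pi.single n x) = Pi.single (ω n) x := by
  rw [spread_apply, Finset.sum_eq_single n]
  · simp
  · intro m _ hm
    simp [hm]
  · simp

theorem spread_spread [DecidableEq σ] {ℓ L : ℕ} (ω : Fin L → σ) (ι : Fin ℓ → Fin L)
    (y : Fin ℓ → Vec d) : spread d ω (spread d ι y) = spread d (ω ∘ ι) y := by
  rw [spread_apply ι, map_sum, spread_apply]
  exact Finset.sum_congr rfl fun n _ => spread_single _ _ _

open Classical in
theorem stencilSlice_eq (V : (σ → Vec d) → ℝ) (a : σ → Vec d) {ℓ : ℕ} (ω : Fin ℓ → σ)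
    (b : Fin ℓ → Vec d) : stencilSlice V a ω b = V (a + spread d ω b) := by
  rw [spread_apply]
  rfl

-- All mixed partial derivatives in coordinates selected from `ω`, at points displaced within these
-- coordinates, are read off from a single function of finitely many variables. Statements about
-- several partial derivatives thereby become ordinary calculus.
open Classical in
theorem mixedPartial_add_spread {V : (σ → Vec d) → ℝ} {a : σ → Vec d} {ℓ L : ℕ} {ω : Fin L → σ}
    {b : Fin L → Vec d} (ι : Fin ℓ → Fin L) (hV : ContDiffAt ℝ ℓ (stencilSlice V a ω) b)
    (h : Fin ℓ → Vec d) : mixedPartial V (a + spread d ω b) (ω ∘ ι) h =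
      iteratedFDeriv ℝ ℓ (stencilSlice V a ω) b fun n => Pi.single (ι n) (h n) := by
  let J : (Fin ℓ → Vec d) →L[ℝ] (Fin L → Vec d) := LinearMap.toContinuousLinearMap (spread d ι)
  have hJ : ∀ y, J y = spread d ι y := fun y => rfl
  have h1 : stencilSlice V (a + spread d ω b) (ω ∘ ι) =
      (fun y => stencilSlice V a ω (b + y)) ∘ J := by
    funext y
    simp only [Function.comp_apply, stencilSlice_eq, hJ, map_add, spread_spread]
    rw [add_assoc]
  have h2 : ContDiffAt ℝ ℓ (fun y => stencilSlice V a ω (b + y)) (J 0) := by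
    refine ContDiffAt.comp (g := stencilSlice V a ω) _ ?_ (by fun_prop)
    simpa using hV
  rw [mixedPartial, h1, iteratedFDeriv_comp_right_of_contDiffAt J h2]
  rw [ContinuousMultilinearMap.compContinuousLinearMap_apply, iteratedFDeriv_comp_add_left,
    map_zero, add_zero]
  congr 1
  funext n
  rw [hJ, spread_single]

theorem mixedPartial_eq {V : (σ → Vec d) → ℝ} {a : σ → Vec d} {ℓ L : ℕ} {ω : Fin L → σ}
    (ι : Fin ℓ → Fin L) (hV : ContDiffAt ℝ ℓ (stencilSlice V a ω) 0) (h : Fin ℓ → Vec d) :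
    mixedPartial V a (ω ∘ ι) h =
      iteratedFDeriv ℝ ℓ (stencilSlice V a ω) 0 fun n => Pi.single (ι n) (h n) := by
  classical
  simpa using mixedPartial_add_spread ι hV h

theorem mixedPartial_cons_sum (V : (σ → Vec d) → ℝ) (a : σ → Vec d) {ℓ : ℕ}
    (ω : Fin (ℓ + 1) → σ) (h : Fin ℓ → Vec d) (x : Vec d) :
    mixedPartial V a ω (Fin.cons x h) =
      ∑ i, x i * mixedPartial V a ω (Fin.cons (EuclideanSpace.single i 1) h) := by
  have hlin : ∀ y : Vec d, mixedPartial V a ω (Fin.cons y h) =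
      fderiv ℝ (iteratedFDeriv ℝ ℓ (stencilSlice V a ω)) 0 (Pi.single 0 y)
        (fun n => Pi.single n.succ (h n)) := by
    intro y
    rw [mixedPartial, iteratedFDeriv_succ_apply_left]
    rfl
  simp only [hlin]
  have hx : (Pi.single 0 x : Fin (ℓ + 1) → Vec d) =
      ∑ i, x i • (Pi.single 0 (EuclideanSpace.single i 1) : Fin (ℓ + 1) → Vec d) := by
    have h1 : x = ∑ i, x i • (EuclideanSpace.single i (1 : ℝ) : Vec d) := by
      ext j
      simp [Finset.sum_apply, Pi.single_apply]
    conv_lhs => rw [h1]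
    rw [← LinearMap.single_apply ℝ (φ := fun _ : Fin (ℓ + 1) => Vec d), map_sum]
    simp
  rw [hx, map_sum, _root_.sum_apply]
  refine Finset.sum_congr rfl fun i _ => ?_
  rw [map_smul]
  rfl

/-- One slice holds the coordinates of the direction `c` and those of the partial derivative. In it
the claim is the chain rule for the iterated derivative along the line `t ↦ t • b₀`. -/
theorem hasDerivAt_mixedPartial {k : ℕ} {V : (σ → Vec d) → ℝ} {a : σ → Vec d}
    (hV : ∀ (ℓ : ℕ) (ω : Fin ℓ → σ), ContDiffAt ℝ k (stencilSlice V a ω) 0) {ℓ : ℕ} (hℓ : ℓ < k)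
    (F : Finset σ) {c : σ → Vec d} (hc : ∀ s, s ∉ F → c s = 0) (ω : Fin ℓ → σ)
    (h : Fin ℓ → Vec d) :
    HasDerivAt (fun t : ℝ => mixedPartial V (a + t • c) ω h)
      (∑ s ∈ F, mixedPartial V a (Fin.cons s ω) (Fin.cons (c s) h)) 0 := by
  classical
  let N := F.card
  let e : Fin N ≃ F := F.equivFin.symm
  -- A site may occur both in `F` and in `ω`. This is harmless, as a slice adds the increments of
  -- repeated coordinates.
  let ω' : Fin (N + ℓ) → σ := Fin.append (fun i => (e i : σ)) ω
  let b₀ : Fin (N + ℓ) → Vec d := ∑ i : Fin N, Pi.single (Fin.castAdd ℓ i) (c (e i))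
  have hω' : ω' ∘ Fin.natAdd N = ω := by
    funext i
    simp [ω']
  have hsum : ∀ {β : Type} [AddCommMonoid β] (f : σ → β), ∑ i : Fin N, f (e i) = ∑ s ∈ F, f s := by
    intro β _ f
    rw [← Finset.sum_coe_sort F]
    exact Equiv.sum_comp e (fun s : F => f s)
  have hb₀ : spread d ω' b₀ = c := by
    rw [map_sum]
    simp only [spread_single, ω', Fin.append_left]
    have : ∑ i : Fin N, (Pi.single (e i : σ) (c (e i)) : σ → Vec d) =
        ∑ s ∈ F, (Pi.single s (c s) : σ → Vec d) := by
      rw [← Finset.sum_coe_sort F]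
      exact Equiv.sum_comp e (fun s : F => (Pi.single (s : σ) (c s) : σ → Vec d))
    rw [this]
    funext s
    rw [Finset.sum_apply]
    by_cases hs : s ∈ F
    · rw [Finset.sum_eq_single_of_mem s hs]
      · simp
      · intro r _ hr
        simp [hr.symm]
    · rw [hc s hs]
      refine Finset.sum_eq_zero fun r hr => ?_
      have : s ≠ r := fun h => hs (h ▸ hr)
      simp [this]
  set g := stencilSlice V a ω' with hg
  have hgk : ContDiffAt ℝ k g 0 := hV _ ω'
  have hle : (ℓ : WithTop ℕ∞) ≤ k := by exact_mod_cast hℓ.le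
  set m : Fin ℓ → Fin (N + ℓ) → Vec d := fun n => Pi.single (Fin.natAdd N n) (h n) with hm
  have hev : ∀ᶠ t : ℝ in 𝓝 0, mixedPartial V (a + t • c) ω h = iteratedFDeriv ℝ ℓ g (t • b₀) m := by
    have h1 : Tendsto (fun t : ℝ => t • b₀) (𝓝 0) (𝓝 0) := by
      have : Continuous fun t : ℝ => t • b₀ := by fun_prop
      simpa using this.tendsto 0
    filter_upwards [h1.eventually ((hgk.of_le hle).eventually (by simp))] with t ht
    have h2 := mixedPartial_add_spread (Fin.natAdd N) ht h
    rwa [map_smul, hb₀, hω'] at h2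
  have hD : HasFDerivAt (iteratedFDeriv ℝ ℓ g) (fderiv ℝ (iteratedFDeriv ℝ ℓ g) 0) ((0 : ℝ) • b₀) := by
    rw [zero_smul]
    exact (hgk.differentiableAt_iteratedFDeriv (by exact_mod_cast hℓ)).hasFDerivAt
  have hb : HasDerivAt (fun t : ℝ => t • b₀) b₀ 0 := by
    simpa using (hasDerivAt_id (0 : ℝ)).smul_const b₀
  have h3 := hD.comp_hasDerivAt (0 : ℝ) hb
  have h4 := ((ContinuousMultilinearMap.apply ℝ (fun _ : Fin ℓ => Fin (N + ℓ) → Vec d) ℝ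
    m).hasFDerivAt).comp_hasDerivAt (0 : ℝ) h3
  have h5 : HasDerivAt (fun t : ℝ => mixedPartial V (a + t • c) ω h)
      (fderiv ℝ (iteratedFDeriv ℝ ℓ g) 0 b₀ m) 0 := h4.congr_of_eventuallyEq hev
  convert h5 using 1
  rw [← hsum (fun s => mixedPartial V a (Fin.cons s ω) (Fin.cons (c s) h)), map_sum,
    _root_.sum_apply]
  refine Finset.sum_congr rfl fun i _ => ?_
  have h6 : (Fin.cons (e i : σ) ω : Fin (ℓ + 1) → σ) =
      ω' ∘ (Fin.cons (Fin.castAdd ℓ i) (Fin.natAdd N) : Fin (ℓ + 1) → Fin (N + ℓ)) := by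
    funext n
    refine Fin.cases ?_ (fun n => ?_) n
    · simp [ω']
    · simp [ω']
  rw [h6, mixedPartial_eq _ (hgk.of_le (by exact_mod_cast hℓ)), iteratedFDeriv_succ_apply_left]
  simp only [Fin.cons_zero]
  congr 1

/-- The weighted partial derivative of `V` in the coordinates `ω`. -/
noncomputable def coordPartial (V : (σ → Vec d) → ℝ) (w : σ → ℝ) {ℓ : ℕ} (ω : Fin ℓ → σ × Fin d)
    (a : σ → Vec d) : ℝ :=
  (∏ n, w (ω n).1) *
    mixedPartial V a (fun n => (ω n).1) (fun n => EuclideanSpace.single (ω n).2 1)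

theorem coordPartial_zero (V : (σ → Vec d) → ℝ) (w : σ → ℝ) (ω : Fin 0 → σ × Fin d)
    (a : σ → Vec d) : coordPartial V w ω a = V a := by
  classical
  simp [coordPartial, mixedPartial, stencilSlice_eq, spread_apply]

theorem coordPartial_cons (V : (σ → Vec d) → ℝ) (w : σ → ℝ) {ℓ : ℕ} (p : σ × Fin d)
    (ω : Fin ℓ → σ × Fin d) (a : σ → Vec d) :
    coordPartial V w (Fin.cons p ω : Fin (ℓ + 1) → σ × Fin d) a = w p.1 * ((∏ n, w (ω n).1) *
      mixedPartial V a (Fin.cons p.1 fun n => (ω n).1 : Fin (ℓ + 1) → σ)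
        (Fin.cons (EuclideanSpace.single p.2 1) fun n => EuclideanSpace.single (ω n).2 1)) := by
  rw [coordPartial, Fin.prod_univ_succ]
  simp only [Fin.cons_zero, Fin.cons_succ]
  rw [mul_assoc]
  congr 3
  · funext n
    refine Fin.cases ?_ (fun n => ?_) n <;> simp
  · funext n
    refine Fin.cases ?_ (fun n => ?_) n <;> simp

theorem hasDerivAt_coordPartial {k : ℕ} {V : (σ → Vec d) → ℝ} {w : σ → ℝ} {a c : σ → Vec d} {t : ℝ}
    (hV : ∀ (ℓ : ℕ) (ω : Fin ℓ → σ), ContDiffAt ℝ k (stencilSlice V (a + t • c) ω) 0) {ℓ : ℕ}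
    (hℓ : ℓ < k) (F : Finset σ) (hc : ∀ s, s ∉ F → c s = 0) (hw : ∀ s, w s = 0 → c s = 0)
    (ω : Fin ℓ → σ × Fin d) :
    HasDerivAt (fun t : ℝ => coordPartial V w ω (a + t • c))
      (∑ p ∈ F ×ˢ Finset.univ, c p.1 p.2 / w p.1 *
        coordPartial V w (Fin.cons p ω : Fin (ℓ + 1) → σ × Fin d) (a + t • c)) t := by
  have h0 := (hasDerivAt_mixedPartial hV hℓ F hc (fun n => (ω n).1)
    (fun n => EuclideanSpace.single (ω n).2 1)).const_mul (∏ n, w (ω n).1)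
  have h1 : HasDerivAt (fun s : ℝ => s - t) 1 t := (hasDerivAt_id t).sub_const t
  rw [← sub_self t] at h0
  have h2 := HasDerivAt.comp (h := fun s : ℝ => s - t) t h0 h1
  rw [mul_one] at h2
  refine (h2.congr_of_eventuallyEq (Eventually.of_forall fun s => ?_)).congr_deriv (Eq.symm ?_)
  · simp only [Function.comp_apply, coordPartial]
    congr 2
    rw [add_assoc, ← add_smul]
    congr 2
    ring
  · rw [Finset.sum_product, Finset.mul_sum]
    refine Finset.sum_congr rfl fun s _ => ?_
    rw [mixedPartial_cons_sum, Finset.mul_sum]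
    refine Finset.sum_congr rfl fun i _ => ?_
    rw [coordPartial_cons]
    -- At a site of zero weight the quotient is zero by convention, which agrees with the vanishing
    -- of `c` there; elsewhere the weight cancels.
    by_cases hs : w s = 0
    · simp [hw s hs]
    · field_simp

/-- The stencils whose entries lie in given balls. -/
def stencilBox (z : σ → Vec d) (ρ : σ → ℝ) : Set (σ → Vec d) :=
  {a | ∀ s, ‖a s - z s‖ ≤ ρ s}

theorem stencilBox_convex (z : σ → Vec d) (ρ : σ → ℝ) : Convex ℝ (stencilBox z ρ) := by
  intro a ha b hb s t hs ht hst i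
  have h : (s • a + t • b) i - z i = s • (a i - z i) + t • (b i - z i) := by
    simp only [Pi.add_apply, Pi.smul_apply]
    rw [smul_sub, smul_sub, sub_add_sub_comm, ← add_smul, hst, one_smul]
  rw [h]
  refine (norm_add_le _ _).trans ?_
  rw [norm_smul, norm_smul, Real.norm_of_nonneg hs, Real.norm_of_nonneg ht]
  have h1 := mul_le_mul_of_nonneg_left (ha i) hs
  have h2 := mul_le_mul_of_nonneg_left (hb i) ht
  have h3 : s * ρ i + t * ρ i = ρ i := by rw [← add_mul, hst, one_mul]
  linarith

theorem continuousOn_coordPartial {k : ℕ} {V : (σ → Vec d) → ℝ} {𝔖 : Set (σ → Vec d)}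
    (hV : StencilSmoothOn k V 𝔖) (w : σ → ℝ) {ℓ : ℕ} (hℓ : ℓ ≤ k) (ω : Fin ℓ → σ × Fin d) :
    ContinuousOn (coordPartial V w ω) 𝔖 :=
  continuousOn_const.mul (hV.2 ℓ hℓ _ _)

/-- Smoothness in finitely many coordinates does not directly differentiate along an infinite
direction. For truncations of `c` the derivative is a finite sum; its integrated form survives the
limit, by coordinatewise continuity and the summable majorant, and is then differentiated again.
Countability of `σ` makes the limit over finite sets accessible to dominated convergence. -/
theorem hasDerivAt_coordPartial_segment [Countable σ] {k : ℕ} {V : (σ → Vec d) → ℝ}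
    {𝔖 : Set (σ → Vec d)} (hV : StencilSmoothOn k V 𝔖) (w : σ → ℝ) {z : σ → Vec d} {ρ : σ → ℝ}
    (hbox : stencilBox z ρ ⊆ 𝔖) {ℓ : ℕ} (hℓ : ℓ < k) (ω : Fin ℓ → σ × Fin d) {M : σ × Fin d → ℝ}
    (hM : ∀ p, ∀ y ∈ stencilBox z ρ,
      |coordPartial V w (Fin.cons p ω : Fin (ℓ + 1) → σ × Fin d) y| ≤ M p)
    {a c : σ → Vec d} (ha : a ∈ stencilBox z ρ) (hb : a + c ∈ stencilBox z ρ)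
    (hw : ∀ s, w s = 0 → c s = 0) (hS : Summable fun p => |c p.1 p.2 / w p.1| * M p) {t : ℝ}
    (ht : t ∈ Ioo (0 : ℝ) 1) :
    HasDerivAt (fun t : ℝ => coordPartial V w ω (a + t • c))
      (∑' p, c p.1 p.2 / w p.1 *
        coordPartial V w (Fin.cons p ω : Fin (ℓ + 1) → σ × Fin d) (a + t • c)) t := by
  classical
  let cF : Finset σ → σ → Vec d := fun F s => if s ∈ F then c s else 0
  have hcc : ∀ t ∈ Icc (0 : ℝ) 1, a + t • c ∈ stencilBox z ρ := by
    intro t ht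
    have := (stencilBox_convex z ρ).add_smul_sub_mem ha hb ht
    simpa using this
  -- The box constrains each entry separately, so freezing the entries outside `F` at those of `a`
  -- does not leave it.
  have hcF : ∀ F, ∀ t ∈ Icc (0 : ℝ) 1, a + t • cF F ∈ stencilBox z ρ := by
    intro F t ht s
    by_cases hs : s ∈ F
    · have := hcc t ht s
      simpa [cF, hs] using this
    · simpa [cF, hs] using ha s
  set D : Finset σ → ℝ → σ × Fin d → ℝ := fun F s p => if p.1 ∈ F then c p.1 p.2 / w p.1 *
    coordPartial V w (Fin.cons p ω : Fin (ℓ + 1) → σ × Fin d) (a + s • cF F) else 0 with hD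
  set D' : ℝ → σ × Fin d → ℝ := fun s p => c p.1 p.2 / w p.1 *
    coordPartial V w (Fin.cons p ω : Fin (ℓ + 1) → σ × Fin d) (a + s • c) with hD'
  have hpath : ∀ c' : σ → Vec d, Continuous fun s : ℝ => a + s • c' := fun c' => by fun_prop
  have hDb : ∀ F, ∀ s ∈ Icc (0 : ℝ) 1, ∀ p, ‖D F s p‖ ≤ |c p.1 p.2 / w p.1| * M p := by
    intro F s hs p
    have h1 := hM p _ (hcF F s hs)
    have h2 : 0 ≤ M p := (abs_nonneg _).trans h1
    by_cases hp : p.1 ∈ F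
    · simp only [hD, hp, if_true, norm_mul, Real.norm_eq_abs]
      exact mul_le_mul_of_nonneg_left h1 (abs_nonneg _)
    · simp only [hD, hp, if_false, norm_zero]
      positivity
  have hDb' : ∀ s ∈ Icc (0 : ℝ) 1, ∀ p, ‖D' s p‖ ≤ |c p.1 p.2 / w p.1| * M p := by
    intro s hs p
    simp only [hD', norm_mul, Real.norm_eq_abs]
    exact mul_le_mul_of_nonneg_left (hM p _ (hcc s hs)) (abs_nonneg _)
  have hDc : ∀ F, ContinuousOn (fun s => ∑' p, D F s p) (Icc 0 1) := by
    intro F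
    refine continuousOn_tsum (fun p => ?_) hS fun p s hs => hDb F s hs p
    by_cases hp : p.1 ∈ F
    · simp only [hD, hp, if_true]
      exact continuousOn_const.mul ((continuousOn_coordPartial hV w hℓ _).comp
        (hpath _).continuousOn fun s hs => hbox (hcF F s hs))
    · simp only [hD, hp, if_false]
      exact continuousOn_const
  have hDc' : ContinuousOn (fun s => ∑' p, D' s p) (Icc 0 1) := by
    refine continuousOn_tsum (fun p => ?_) hS fun p s hs => hDb' s hs p
    exact continuousOn_const.mul ((continuousOn_coordPartial hV w hℓ _).comp
      (hpath _).continuousOn fun s hs => hbox (hcc s hs))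
  have hder : ∀ F, ∀ s ∈ Icc (0 : ℝ) 1, HasDerivAt (fun t : ℝ => coordPartial V w ω (a + t • cF F))
      (∑' p, D F s p) s := by
    intro F s hs
    have h1 := hasDerivAt_coordPartial (w := w) (a := a) (c := cF F) (t := s)
      (fun ℓ ω => hV.1 _ (hbox (hcF F s hs)) ℓ ω) hℓ F (fun r hr => by simp [cF, hr])
      (fun r hr => by simp [cF, hw r hr]) ω
    convert h1 using 1
    rw [tsum_eq_sum (s := F ×ˢ Finset.univ)]
    · refine Finset.sum_congr rfl fun p hp => ?_
      have : p.1 ∈ F := (Finset.mem_product.1 hp).1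
      simp [hD, cF, this]
    · intro p hp
      have : p.1 ∉ F := fun h => hp (Finset.mem_product.2 ⟨h, Finset.mem_univ _⟩)
      simp [hD, this]
  have hsub : ∀ t ∈ Icc (0 : ℝ) 1, uIcc 0 t ⊆ Icc (0 : ℝ) 1 := by
    intro t ht
    rw [uIcc_of_le ht.1]
    exact Icc_subset_Icc_right ht.2
  have hFTC : ∀ F, ∀ t ∈ Icc (0 : ℝ) 1, ∫ s in (0 : ℝ)..t, ∑' p, D F s p =
      coordPartial V w ω (a + t • cF F) - coordPartial V w ω a := by
    intro F t ht
    rw [intervalIntegral.integral_eq_sub_of_hasDerivAt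
      (fun s hs => hder F s (hsub t ht hs)) ((hDc F).mono (hsub t ht)).intervalIntegrable]
    simp
  have hcoord : Tendsto cF atTop (𝓝 c) := by
    refine tendsto_pi_nhds.2 fun s => tendsto_const_nhds.congr' ?_
    filter_upwards [eventually_ge_atTop {s}] with F hF
    have : s ∈ F := hF (Finset.mem_singleton_self s)
    simp [cF, this]
  have hlimP : ∀ {ℓ' : ℕ}, ℓ' ≤ k → ∀ (ω' : Fin ℓ' → σ × Fin d), ∀ s ∈ Icc (0 : ℝ) 1,
      Tendsto (fun F => coordPartial V w ω' (a + s • cF F)) atTop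
        (𝓝 (coordPartial V w ω' (a + s • c))) := by
    intro ℓ' hℓ' ω' s hs
    refine (continuousOn_coordPartial hV w hℓ' ω' _ (hbox (hcc s hs))).tendsto.comp ?_
    refine tendsto_nhdsWithin_iff.2 ⟨tendsto_const_nhds.add (hcoord.const_smul s), ?_⟩
    exact Eventually.of_forall fun F => hbox (hcF F s hs)
  have hlim : ∀ t ∈ Icc (0 : ℝ) 1, ∫ s in (0 : ℝ)..t, ∑' p, D' s p =
      coordPartial V w ω (a + t • c) - coordPartial V w ω a := by
    intro t ht
    have hIoc : ∀ s ∈ uIoc 0 t, s ∈ Icc (0 : ℝ) 1 := fun s hs => hsub t ht (uIoc_subset_uIcc hs)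
    -- Dominated convergence is used twice, for the series over `p` and for the integral over `s`,
    -- with the same majorant.
    have h1 : Tendsto (fun F => ∫ s in (0 : ℝ)..t, ∑' p, D F s p) atTop
        (𝓝 (∫ s in (0 : ℝ)..t, ∑' p, D' s p)) := by
      refine intervalIntegral.tendsto_integral_filter_of_dominated_convergence
        (fun _ => ∑' p : σ × Fin d, |c p.1 p.2 / w p.1| * M p) ?_ ?_ (by simp) ?_
      · exact Eventually.of_forall fun F => ((hDc F).mono
          (uIoc_subset_uIcc.trans (hsub t ht))).aestronglyMeasurable measurableSet_uIoc
      · exact Eventually.of_forall fun F => Eventually.of_forall fun s hs =>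
          tsum_of_norm_bounded hS.hasSum fun p => hDb F s (hIoc s hs) p
      · refine Eventually.of_forall fun s hs => ?_
        refine tendsto_tsum_of_dominated_convergence hS (fun p => ?_)
          (Eventually.of_forall fun F p => hDb F s (hIoc s hs) p)
        refine ((hlimP hℓ (Fin.cons p ω) s (hIoc s hs)).const_mul (c p.1 p.2 / w p.1)).congr' ?_
        filter_upwards [eventually_ge_atTop {p.1}] with F hF
        have : p.1 ∈ F := hF (Finset.mem_singleton_self _)
        simp [hD, this]
    refine tendsto_nhds_unique h1 ?_
    simp_rw [fun F => hFTC F t ht]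
    exact (hlimP hℓ.le ω t ht).sub_const _
  have hIoo : Ioo (0 : ℝ) 1 ∈ 𝓝 t := Ioo_mem_nhds ht.1 ht.2
  have ht' := Ioo_subset_Icc_self ht
  -- The series in the limiting formula is continuous in `s`, so its integral is differentiable.
  have hmain := intervalIntegral.integral_hasDerivAt_right
    (hDc'.mono (hsub t ht')).intervalIntegrable
    (ContinuousOn.stronglyMeasurableAtFilter isOpen_Ioo (hDc'.mono Ioo_subset_Icc_self) t ht)
    (hDc'.continuousAt (Icc_mem_nhds ht.1 ht.2))
  refine (hmain.add_const (coordPartial V w ω a)).congr_of_eventuallyEq ?_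
  filter_upwards [hIoo] with s hs
  rw [hlim s (Ioo_subset_Icc_self hs)]
  ring

theorem continuousOn_coordPartial_segment {k : ℕ} {V : (σ → Vec d) → ℝ}
    {𝔖 : Set (σ → Vec d)} (hV : StencilSmoothOn k V 𝔖) (w : σ → ℝ) {z : σ → Vec d} {ρ : σ → ℝ}
    (hbox : stencilBox z ρ ⊆ 𝔖) {ℓ : ℕ} (hℓ : ℓ ≤ k) (ω : Fin ℓ → σ × Fin d)
    {a c : σ → Vec d} (ha : a ∈ stencilBox z ρ) (hb : a + c ∈ stencilBox z ρ) :
    ContinuousOn (fun t : ℝ => coordPartial V w ω (a + t • c)) (Icc 0 1) := by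
  refine (continuousOn_coordPartial hV w hℓ ω).comp
    (f := fun t : ℝ => a + t • c) (by fun_prop) fun t ht => hbox ?_
  simpa using (stencilBox_convex z ρ).add_smul_sub_mem ha hb ht

/-- A mean value inequality in an infinite direction; it is what controls the change of a site
potential under a finitely supported perturbation. -/
theorem abs_sub_le_tsum_coordPartial [Countable σ] {k : ℕ} (hk : 1 ≤ k) {V : (σ → Vec d) → ℝ}
    {𝔖 : Set (σ → Vec d)} (hV : StencilSmoothOn k V 𝔖) (w : σ → ℝ) {z : σ → Vec d} {ρ : σ → ℝ}
    (hbox : stencilBox z ρ ⊆ 𝔖) {M : (Fin 1 → σ × Fin d) → ℝ}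
    (hM : ∀ ω, ∀ y ∈ stencilBox z ρ, |coordPartial V w ω y| ≤ M ω)
    {a c : σ → Vec d} (ha : a ∈ stencilBox z ρ) (hb : a + c ∈ stencilBox z ρ)
    (hw : ∀ s, w s = 0 → c s = 0) (hS : Summable fun p => |c p.1 p.2 / w p.1| * M fun _ => p) :
    |V (a + c) - V a| ≤ ∑' p : σ × Fin d, |c p.1 p.2 / w p.1| * M fun _ => p := by
  have hcons : ∀ p : σ × Fin d, (Fin.cons p Fin.elim0 : Fin 1 → σ × Fin d) = fun _ => p := by
    intro p
    funext i
    refine Fin.cases rfl (fun j => j.elim0) i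
  have hc := continuousOn_coordPartial_segment hV w hbox (Nat.zero_le k) Fin.elim0 ha hb
  obtain ⟨ξ, hξ, h⟩ := exists_hasDerivAt_eq_slope _ _ zero_lt_one hc
    (fun t ht => hasDerivAt_coordPartial_segment hV w hbox hk Fin.elim0
      (M := fun p => M fun _ => p) (fun p y hy => by rw [hcons]; exact hM _ y hy) ha hb hw hS ht)
  simp only [coordPartial_zero, zero_smul, add_zero, one_smul, sub_zero, div_one] at h
  rw [← h, ← Real.norm_eq_abs]
  refine tsum_of_norm_bounded hS.hasSum fun p => ?_
  rw [norm_mul, Real.norm_eq_abs, Real.norm_eq_abs, hcons]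
  refine mul_le_mul_of_nonneg_left (hM _ _ ?_) (abs_nonneg _)
  simpa using (stencilBox_convex z ρ).add_smul_sub_mem ha hb ⟨hξ.1.le, hξ.2.le⟩

end Stencils

/-! ### From site potentials to smooth integrands -/

section StencilIntegrands

theorem summable_comp_fst {σ : Type*} {d ℓ : ℕ} {m : (Fin ℓ → σ) → ℝ≥0∞} (hm : ∑' ω, m ω < ∞) :
    Summable fun ω : Fin ℓ → σ × Fin d => (m fun n => (ω n).1).toReal := by
  have h1 : Summable fun ω => (m ω).toReal := ENNReal.summable_toReal hm.ne
  have h2 : Summable fun _ : Fin ℓ → Fin d => (1 : ℝ) := (hasSum_fintype _).summable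
  have h3 := h1.mul_of_nonneg h2 (fun _ => ENNReal.toReal_nonneg) (fun _ => zero_le_one)
  simp only [mul_one] at h3
  exact ((Equiv.arrowProdEquivProdArrow (Fin ℓ) (fun _ => σ) (fun _ => Fin d)).summable_iff.2 h3)

variable {X W σ : Type*} {d : ℕ} [MeasurableSpace X] [NormedAddCommGroup W] [NormedSpace ℝ W]

/-- The integrands given by the weighted partial derivatives of a potential `V` along a family of
stencils `st u x`, depending affinely on `u`. -/
theorem smoothIntegrand_of_stencils [Countable σ] {μ : Measure X} {K : Set W} {k : ℕ} {q : ℝ≥0∞}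
    {V : (σ → Vec d) → ℝ} {w : σ → ℝ} {st lin : W → X → σ → Vec d} {r : X → ℝ} {X₀ : Set X}
    (hX₀ : ∀ᵐ x ∂μ, x ∈ X₀) {z : X → σ → Vec d} {ρ : σ → ℝ} {𝔖 : Set (σ → Vec d)}
    {m : ∀ ℓ, (Fin ℓ → σ) → ℝ≥0∞} (hK : Convex ℝ K)
    (one_fin : eLpNorm (fun _ : X => (1 : ℝ)) q μ ≠ ∞)
    (hV : StencilSmoothOn k V 𝔖) (hbox : ∀ x ∈ X₀, stencilBox (z x) ρ ⊆ 𝔖)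
    (hst : ∀ u ∈ K, ∀ x ∈ X₀, st u x ∈ stencilBox (z x) ρ)
    (hlin : ∀ u ∈ K, ∀ v ∈ K, ∀ x ∈ X₀, ∀ t ∈ Icc (0 : ℝ) 1,
      st (u + t • (v - u)) x = st u x + t • lin (v - u) x)
    (hw : ∀ u ∈ K, ∀ v ∈ K, ∀ x ∈ X₀, ∀ s, w s = 0 → lin (v - u) x s = 0)
    (hbdd : ∀ u ∈ K, ∀ v ∈ K, ∃ C, ∀ x ∈ X₀, ∀ p : σ × Fin d,
      |lin (v - u) x p.1 p.2 / w p.1| ≤ C)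
    (hm : ∀ ℓ, 1 ≤ ℓ → ℓ ≤ k → ∑' ω, m ℓ ω < ∞)
    (hbound : ∀ ℓ, 1 ≤ ℓ → ℓ ≤ k → ∀ (ω : Fin ℓ → σ × Fin d), ∀ y ∈ 𝔖,
      |coordPartial V w ω y| ≤ (m ℓ fun n => (ω n).1).toReal)
    (hmeas : ∀ ℓ ≤ k, ∀ (ω : Fin ℓ → σ × Fin d), ∀ u ∈ K,
      AEStronglyMeasurable (fun x => coordPartial V w ω (st u x)) μ)
    (hr : AEStronglyMeasurable r μ)
    (L_meas : ∀ (p : σ × Fin d) v, AEStronglyMeasurable (fun x => lin v x p.1 p.2 / w p.1) μ)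
    (L_add : ∀ u v, ∀ᵐ x ∂μ, lin (u + v) x = lin u x + lin v x)
    (L_smul : ∀ (c : ℝ) v, ∀ᵐ x ∂μ, lin (c • v) x = c • lin v x)
    (hoelder : ∀ ℓ, 1 ≤ ℓ → ℓ ≤ k → ∃ C : ℝ≥0, ∀ (ω : Fin ℓ → σ × Fin d) (v : Fin ℓ → W)
      (g : X → ℝ), AEStronglyMeasurable g μ →
      ∫⁻ x, ‖g x * ∏ n, (lin (v n) x (ω n).1 (ω n).2 / w (ω n).1)‖ₑ ∂μ ≤
        C * eLpNorm g q μ * ∏ n, ‖v n‖ₑ)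
    (hint : ∃ u ∈ K, Integrable (fun x => V (st u x) - r x) μ)
    (htendsto : ∀ ℓ, 1 ≤ ℓ → ℓ ≤ k → ∀ (ω : Fin ℓ → σ × Fin d), ∀ u ∈ K,
      Tendsto (fun u' => eLpNorm (fun x => coordPartial V w ω (st u' x) -
        coordPartial V w ω (st u x)) q μ) (𝓝[K] u) (𝓝 0)) :
    SmoothIntegrand μ K k q (fun (p : σ × Fin d) v x => lin v x p.1 p.2 / w p.1)
      (fun ℓ ω u x => coordPartial V w ω (st u x) - if ℓ = 0 then r x else 0)
      (fun ℓ ω => (m ℓ fun n => (ω n).1).toReal) := by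
  have hseg : ∀ u ∈ K, ∀ v ∈ K, ∀ x ∈ X₀, st v x = st u x + lin (v - u) x := by
    intro u hu v hv x hx
    simpa using hlin u hu v hv x hx 1 (by simp)
  refine
    { convex := hK
      one_fin := one_fin
      L_meas := L_meas
      L_add := fun p u v => ?_
      L_smul := fun p c v => ?_
      hoelder := hoelder
      M_nonneg := fun _ _ => ENNReal.toReal_nonneg
      M_summable := fun ℓ h1 h2 => summable_comp_fst (hm ℓ h1 h2)
      G_meas := fun ℓ hℓ ω u hu => ?_
      G_bound := fun ℓ h1 h2 ω u hu v hv => ?_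
      G_int := ?_
      G_cont := fun u hu v hv => ?_
      G_deriv := fun ℓ hℓ ω u hu v hv => ?_
      G_tendsto := fun ℓ h1 h2 ω u hu => ?_ }
  · filter_upwards [L_add u v] with x hx
    rw [hx]
    simp [add_div]
  · filter_upwards [L_smul c v] with x hx
    rw [hx]
    simp [mul_div_assoc]
  · refine (hmeas ℓ hℓ ω u hu).sub ?_
    split_ifs
    · exact hr
    · exact aestronglyMeasurable_const
  · filter_upwards [hX₀] with x hx t ht
    rw [if_neg (by omega), sub_zero]
    exact hbound ℓ h1 h2 ω _ (hbox x hx (hst _ (hK.add_smul_sub_mem hu hv ht) x hx))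
  · simpa [coordPartial_zero] using hint
  · filter_upwards [hX₀] with x hx
    have hb : st u x + lin (v - u) x ∈ stencilBox (z x) ρ := by
      rw [← hseg u hu v hv x hx]
      exact hst v hv x hx
    refine ContinuousOn.sub ?_ continuousOn_const
    refine (continuousOn_coordPartial_segment hV w (hbox x hx) (Nat.zero_le k) Fin.elim0
      (hst u hu x hx) hb).congr fun t ht => ?_
    simp only [hlin u hu v hv x hx t ht]
  · filter_upwards [hX₀] with x hx t ht
    have hb : st u x + lin (v - u) x ∈ stencilBox (z x) ρ := by
      rw [← hseg u hu v hv x hx]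
      exact hst v hv x hx
    -- A bounded direction times a summable family of derivative bounds is summable, as the
    -- pointwise chain rule requires.
    obtain ⟨C, hC⟩ := hbdd u hu v hv
    have hS : Summable fun p => (m (ℓ + 1) fun n =>
        ((Fin.cons p ω : Fin (ℓ + 1) → σ × Fin d) n).1).toReal :=
      (summable_comp_fst (hm (ℓ + 1) (by omega) hℓ)).comp_injective
        (i := fun p : σ × Fin d => (Fin.cons p ω : Fin (ℓ + 1) → σ × Fin d))
        (fun i j h => by simpa using congrFun h 0)
    have hS' : Summable fun p : σ × Fin d => |lin (v - u) x p.1 p.2 / w p.1| * (m (ℓ + 1) fun n =>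
        ((Fin.cons p ω : Fin (ℓ + 1) → σ × Fin d) n).1).toReal := by
      refine Summable.of_nonneg_of_le (fun p => by positivity) (fun p => ?_) (hS.mul_left C)
      exact mul_le_mul_of_nonneg_right (hC x hx p) ENNReal.toReal_nonneg
    have h1 := hasDerivAt_coordPartial_segment hV w (hbox x hx) hℓ ω
      (fun p y hy => hbound (ℓ + 1) (by omega) hℓ (Fin.cons p ω) y (hbox x hx hy))
      (hst u hu x hx) hb (hw u hu v hv x hx) hS' ht
    simp only [Nat.add_eq_zero_iff, one_ne_zero, and_false, if_false, sub_zero]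
    -- The reference value `r`, subtracted at order zero so that infinitely many site energies can
    -- be compared, does not depend on the parameter.
    refine ((h1.sub_const (if ℓ = 0 then r x else 0)).congr_of_eventuallyEq ?_).congr_deriv ?_
    · filter_upwards [Ioo_mem_nhds ht.1 ht.2] with s hs
      rw [hlin u hu v hv x hx s (Ioo_subset_Icc_self hs)]
    · rw [hlin u hu v hv x hx t (Ioo_subset_Icc_self ht)]
  · have h0 : ℓ ≠ 0 := by omega
    simpa [h0] using htendsto ℓ h1 h2 ω u hu

variable {𝒜 : Fin 2 → Type*}

theorem Bilayer.weight_nonneg (S : Bilayer 𝒜 d) (j : Fin 2) (α : 𝒜 j) (ω : Site 𝒜 j) :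
    0 ≤ S.weight j α ω := by
  unfold Bilayer.weight
  split_ifs <;> simp

variable [∀ j, Fintype (𝒜 j)]

theorem abs_coordPartial_le_toReal {V : (σ → Vec d) → ℝ} {w : σ → ℝ} (hw : ∀ s, 0 ≤ w s) {ℓ : ℕ}
    {ω : Fin ℓ → σ × Fin d} {y : σ → Vec d} {m : ℝ≥0∞} (hm : m ≠ ∞)
    (h : ENNReal.ofReal ((∏ n, w (ω n).1) * |mixedPartial V y (fun n => (ω n).1)
      (fun n => EuclideanSpace.single (ω n).2 1)|) ≤ m) : |coordPartial V w ω y| ≤ m.toReal := by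
  rw [coordPartial, abs_mul, abs_of_nonneg (Finset.prod_nonneg fun n _ => hw _)]
  exact (ENNReal.ofReal_le_iff_le_toReal hm).1 h

/-- Coordinate directions are unit vectors, hence admitted in the supremum, and one sublattice is
dominated by the sum over all of them. Finiteness of the supremum comes from its being a term of a
finite sum. -/
theorem Bilayer.Decay.mono_bound {S : Bilayer 𝒜 d} {V : SitePotentials 𝒜 d} {κ r : ℝ} {k : ℕ}
    (hD : S.Decay V κ r k) (j : Fin 2) (α : 𝒜 j) {ℓ : ℕ} (h1 : 1 ≤ ℓ) (h2 : ℓ ≤ k)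
    (ω : Fin ℓ → Site 𝒜 j × Fin d) {y : Site 𝒜 j → Vec d} (hy : y ∈ S.stencils κ r j) :
    |coordPartial (V.mono j α) (S.weight j α) ω y| ≤
      (S.monoNorm V κ r j fun n => (ω n).1).toReal := by
  refine abs_coordPartial_le_toReal (S.weight_nonneg j α)
    (ENNReal.ne_top_of_tsum_ne_top (hD.mono_summable j ℓ h1 h2).ne _) ?_
  refine le_trans ?_ (le_iSup₂_of_le (fun n => EuclideanSpace.single (ω n).2 1)
    (fun n => by simp) (le_iSup₂_of_le y hy le_rfl))
  exact Finset.single_le_sum (f := fun α => ENNReal.ofReal ((∏ n, S.weight j α (ω n).1) *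
    |mixedPartial (V.mono j α) y (fun n => (ω n).1) (fun n => EuclideanSpace.single (ω n).2 1)|))
    (fun _ _ => zero_le) (Finset.mem_univ α)

theorem Bilayer.Decay.inter_bound {S : Bilayer 𝒜 d} {V : SitePotentials 𝒜 d} {κ r : ℝ} {k : ℕ}
    (hD : S.Decay V κ r k) (j : Fin 2) (α : 𝒜 j) {ℓ : ℕ} (h1 : 1 ≤ ℓ) (h2 : ℓ ≤ k)
    (ω : Fin ℓ → Site 𝒜 (1 - j) × Fin d) {y : Site 𝒜 (1 - j) → Vec d}
    (hy : y ∈ S.interStencils κ r j α) :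
    |coordPartial (V.inter j α) (fun _ => 1) ω y| ≤
      (S.interNorm V κ r j fun n => (ω n).1).toReal := by
  refine abs_coordPartial_le_toReal (fun _ => zero_le_one)
    (ENNReal.ne_top_of_tsum_ne_top (hD.inter_summable j ℓ h1 h2).ne _) ?_
  obtain ⟨x, hx, a, ha, rfl⟩ := hy
  refine le_trans ?_ (le_iSup₂_of_le (fun n => EuclideanSpace.single (ω n).2 1)
    (fun n => by simp) (le_iSup₂_of_le a ha (le_iSup₂_of_le x hx le_rfl)))
  rw [Finset.prod_const_one, one_mul]
  exact Finset.single_le_sum (f := fun α => ENNReal.ofReal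
    |mixedPartial (V.inter j α) (S.interStencil j 0 x α + a) (fun n => (ω n).1)
      (fun n => EuclideanSpace.single (ω n).2 1)|)
    (fun _ _ => zero_le) (Finset.mem_univ α)

end StencilIntegrands

/-! ### Unit cells as fundamental domains -/

section Lattice

variable {M : Matrix (Fin 2) (Fin 2) ℝ}

theorem latticePoint_add (M : Matrix (Fin 2) (Fin 2) ℝ) (n m : Fin 2 → ℤ) :
    latticePoint M (n + m) = latticePoint M n + latticePoint M m := by
  rw [latticePoint, latticePoint, latticePoint, ← map_add]
  congr 1
  ext i
  simp

theorem latticePoint_zero (M : Matrix (Fin 2) (Fin 2) ℝ) : latticePoint M 0 = 0 := by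
  have h := latticePoint_add M 0 0
  rw [add_zero] at h
  exact left_eq_add.1 h

theorem latticePoint_neg (M : Matrix (Fin 2) (Fin 2) ℝ) (n : Fin 2 → ℤ) :
    latticePoint M (-n) = -latticePoint M n := by
  refine eq_neg_of_add_eq_zero_left ?_
  rw [← latticePoint_add, neg_add_cancel, latticePoint_zero]

theorem latticePoint_sub (M : Matrix (Fin 2) (Fin 2) ℝ) (n m : Fin 2 → ℤ) :
    latticePoint M (n - m) = latticePoint M n - latticePoint M m := by
  rw [sub_eq_add_neg, latticePoint_add, latticePoint_neg, sub_eq_add_neg]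

theorem toEuclideanLin_mul_apply (A B : Matrix (Fin 2) (Fin 2) ℝ) (x : Plane) :
    (A * B).toEuclideanLin x = A.toEuclideanLin (B.toEuclideanLin x) := by
  simp [Matrix.toLpLin_apply]

theorem toEuclideanLin_one_apply (x : Plane) :
    (1 : Matrix (Fin 2) (Fin 2) ℝ).toEuclideanLin x = x := by
  simp

theorem toEuclideanLin_inv_apply (hM : IsUnit M.det) (x : Plane) :
    M.toEuclideanLin (M⁻¹.toEuclideanLin x) = x := by
  rw [← toEuclideanLin_mul_apply, Matrix.mul_nonsing_inv _ hM, toEuclideanLin_one_apply]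

theorem inv_toEuclideanLin_apply (hM : IsUnit M.det) (x : Plane) :
    M⁻¹.toEuclideanLin (M.toEuclideanLin x) = x := by
  rw [← toEuclideanLin_mul_apply, Matrix.nonsing_inv_mul _ hM, toEuclideanLin_one_apply]

/-- The integer part of `x` with respect to the lattice `M ℤ²`. -/
noncomputable def cellFloor (M : Matrix (Fin 2) (Fin 2) ℝ) (x : Plane) : Fin 2 → ℤ :=
  fun i => ⌊M⁻¹.toEuclideanLin x i⌋

theorem cellFract_add_floor (hM : IsUnit M.det) (x : Plane) :
    cellFract M x + latticePoint M (cellFloor M x) = x := by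
  rw [cellFract, latticePoint, ← map_add]
  conv_rhs => rw [← toEuclideanLin_inv_apply hM x]
  congr 1
  ext i
  simp [cellFloor]

theorem cellFract_mem (M : Matrix (Fin 2) (Fin 2) ℝ) (x : Plane) : cellFract M x ∈ unitCell M :=
  ⟨_, fun _ => ⟨Int.fract_nonneg _, Int.fract_lt_one _⟩, rfl⟩

theorem cellFloor_add (hM : IsUnit M.det) {x : Plane} (hx : x ∈ unitCell M) (n : Fin 2 → ℤ) :
    cellFloor M (x + latticePoint M n) = n := by
  obtain ⟨y, hy, rfl⟩ := hx
  funext i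
  rw [cellFloor, latticePoint, ← map_add, inv_toEuclideanLin_apply hM]
  simpa using Int.floor_eq_zero_iff.2 (hy i)

theorem cellFloor_eq_zero (hM : IsUnit M.det) {x : Plane} (hx : x ∈ unitCell M) :
    cellFloor M x = 0 := by
  simpa [latticePoint_zero] using cellFloor_add hM hx 0

theorem cellFract_eq_sub (hM : IsUnit M.det) (x : Plane) :
    cellFract M x = x - latticePoint M (cellFloor M x) :=
  eq_sub_of_add_eq (cellFract_add_floor hM x)

theorem cellFract_eq_self (hM : IsUnit M.det) {x : Plane} (hx : x ∈ unitCell M) :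
    cellFract M x = x := by
  rw [cellFract_eq_sub hM, cellFloor_eq_zero hM hx, latticePoint_zero, sub_zero]

theorem cellFract_add_latticePoint (hM : IsUnit M.det) (x : Plane) (n : Fin 2 → ℤ) :
    cellFract M (x + latticePoint M n) = cellFract M x := by
  have h : x + latticePoint M n =
      cellFract M x + latticePoint M (cellFloor M x + n) := by
    rw [latticePoint_add, ← add_assoc, cellFract_add_floor hM]
  rw [cellFract_eq_sub hM (x + _), h, cellFloor_add hM (cellFract_mem M x), add_sub_cancel_right]

theorem continuous_toEuclideanLin (A : Matrix (Fin 2) (Fin 2) ℝ) :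
    Continuous A.toEuclideanLin := LinearMap.continuous_of_finiteDimensional _

theorem measurable_cellFract (M : Matrix (Fin 2) (Fin 2) ℝ) : Measurable (cellFract M) := by
  refine (continuous_toEuclideanLin M).measurable.comp ?_
  refine (WithLp.measurable_toLp 2 _).comp (measurable_pi_lambda _ fun i => ?_)
  refine measurable_fract.comp ?_
  have : Continuous fun x : Plane => M⁻¹.toEuclideanLin x i := by
    have := continuous_toEuclideanLin M⁻¹
    fun_prop
  exact this.measurable

theorem mem_unitCell_iff (hM : IsUnit M.det) {x : Plane} : x ∈ unitCell M ↔ cellFract M x = x :=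
  ⟨cellFract_eq_self hM, fun h => h ▸ cellFract_mem M x⟩

theorem measurableSet_unitCell (hM : IsUnit M.det) : MeasurableSet (unitCell M) := by
  have : unitCell M = {x | cellFract M x = x} := by
    ext x
    exact mem_unitCell_iff hM
  rw [this]
  exact measurableSet_eq_fun (measurable_cellFract M) measurable_id

theorem isBounded_unitCell (M : Matrix (Fin 2) (Fin 2) ℝ) : Bornology.IsBounded (unitCell M) := by
  obtain ⟨K, hK, h⟩ := unitCell_subset_compact M
  exact hK.isBounded.subset h

/-- The translate of the unit cell by a lattice vector. -/
def cellAt (M : Matrix (Fin 2) (Fin 2) ℝ) (n : Fin 2 → ℤ) : Set Plane :=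
  {x | x - latticePoint M n ∈ unitCell M}

theorem mem_cellAt_iff (hM : IsUnit M.det) {n : Fin 2 → ℤ} {x : Plane} :
    x ∈ cellAt M n ↔ cellFloor M x = n := by
  constructor
  · intro h
    have := cellFloor_add hM h n
    rwa [sub_add_cancel] at this
  · rintro rfl
    have h := cellFract_eq_sub hM x
    rw [cellAt, mem_ofPred_eq, ← h]
    exact cellFract_mem M x

theorem measurableSet_cellAt (hM : IsUnit M.det) (n : Fin 2 → ℤ) : MeasurableSet (cellAt M n) :=
  (measurable_id.sub_const (latticePoint M n)) (measurableSet_unitCell hM)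

theorem iUnion_cellAt (hM : IsUnit M.det) : ⋃ n, cellAt M n = univ :=
  eq_univ_of_forall fun _ => mem_iUnion.2 ⟨_, (mem_cellAt_iff hM).2 rfl⟩

theorem cellAt_pairwise (hM : IsUnit M.det) : Pairwise (Function.onFun Disjoint (cellAt M)) := by
  intro n m hnm
  refine disjoint_left.2 fun x hx hx' => hnm ?_
  rw [← (mem_cellAt_iff hM).1 hx, (mem_cellAt_iff hM).1 hx']

theorem measurePreserving_cellAt (hM : IsUnit M.det) (n : Fin 2 → ℤ) :
    MeasurePreserving (fun x => x + latticePoint M n) (volume.restrict (unitCell M))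
      (volume.restrict (cellAt M n)) := by
  have h := (measurePreserving_add_right (volume : Measure Plane)
    (latticePoint M n)).restrict_preimage (measurableSet_cellAt hM n)
  convert h using 2
  ext x
  simp [cellAt]

/-- The plane is a countable union of translated cells, and on each of them reduction to the unit
cell is a translation, which pulls null sets back to null sets. -/
theorem ae_cellFract (hM : IsUnit M.det) {p : Plane → Prop}
    (h : ∀ᵐ x ∂(volume.restrict (unitCell M)), p x) : ∀ᵐ x : Plane, p (cellFract M x) := by
  have h1 : ∀ n, ∀ᵐ x ∂(volume.restrict (cellAt M n)), p (cellFract M x) := by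
    intro n
    have hn := (measurePreserving_add_right (volume : Measure Plane)
      (-latticePoint M n)).restrict_preimage (measurableSet_unitCell hM)
    have hpre : (fun x => x + -latticePoint M n) ⁻¹' unitCell M = cellAt M n := by
      ext x
      simp [cellAt, sub_eq_add_neg]
    rw [hpre] at hn
    filter_upwards [hn.quasiMeasurePreserving.ae h, ae_restrict_mem (measurableSet_cellAt hM n)]
      with x hx hxn
    rw [cellFract_eq_sub hM, (mem_cellAt_iff hM).1 hxn, sub_eq_add_neg]
    exact hx
  have h2 := (ae_restrict_iUnion_iff (cellAt M) (fun x => p (cellFract M x))).2 h1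
  rwa [iUnion_cellAt hM, Measure.restrict_univ] at h2

/-- The inverse matrix is a bounded operator recovering the integer coordinates. -/
theorem exists_norm_latticePoint_ge (hM : IsUnit M.det) :
    ∃ c : ℝ, 0 < c ∧ ∀ (n : Fin 2 → ℤ) (i : Fin 2), c * |(n i : ℝ)| ≤ ‖latticePoint M n‖ := by
  let T : Plane →L[ℝ] Plane := LinearMap.toContinuousLinearMap M⁻¹.toEuclideanLin
  have hT : ∀ n : Fin 2 → ℤ, T (latticePoint M n) = WithLp.toLp 2 fun i => (n i : ℝ) := fun n =>
    inv_toEuclideanLin_apply hM _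
  refine ⟨(‖T‖ + 1)⁻¹, by positivity, fun n i => ?_⟩
  rw [inv_mul_le_iff₀ (by positivity)]
  have h1 : |(n i : ℝ)| ≤ ‖T (latticePoint M n)‖ := by
    rw [hT]
    exact PiLp.norm_apply_le (p := 2) (WithLp.toLp 2 fun i => (n i : ℝ)) i
  refine h1.trans ((T.le_opNorm _).trans ?_)
  nlinarith [norm_nonneg (latticePoint M n)]

theorem finite_latticePoint_norm_le (hM : IsUnit M.det) (r : ℝ) :
    {n : Fin 2 → ℤ | ‖latticePoint M n‖ ≤ r}.Finite := by
  obtain ⟨c, hc, h⟩ := exists_norm_latticePoint_ge hM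
  refine (Set.finite_Icc (fun _ => -⌈r / c⌉) (fun _ => ⌈r / c⌉)).subset fun n hn => ?_
  have hb : ∀ i, |(n i : ℝ)| ≤ r / c := fun i => by
    rw [le_div_iff₀ hc, mul_comm]
    exact (h n i).trans hn
  refine ⟨fun i => ?_, fun i => ?_⟩
  · have := (abs_le.1 (hb i)).1
    have h2 : (-⌈r / c⌉ : ℝ) ≤ n i := by linarith [Int.le_ceil (r / c)]
    exact_mod_cast h2
  · have := (abs_le.1 (hb i)).2
    have h2 : (n i : ℝ) ≤ ⌈r / c⌉ := by linarith [Int.le_ceil (r / c)]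
    exact_mod_cast h2

theorem exists_finset_cover (hM : IsUnit M.det) {B : Set Plane} (hB : Bornology.IsBounded B) :
    ∃ F : Finset (Fin 2 → ℤ), B ⊆ ⋃ n ∈ F, cellAt M n := by
  obtain ⟨r, hr⟩ := hB.exists_norm_le
  obtain ⟨r', hr'⟩ := (isBounded_unitCell M).exists_norm_le
  refine ⟨(finite_latticePoint_norm_le hM (r + r')).toFinset, fun x hx => ?_⟩
  refine mem_iUnion₂.2 ⟨cellFloor M x, ?_, (mem_cellAt_iff hM).2 rfl⟩
  rw [Finite.mem_toFinset, mem_ofPred_eq, eq_sub_of_add_eq' (cellFract_add_floor hM x)]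
  exact (norm_sub_le _ _).trans (add_le_add (hr x hx) (hr' _ (cellFract_mem M x)))

theorem lintegral_cellAt (hM : IsUnit M.det) {f : Plane → ℝ≥0∞} (hf : Measurable f)
    (hper : IsLatticePeriodic M f) (n : Fin 2 → ℤ) :
    ∫⁻ x in cellAt M n, f x = ∫⁻ x in unitCell M, f x := by
  rw [← (measurePreserving_cellAt hM n).lintegral_comp hf]
  exact lintegral_congr fun x => hper n x

open scoped Pointwise in
/-- The integral of a periodic function over any translate of a bounded set is controlled by the
integral over the unit cell. -/
theorem exists_lintegral_translate_le (hM : IsUnit M.det) {B : Set Plane}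
    (hB : Bornology.IsBounded B) : ∃ N : ℕ, ∀ f : Plane → ℝ≥0∞, Measurable f →
      IsLatticePeriodic M f → ∀ z : Plane, ∫⁻ x in B, f (x + z) ≤ N * ∫⁻ x in unitCell M, f x := by
  have hB' : Bornology.IsBounded (B + unitCell M) := hB.add (isBounded_unitCell M)
  obtain ⟨F, hF⟩ := exists_finset_cover hM hB'
  refine ⟨F.card, fun f hf hper z => ?_⟩
  -- By periodicity `z` may be reduced to the unit cell. Then `B + z` lies in `B + unitCell M`,
  -- which is covered by a number of cells that does not depend on `z`.
  have hz := cellFract_add_floor hM z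
  set z' := cellFract M z with hz'
  have h1 : ∀ x, f (x + z) = f (x + z') := by
    intro x
    rw [← hz, ← add_assoc]
    exact hper _ _
  simp_rw [h1]
  have hsub : B ⊆ (fun x => x + z') ⁻¹' (⋃ n ∈ F, cellAt M n) := fun x hx =>
    hF (Set.add_mem_add hx (cellFract_mem M z))
  have hmU : MeasurableSet (⋃ n ∈ F, cellAt M n) :=
    Finset.measurableSet_biUnion F fun n _ => measurableSet_cellAt hM n
  calc ∫⁻ x in B, f (x + z') ≤ ∫⁻ x in (fun x => x + z') ⁻¹' (⋃ n ∈ F, cellAt M n), f (x + z') :=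
        lintegral_mono_set hsub
    _ = ∫⁻ x in ⋃ n ∈ F, cellAt M n, f x :=
        ((measurePreserving_add_right (volume : Measure Plane) z').restrict_preimage
          hmU).lintegral_comp hf
    _ = ∑ n ∈ F, ∫⁻ x in cellAt M n, f x :=
        lintegral_biUnion_finset ((cellAt_pairwise hM).set_pairwise _)
          (fun n _ => measurableSet_cellAt hM n) f
    _ = F.card * ∫⁻ x in unitCell M, f x := by
        rw [Finset.sum_congr rfl fun n _ => lintegral_cellAt hM hf hper n, Finset.sum_const,
          nsmul_eq_mul]

end Lattice

/-! ### Periodic extensions and compactly supported test functions -/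

section PeriodicFunctions

variable {M : Matrix (Fin 2) (Fin 2) ℝ} {d : ℕ}

/-- The periodic extension of an element of the periodic Sobolev space. -/
noncomputable def periodicFun (v : PeriodicSobolev M d) (x : Plane) : Vec d :=
  v.1.1 (cellFract M x)

/-- The periodic extension of the weak gradient. -/
noncomputable def periodicGrad (v : PeriodicSobolev M d) (x : Plane) : Plane →L[ℝ] Vec d :=
  v.1.2 (cellFract M x)

theorem periodicFun_periodic (hM : IsUnit M.det) (v : PeriodicSobolev M d) :
    IsLatticePeriodic M (periodicFun v) := fun n x => by
  rw [periodicFun, periodicFun, cellFract_add_latticePoint hM]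

theorem periodicGrad_periodic (hM : IsUnit M.det) (v : PeriodicSobolev M d) :
    IsLatticePeriodic M (periodicGrad v) := fun n x => by
  rw [periodicGrad, periodicGrad, cellFract_add_latticePoint hM]

theorem stronglyMeasurable_periodicFun (v : PeriodicSobolev M d) :
    StronglyMeasurable (periodicFun v) :=
  (Lp.stronglyMeasurable v.1.1).comp_measurable (measurable_cellFract M)

theorem stronglyMeasurable_periodicGrad (v : PeriodicSobolev M d) :
    StronglyMeasurable (periodicGrad v) :=
  (Lp.stronglyMeasurable v.1.2).comp_measurable (measurable_cellFract M)

theorem periodicFun_eq (hM : IsUnit M.det) (v : PeriodicSobolev M d) {x : Plane}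
    (hx : x ∈ unitCell M) : periodicFun v x = v.1.1 x := by
  rw [periodicFun, cellFract_eq_self hM hx]

theorem periodicGrad_eq (hM : IsUnit M.det) (v : PeriodicSobolev M d) {x : Plane}
    (hx : x ∈ unitCell M) : periodicGrad v x = v.1.2 x := by
  rw [periodicGrad, cellFract_eq_self hM hx]

theorem eLpNorm_periodicFun (hM : IsUnit M.det) (v : PeriodicSobolev M d) (p : ℝ≥0∞) :
    eLpNorm (periodicFun v) p (volume.restrict (unitCell M)) =
      eLpNorm v.1.1 p (volume.restrict (unitCell M)) :=
  eLpNorm_congr_ae <| (ae_restrict_mem (measurableSet_unitCell hM)).mono fun _ hx =>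
    periodicFun_eq hM v hx

theorem eLpNorm_periodicGrad (hM : IsUnit M.det) (v : PeriodicSobolev M d) (p : ℝ≥0∞) :
    eLpNorm (periodicGrad v) p (volume.restrict (unitCell M)) =
      eLpNorm v.1.2 p (volume.restrict (unitCell M)) :=
  eLpNorm_congr_ae <| (ae_restrict_mem (measurableSet_unitCell hM)).mono fun _ hx =>
    periodicGrad_eq hM v hx

variable {E : Type*} [NormedAddCommGroup E]

theorem locallyIntegrable_of_periodic (hM : IsUnit M.det) {f : Plane → E}
    (hf : StronglyMeasurable f) (hper : IsLatticePeriodic M f)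
    (hint : Integrable f (volume.restrict (unitCell M))) : LocallyIntegrable f := by
  rw [locallyIntegrable_iff]
  intro K hK
  refine ⟨hf.aestronglyMeasurable, ?_⟩
  obtain ⟨N, hN⟩ := exists_lintegral_translate_le hM hK.isBounded
  have h := hN (fun x => ‖f x‖ₑ) hf.enorm (fun n x => congrArg _ (hper n x)) 0
  simp only [add_zero] at h
  exact h.trans_lt (ENNReal.mul_lt_top (ENNReal.natCast_lt_top N) hint.2)

theorem locallyIntegrable_periodicFun (hM : IsUnit M.det) (v : PeriodicSobolev M d) :
    LocallyIntegrable (periodicFun v) := by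
  refine locallyIntegrable_of_periodic hM (stronglyMeasurable_periodicFun v)
    (periodicFun_periodic hM v) (((Lp.memLp v.1.1).integrable one_le_two).congr ?_)
  exact (ae_restrict_mem (measurableSet_unitCell hM)).mono fun _ hx => (periodicFun_eq hM v hx).symm

theorem locallyIntegrable_periodicGrad (hM : IsUnit M.det) (v : PeriodicSobolev M d) :
    LocallyIntegrable (periodicGrad v) := by
  refine locallyIntegrable_of_periodic hM (stronglyMeasurable_periodicGrad v)
    (periodicGrad_periodic hM v) (((Lp.memLp v.1.2).integrable one_le_two).congr ?_)
  exact (ae_restrict_mem (measurableSet_unitCell hM)).mono fun _ hx => (periodicGrad_eq hM v hx).symm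

/-- The integral of a function vanishing outside finitely many cells. -/
theorem integral_eq_sum_cells [NormedSpace ℝ E] (hM : IsUnit M.det) {h : Plane → E}
    (hint : Integrable h) (F : Finset (Fin 2 → ℤ))
    (hF : ∀ x ∈ unitCell M, ∀ n, n ∉ F → h (x + latticePoint M n) = 0) :
    ∫ x, h x = ∑ n ∈ F, ∫ x in unitCell M, h (x + latticePoint M n) := by
  have h1 : ∫ x, h x = ∫ x in ⋃ n ∈ F, cellAt M n, h x := by
    refine (setIntegral_eq_integral_of_forall_compl_eq_zero fun x hx => ?_).symm
    have hn : cellFloor M x ∉ F := fun hmem =>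
      hx (mem_iUnion₂.2 ⟨_, hmem, (mem_cellAt_iff hM).2 rfl⟩)
    have := hF _ (cellFract_mem M x) _ hn
    rwa [cellFract_add_floor hM] at this
  rw [h1, integral_biUnion_finset F (fun n _ => measurableSet_cellAt hM n)
    ((cellAt_pairwise hM).set_pairwise _) (fun n _ => hint.integrableOn)]
  refine Finset.sum_congr rfl fun n _ => ?_
  exact ((measurePreserving_cellAt hM n).integral_comp
    (measurableEmbedding_addRight (latticePoint M n)) h).symm

theorem exists_finset_translate_eq_zero (hM : IsUnit M.det) {ψ : Plane → ℝ}
    (hψ : HasCompactSupport ψ) (R : ℝ) : ∃ F : Finset (Fin 2 → ℤ), ∀ x : Plane, ‖x‖ < R →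
      ∀ n, n ∉ F → ψ (x + latticePoint M n) = 0 := by
  obtain ⟨r, hr⟩ := hψ.isCompact.isBounded.exists_norm_le
  refine ⟨(finite_latticePoint_norm_le hM (r + R)).toFinset, fun x hx n hn => ?_⟩
  by_contra hne
  have h1 := hr _ (subset_tsupport ψ hne)
  refine hn ((Finite.mem_toFinset _).2 ?_)
  have h2 : latticePoint M n = (x + latticePoint M n) - x := by abel
  rw [mem_ofPred_eq, h2]
  exact (norm_sub_le _ _).trans (add_le_add h1 hx.le)

/-- The periodization of a compactly supported function. -/
noncomputable def periodize (M : Matrix (Fin 2) (Fin 2) ℝ) (ψ : Plane → ℝ) (x : Plane) : ℝ :=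
  ∑' n, ψ (x + latticePoint M n)

theorem periodize_periodic (M : Matrix (Fin 2) (Fin 2) ℝ) (ψ : Plane → ℝ) :
    IsLatticePeriodic M (periodize M ψ) := fun m x => by
  rw [periodize, periodize, ← (Equiv.addLeft m).tsum_eq fun n => ψ (x + latticePoint M n)]
  refine tsum_congr fun n => ?_
  rw [Equiv.coe_addLeft, latticePoint_add, add_assoc]

/-- Near `x` the periodization is a sum over a fixed finite index set, so smoothness and derivatives
can be computed term by term. -/
theorem periodize_eventuallyEq {ψ : Plane → ℝ} {R : ℝ} {F : Finset (Fin 2 → ℤ)}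
    (hF : ∀ x : Plane, ‖x‖ < R → ∀ n, n ∉ F → ψ (x + latticePoint M n) = 0) {x : Plane}
    (hx : ‖x‖ < R) : periodize M ψ =ᶠ[𝓝 x] fun y => ∑ n ∈ F, ψ (y + latticePoint M n) := by
  have : ∀ᶠ y in 𝓝 x, ‖y‖ < R := continuous_norm.continuousAt.eventually (gt_mem_nhds hx)
  filter_upwards [this] with y hy
  exact tsum_eq_sum fun n hn => hF y hy n hn

theorem contDiff_periodize (hM : IsUnit M.det) {ψ : Plane → ℝ} (hψ : HasCompactSupport ψ)
    (hs : ContDiff ℝ (⊤ : ℕ∞) ψ) : ContDiff ℝ (⊤ : ℕ∞) (periodize M ψ) := by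
  rw [contDiff_iff_contDiffAt]
  intro x
  obtain ⟨F, hF⟩ := exists_finset_translate_eq_zero hM hψ (‖x‖ + 1)
  refine ContDiffAt.congr_of_eventuallyEq ?_ (periodize_eventuallyEq hF (lt_add_one _))
  exact (ContDiff.sum fun n _ => hs.comp (contDiff_id.add contDiff_const)).contDiffAt

/-- The weak gradient of a periodic function can be tested with compactly supported functions. -/
theorem integral_fderiv_smul_periodicFun (hM : IsUnit M.det) (v : PeriodicSobolev M d)
    {ψ : Plane → ℝ} (hψ : HasCompactSupport ψ) (hs : ContDiff ℝ (⊤ : ℕ∞) ψ) (e : Plane) :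
    ∫ x, fderiv ℝ ψ x e • periodicFun v x = -∫ x, ψ x • periodicGrad v x e := by
  obtain ⟨R, hR⟩ := (isBounded_unitCell M).exists_norm_le
  -- The radius `R + 1` makes the discarded translates vanish near every point of the cell, so their
  -- derivatives vanish there as well.
  obtain ⟨F, hF⟩ := exists_finset_translate_eq_zero hM hψ (R + 1)
  have hF' : ∀ x ∈ unitCell M, ∀ n, n ∉ F → fderiv ℝ ψ (x + latticePoint M n) = 0 := by
    intro x hx n hn
    have h1 : (fun y => ψ (y + latticePoint M n)) =ᶠ[𝓝 x] fun _ => 0 := by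
      have : ∀ᶠ y in 𝓝 x, ‖y‖ < R + 1 :=
        continuous_norm.continuousAt.eventually (gt_mem_nhds ((hR x hx).trans_lt (lt_add_one R)))
      filter_upwards [this] with y hy using hF y hy n hn
    rw [← fderiv_comp_add_right, h1.fderiv_eq]
    simp
  have hFx : ∀ x ∈ unitCell M, ∀ n, n ∉ F → ψ (x + latticePoint M n) = 0 := fun x hx =>
    hF x ((hR x hx).trans_lt (lt_add_one R))
  have hψ1 : Continuous fun x => fderiv ℝ ψ x e :=
    (hs.continuous_fderiv (by simp)).clm_apply continuous_const
  have hψ2 : HasCompactSupport fun x => fderiv ℝ ψ x e := hψ.fderiv_apply (𝕜 := ℝ) e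
  have hI1 : Integrable fun x => fderiv ℝ ψ x e • periodicFun v x :=
    (locallyIntegrable_periodicFun hM v).integrable_smul_left_of_hasCompactSupport hψ1 hψ2
  have hgrad : LocallyIntegrable fun x => periodicGrad v x e := by
    rw [locallyIntegrable_iff]
    intro K hK
    exact (((locallyIntegrable_iff.1 (locallyIntegrable_periodicGrad hM v)) _ hK).apply_continuousLinearMap e)
  have hI2 : Integrable fun x => ψ x • periodicGrad v x e :=
    hgrad.integrable_smul_left_of_hasCompactSupport hs.continuous hψ
  have hcell := measurableSet_unitCell hM
  have hiv := (Lp.memLp v.1.1).integrable one_le_two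
  have hig := ((Lp.memLp v.1.2).integrable one_le_two).apply_continuousLinearMap e
  -- The periodization of `ψ` is an admissible periodic test function. What remains is to unfold
  -- both whole-plane integrals into sums over cells.
  have hper := v.2.1 (periodize M ψ) (contDiff_periodize hM hψ hs) (periodize_periodic M ψ) e
  rw [integral_eq_sum_cells hM hI1 F fun x hx n hn => by rw [hF' x hx n hn]; simp,
    integral_eq_sum_cells hM hI2 F fun x hx n hn => by rw [hFx x hx n hn]; simp]
  have h3 : ∑ n ∈ F, ∫ x in unitCell M, fderiv ℝ ψ (x + latticePoint M n) e •
      periodicFun v (x + latticePoint M n) =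
      ∫ x in unitCell M, fderiv ℝ (periodize M ψ) x e • v.1.1 x := by
    have h4 : ∀ n, ∫ x in unitCell M, fderiv ℝ ψ (x + latticePoint M n) e •
        periodicFun v (x + latticePoint M n) =
        ∫ x in unitCell M, fderiv ℝ ψ (x + latticePoint M n) e • v.1.1 x := fun n =>
      setIntegral_congr_fun hcell fun x hx => by
        simp only [periodicFun_periodic hM v n x, periodicFun_eq hM v hx]
    simp_rw [h4]
    rw [← integral_finsetSum _ fun n _ => integrable_smul_unitCell M
      (φ := fun x => fderiv ℝ ψ (x + latticePoint M n) e) (hψ1.comp (continuous_add_const (latticePoint M n))) hiv]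
    refine setIntegral_congr_fun hcell fun x hx => ?_
    rw [← Finset.sum_smul]
    congr 1
    rw [(periodize_eventuallyEq hF ((hR x hx).trans_lt (lt_add_one R))).fderiv_eq,
      fderiv_fun_sum]
    · rw [_root_.sum_apply]
      refine Finset.sum_congr rfl fun n _ => ?_
      rw [fderiv_comp_add_right]
    · intro n _
      exact ((hs.differentiable (by simp)) _).comp x (by fun_prop)
  have h5 : ∑ n ∈ F, ∫ x in unitCell M, ψ (x + latticePoint M n) •
      periodicGrad v (x + latticePoint M n) e =
      ∫ x in unitCell M, periodize M ψ x • v.1.2 x e := by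
    have h4 : ∀ n, ∫ x in unitCell M, ψ (x + latticePoint M n) •
        periodicGrad v (x + latticePoint M n) e =
        ∫ x in unitCell M, ψ (x + latticePoint M n) • v.1.2 x e := fun n =>
      setIntegral_congr_fun hcell fun x hx => by
        simp only [periodicGrad_periodic hM v n x, periodicGrad_eq hM v hx]
    simp_rw [h4]
    rw [← integral_finsetSum _ fun n _ => integrable_smul_unitCell M
      (φ := fun x => ψ (x + latticePoint M n)) (hs.continuous.comp (continuous_add_const (latticePoint M n))) hig]
    refine setIntegral_congr_fun hcell fun x hx => ?_
    rw [← Finset.sum_smul, (periodize_eventuallyEq hF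
      ((hR x hx).trans_lt (lt_add_one R))).eq_of_nhds]
  rw [h3, h5, hper]

end PeriodicFunctions

/-! ### Mollification and Lipschitz representatives -/

open scoped Convolution

section Mollification

variable {M : Matrix (Fin 2) (Fin 2) ℝ} {d : ℕ}

/-- The mollification of the periodic extension of `v`. -/
noncomputable def mollify (φ : ContDiffBump (0 : Plane)) (v : PeriodicSobolev M d) : Plane → Vec d :=
  (φ.normed volume) ⋆[ContinuousLinearMap.lsmul ℝ ℝ, volume] (periodicFun v)

theorem mollify_apply (φ : ContDiffBump (0 : Plane)) (v : PeriodicSobolev M d) (x : Plane) :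
    mollify φ v x = ∫ t, φ.normed volume t • periodicFun v (x - t) := rfl

theorem contDiff_mollify (hM : IsUnit M.det) (φ : ContDiffBump (0 : Plane))
    (v : PeriodicSobolev M d) : ContDiff ℝ 1 (mollify φ v) := by
  have h := HasCompactSupport.contDiff_convolution_left (μ := (volume : Measure Plane))
    (ContinuousLinearMap.lsmul ℝ ℝ) (φ.hasCompactSupport_normed (μ := (volume : Measure Plane))) (n := 1)
    φ.contDiff_normed
    (locallyIntegrable_periodicFun hM v)
  exact h

/-- The derivative first falls on the bump. As a function of `y = x - t` the bump is a test
function, and the weak gradient identity moves the derivative onto `v`; the sign from the reflection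
cancels the one from integration by parts. -/
theorem fderiv_mollify (hM : IsUnit M.det) (φ : ContDiffBump (0 : Plane))
    (v : PeriodicSobolev M d) (x e : Plane) :
    fderiv ℝ (mollify φ v) x e = ∫ t, φ.normed volume t • periodicGrad v (x - t) e := by
  have hφ : ContDiff ℝ (⊤ : ℕ∞) (φ.normed (volume : Measure Plane)) := φ.contDiff_normed
  have hc := φ.hasCompactSupport_normed (μ := (volume : Measure Plane))
  have h1 := HasCompactSupport.hasFDerivAt_convolution_left (μ := (volume : Measure Plane))
    (ContinuousLinearMap.lsmul ℝ ℝ) hc φ.contDiff_normed (locallyIntegrable_periodicFun hM v) x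
  have h2 : fderiv ℝ (mollify φ v) x = _ := h1.fderiv
  have hex := (HasCompactSupport.convolutionExists_left (μ := (volume : Measure Plane))
    ((ContinuousLinearMap.lsmul ℝ ℝ).precompL Plane : _ →L[ℝ] Vec d →L[ℝ] _)
    (hc.fderiv (𝕜 := ℝ)) (hφ.continuous_fderiv (by simp)) (locallyIntegrable_periodicFun hM v)) x
  rw [h2, convolution_def, ContinuousLinearMap.integral_apply hex]
  set ψ : Plane → ℝ := fun y => φ.normed volume (x - y) with hψ
  have hψs : ContDiff ℝ (⊤ : ℕ∞) ψ := hφ.comp (contDiff_const.sub contDiff_id)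
  have hψc : HasCompactSupport ψ := hc.comp_homeomorph (Homeomorph.subLeft x)
  have hd : ∀ y, fderiv ℝ ψ y e = -(fderiv ℝ (φ.normed volume) (x - y) e) := by
    intro y
    have hd1 := ((hφ.differentiable (by simp)) (x - y)).hasFDerivAt.comp y
      ((hasFDerivAt_id (𝕜 := ℝ) y).const_sub x)
    have hd2 : fderiv ℝ ψ y = _ := hd1.fderiv
    rw [hd2]
    simp
  have h3 := integral_fderiv_smul_periodicFun hM v hψc hψs e
  simp_rw [hd, neg_smul] at h3
  rw [integral_neg, neg_inj] at h3
  have h4 : ∫ t, φ.normed volume t • periodicGrad v (x - t) e =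
      ∫ y, ψ y • periodicGrad v y e := by
    rw [← integral_sub_left_eq_self (fun y => ψ y • periodicGrad v y e) volume x]
    simp [hψ]
  rw [h4, ← h3, ← integral_sub_left_eq_self (fun y => fderiv ℝ (φ.normed volume) (x - y) e •
    periodicFun v y) volume x]
  simp [ContinuousLinearMap.precompL_apply]

theorem norm_integral_bump_smul_le {E : Type*} [NormedAddCommGroup E] [NormedSpace ℝ E]
    (φ : ContDiffBump (0 : Plane)) (f : Plane → E) :
    ‖∫ t, φ.normed volume t • f t‖ₑ ≤ ∫⁻ t, ENNReal.ofReal (φ.normed volume t) * ‖f t‖ₑ := by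
  refine (enorm_integral_le_lintegral_enorm _).trans_eq (lintegral_congr fun t => ?_)
  rw [enorm_smul, Real.enorm_of_nonneg (φ.nonneg_normed t)]

theorem lintegral_bump (φ : ContDiffBump (0 : Plane)) :
    ∫⁻ t, ENNReal.ofReal (φ.normed volume t) = 1 := by
  rw [← ofReal_integral_eq_lintegral_ofReal φ.integrable_normed
    (Eventually.of_forall φ.nonneg_normed), φ.integral_normed, ENNReal.ofReal_one]

theorem measurable_bump (φ : ContDiffBump (0 : Plane)) :
    Measurable fun t => ENNReal.ofReal (φ.normed (volume : Measure Plane) t) :=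
  ENNReal.measurable_ofReal.comp φ.continuous_normed.measurable

theorem enorm_fderiv_mollify_le (hM : IsUnit M.det) (φ : ContDiffBump (0 : Plane))
    (v : PeriodicSobolev M d) (x : Plane) : ‖fderiv ℝ (mollify φ v) x‖ₑ ≤
      ∫⁻ t, ENNReal.ofReal (φ.normed volume t) * ‖periodicGrad v (x - t)‖ₑ := by
  refine ContinuousLinearMap.opENorm_le_bound _ fun e => ?_
  rw [fderiv_mollify hM]
  refine (norm_integral_bump_smul_le φ _).trans ?_
  rw [← lintegral_mul_const]
  · refine lintegral_mono fun t => ?_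
    rw [mul_assoc]
    gcongr
    exact ContinuousLinearMap.le_opENorm _ _
  · refine (measurable_bump φ).mul ?_
    exact ((stronglyMeasurable_periodicGrad v).enorm).comp (measurable_const.sub measurable_id)

/-- Averaging with a probability density does not increase `L²` norms, up to the number of cells. -/
theorem exists_lintegral_average_sq_le (hM : IsUnit M.det) {B : Set Plane}
    (hB : Bornology.IsBounded B) : ∃ N : ℕ, ∀ (φ : ContDiffBump (0 : Plane)) (f : Plane → ℝ≥0∞),
      Measurable f → IsLatticePeriodic M f →
      ∫⁻ x in B, (∫⁻ t, ENNReal.ofReal (φ.normed volume t) * f (x - t)) ^ (2 : ℝ) ≤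
        N * ∫⁻ x in unitCell M, f x ^ (2 : ℝ) := by
  obtain ⟨N, hN⟩ := exists_lintegral_translate_le hM hB
  refine ⟨N, fun φ f hf hper => ?_⟩
  have hφm := measurable_bump φ
  have h1 : ∀ x, (∫⁻ t, ENNReal.ofReal (φ.normed volume t) * f (x - t)) ^ (2 : ℝ) ≤
      ∫⁻ t, ENNReal.ofReal (φ.normed volume t) * f (x - t) ^ (2 : ℝ) := by
    intro x
    have hfx : Measurable fun t => f (x - t) := hf.comp (measurable_const.sub measurable_id)
    set ν : Measure Plane := volume.withDensity fun t => ENNReal.ofReal (φ.normed volume t) with hν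
    have hν1 : IsProbabilityMeasure ν := ⟨by
      rw [hν, withDensity_apply _ MeasurableSet.univ, Measure.restrict_univ, lintegral_bump]⟩
    have h2 : ∀ g : Plane → ℝ≥0∞, Measurable g → ∫⁻ t, ENNReal.ofReal (φ.normed volume t) * g t =
        ∫⁻ t, g t ∂ν := fun g hg => by
      rw [hν, lintegral_withDensity_eq_lintegral_mul _ hφm hg]
      rfl
    rw [h2 _ hfx, h2 _ (hfx.pow_const _)]
    -- Jensen's inequality for the square, obtained from Hölder's against the constant `1` under a
    -- probability measure.
    have h3 := ENNReal.lintegral_mul_le_Lp_mul_Lq ν (Real.HolderConjugate.two_two)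
      hfx.aemeasurable (aemeasurable_const (b := (1 : ℝ≥0∞)))
    simp only [Pi.mul_apply, mul_one, ENNReal.one_rpow, lintegral_const, measure_univ] at h3
    calc _ ≤ ((∫⁻ t, f (x - t) ^ (2 : ℝ) ∂ν) ^ (1 / (2 : ℝ))) ^ (2 : ℝ) := by gcongr
      _ = _ := by
        rw [← ENNReal.rpow_mul]
        norm_num
  calc _ ≤ ∫⁻ x in B, ∫⁻ t, ENNReal.ofReal (φ.normed volume t) * f (x - t) ^ (2 : ℝ) :=
        lintegral_mono h1
    _ = ∫⁻ t, ∫⁻ x in B, ENNReal.ofReal (φ.normed volume t) * f (x - t) ^ (2 : ℝ) := by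
        refine lintegral_lintegral_swap (Measurable.aemeasurable ?_)
        exact (hφm.comp measurable_snd).mul
          ((hf.comp (measurable_fst.sub measurable_snd)).pow_const _)
    _ ≤ ∫⁻ t, ENNReal.ofReal (φ.normed volume t) * (N * ∫⁻ x in unitCell M, f x ^ (2 : ℝ)) := by
        refine lintegral_mono fun t => ?_
        rw [lintegral_const_mul]
        · gcongr
          have := hN (fun x => f x ^ (2 : ℝ)) (hf.pow_const _)
            (fun n x => congrArg (· ^ (2 : ℝ)) (hper n x)) (-t)
          simpa only [sub_eq_add_neg] using this
        · exact (hf.comp (measurable_id.sub_const t)).pow_const _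
    _ = _ := by rw [lintegral_mul_const _ hφm, lintegral_bump, one_mul]

/-- A sequence of mollifiers concentrating at the origin. -/
noncomputable def mollifier (n : ℕ) : ContDiffBump (0 : Plane) where
  rIn := 1 / ((n : ℝ) + 1)
  rOut := 2 * (1 / ((n : ℝ) + 1))
  rIn_pos := by positivity
  rIn_lt_rOut := by
    have : 0 < 1 / ((n : ℝ) + 1) := by positivity
    linarith

/-- Lebesgue differentiation, available for bumps whose outer and inner radii have bounded ratio;
for `mollifier` the ratio is `2`. -/
theorem ae_tendsto_mollify (hM : IsUnit M.det) (v : PeriodicSobolev M d) :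
    ∀ᵐ x : Plane, Tendsto (fun n => mollify (mollifier n) v x) atTop (𝓝 (periodicFun v x)) := by
  refine ContDiffBump.ae_convolution_tendsto_right_of_locallyIntegrable (K := 2) (μ := volume) ?_ ?_
    (locallyIntegrable_periodicFun hM v)
  · have h := (tendsto_one_div_add_atTop_nhds_zero_nat (𝕜 := ℝ)).const_mul (2 : ℝ)
    rwa [mul_zero] at h
  · exact Eventually.of_forall fun n => le_rfl

/-- A periodic Sobolev function with bounded gradient is Lipschitz. -/
theorem exists_lipschitz_representative (hM : IsUnit M.det) (v : PeriodicSobolev M d) {κ : ℝ≥0}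
    (hv : ∀ᵐ x ∂(volume.restrict (unitCell M)), ‖v.1.2 x‖ ≤ κ) :
    ∃ f : Plane → Vec d, LipschitzWith (lipschitzExtensionConstant (Vec d) * κ) f ∧
      f =ᵐ[volume] periodicFun v := by
  have hg : ∀ᵐ x : Plane, ‖periodicGrad v x‖ₑ ≤ κ := by
    filter_upwards [ae_cellFract hM hv] with x hx
    rw [enorm_eq_nnnorm]
    exact_mod_cast hx
  have hL : ∀ n, LipschitzWith κ (mollify (mollifier n) v) := by
    intro n
    refine lipschitzWith_of_nnnorm_fderiv_le ((contDiff_mollify hM _ v).differentiable (by simp))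
      fun x => ?_
    have h1 := enorm_fderiv_mollify_le hM (mollifier n) v x
    have h2 : ∫⁻ t, ENNReal.ofReal ((mollifier n).normed volume t) * ‖periodicGrad v (x - t)‖ₑ ≤
        ∫⁻ t, ENNReal.ofReal ((mollifier n).normed volume t) * κ := by
      refine lintegral_mono_ae ?_
      have h3 : ∀ᵐ t : Plane, ‖periodicGrad v (x - t)‖ₑ ≤ κ :=
        (Measure.measurePreserving_sub_left (volume : Measure Plane) x).quasiMeasurePreserving.ae hg
      filter_upwards [h3] with t ht
      gcongr
    rw [lintegral_mul_const _ (measurable_bump (mollifier n)), lintegral_bump, one_mul] at h2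
    have h4 := h1.trans h2
    rw [enorm_eq_nnnorm] at h4
    exact_mod_cast h4
  -- The mollifications share the Lipschitz constant `κ`, which survives the limit on this set of
  -- full measure. Extending a vector-valued function to the plane costs the factor
  -- `lipschitzExtensionConstant`; only its independence of `v` matters later.
  set s := {x | Tendsto (fun n => mollify (mollifier n) v x) atTop (𝓝 (periodicFun v x))} with hs
  have hlip : LipschitzOnWith κ (periodicFun v) s := by
    refine LipschitzOnWith.of_dist_le_mul fun x hx y hy => ?_
    exact le_of_tendsto (hx.dist hy) (Eventually.of_forall fun n => (hL n).dist_le_mul x y)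
  obtain ⟨f, hf, hfs⟩ := hlip.extend_finite_dimension
  exact ⟨f, hf, (ae_tendsto_mollify hM v).mono fun x hx => (hfs hx).symm⟩

end Mollification

/-! ### Sobolev embedding of periodic functions -/

section Embedding

variable {M : Matrix (Fin 2) (Fin 2) ℝ} {d : ℕ}

theorem norm_fst_coe_le (v : PeriodicSobolev M d) : ‖v.1.1‖ ≤ ‖v‖ := by
  rw [← Submodule.norm_coe v]
  exact norm_fst_le v.1

theorem norm_snd_coe_le (v : PeriodicSobolev M d) : ‖v.1.2‖ ≤ ‖v‖ := by
  rw [← Submodule.norm_coe v]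
  exact norm_snd_le v.1

theorem eLpNorm_periodicFun_two_le (hM : IsUnit M.det) (v : PeriodicSobolev M d) :
    eLpNorm (periodicFun v) 2 (volume.restrict (unitCell M)) ≤ ENNReal.ofReal ‖v‖ := by
  rw [eLpNorm_periodicFun hM, ← Lp.enorm_def, ← ofReal_norm]
  exact ENNReal.ofReal_le_ofReal (norm_fst_coe_le v)

theorem eLpNorm_periodicGrad_two_le (hM : IsUnit M.det) (v : PeriodicSobolev M d) :
    eLpNorm (periodicGrad v) 2 (volume.restrict (unitCell M)) ≤ ENNReal.ofReal ‖v‖ := by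
  rw [eLpNorm_periodicGrad hM, ← Lp.enorm_def, ← ofReal_norm]
  exact ENNReal.ofReal_le_ofReal (norm_snd_coe_le v)

/-- A local form of the Sobolev inequality in the plane, for `C¹` functions. -/
theorem exists_eLpNorm_le_of_contDiff (d : ℕ) {Γ : Set Plane} {r : ℝ} (hr : 0 < r)
    (hΓ : Γ ⊆ Metric.closedBall 0 r) {p : ℕ} (hp : 1 ≤ p) :
    ∃ C : ℝ≥0, ∀ F : Plane → Vec d, ContDiff ℝ 1 F → eLpNorm F p (volume.restrict Γ) ≤
      C * (eLpNorm F 2 (volume.restrict (Metric.closedBall 0 (r + 1))) +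
        eLpNorm (fderiv ℝ F) 2 (volume.restrict (Metric.closedBall 0 (r + 1)))) := by
  -- The cutoff equals `1` on the ball containing `Γ`, and the global inequality is applied to `χ •
  -- F`.
  let χ : ContDiffBump (0 : Plane) := ⟨r, r + 1, hr, by linarith⟩
  set B := Metric.closedBall (0 : Plane) (r + 1) with hB
  have hχs : ContDiff ℝ 1 χ := χ.contDiff
  obtain ⟨Cχ, hCχ⟩ := (χ.hasCompactSupport.fderiv (𝕜 := ℝ)).exists_bound_of_continuous
    (hχs.continuous_fderiv (by simp))
  have hCχ0 : 0 ≤ Cχ := (norm_nonneg _).trans (hCχ 0)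
  have hBfin : volume B ≠ ∞ := (isCompact_closedBall _ _).measure_lt_top.ne
  -- The Sobolev inequality needs `1 ≤ q < 2` and `1/q - 1/2 ≤ 1/p`; this choice gives `1/q - 1/2 =
  -- 1/(2p)`.
  let q : ℝ≥0 := 2 * p / (p + 1)
  have hp' : (1 : ℝ) ≤ p := by exact_mod_cast hp
  have hqr : (q : ℝ) = 2 * p / (p + 1) := by simp [q]
  have hq1 : 1 ≤ q := by
    rw [← NNReal.coe_le_coe, hqr, NNReal.coe_one, le_div_iff₀ (by positivity)]
    linarith
  have hq2 : (q : ℝ) < 2 := by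
    rw [hqr, div_lt_iff₀ (by positivity)]
    linarith
  have hfr : Module.finrank ℝ Plane = 2 := by simp
  have hpq : (q : ℝ)⁻¹ - (Module.finrank ℝ Plane : ℝ)⁻¹ ≤ (((p : ℝ≥0) : ℝ))⁻¹ := by
    rw [hfr, hqr]
    have hp0 : (0 : ℝ) < p := by linarith
    rw [inv_div, NNReal.coe_natCast]
    have : ((p : ℝ) + 1) / (2 * p) - ((2 : ℕ) : ℝ)⁻¹ = (p : ℝ)⁻¹ / 2 := by
      push_cast
      field_simp
      ring
    rw [this]
    have := inv_pos.2 hp0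
    linarith
  set c₁ := eLpNormLESNormFDerivOfLeConst (Vec d) (volume : Measure Plane) B q p with hc₁
  -- The price of passing from the `L^q` to the `L²` norm of the gradient on the ball `B`.
  set c₂ := (volume B) ^ (1 / (q : ℝ) - 1 / 2) with hc₂
  have hc₂fin : c₂ ≠ ∞ := by
    refine ENNReal.rpow_ne_top_of_nonneg ?_ hBfin
    rw [sub_nonneg]
    exact one_div_le_one_div_of_le (by linarith [(NNReal.coe_le_coe.2 hq1 : (1 : ℝ) ≤ q)]) hq2.le
  refine ⟨c₁ * c₂.toNNReal * (1 + Cχ.toNNReal), fun F hF => ?_⟩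
  set h : Plane → Vec d := fun x => χ x • F x with hh
  have hhs : ContDiff ℝ 1 h := hχs.smul hF
  have hsupp : Function.support h ⊆ Metric.ball 0 (r + 1) := by
    intro x hx
    have : χ x ≠ 0 := fun h0 => hx (by simp [hh, h0])
    have h2 : x ∈ Function.support χ := this
    rwa [χ.support_eq] at h2
  have hsupp' : Function.support (fderiv ℝ h) ⊆ B :=
    (support_fderiv_subset ℝ).trans
      ((closure_mono hsupp).trans Metric.closure_ball_subset_closedBall)
  have h1 : eLpNorm F p (volume.restrict Γ) ≤ eLpNorm h p volume := by
    have h2 : eLpNorm F p (volume.restrict Γ) ≤ eLpNorm F p (volume.restrict (Metric.closedBall 0 r)) :=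
      eLpNorm_mono_measure _ (Measure.restrict_mono hΓ le_rfl)
    have h3 : eLpNorm F p (volume.restrict (Metric.closedBall 0 r)) =
        eLpNorm h p (volume.restrict (Metric.closedBall 0 r)) := by
      refine eLpNorm_congr_ae ?_
      filter_upwards [ae_restrict_mem Metric.isClosed_closedBall.measurableSet] with x hx
      have : χ x = 1 := χ.one_of_mem_closedBall hx
      simp [hh, this]
    rw [h3] at h2
    exact h2.trans (eLpNorm_mono_measure _ Measure.restrict_le_self)
  have h2 : eLpNorm h p volume ≤ c₁ * eLpNorm (fderiv ℝ h) q volume := by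
    have := eLpNorm_le_eLpNorm_fderiv_of_le (volume : Measure Plane) hhs
      (hsupp.trans Metric.ball_subset_closedBall) hq1
      (by rw [← NNReal.coe_lt_coe, NNReal.coe_natCast, hfr]; exact_mod_cast hq2)
      (q := (p : ℝ≥0)) hpq Metric.isBounded_closedBall
    simpa using this
  have hfm : AEStronglyMeasurable (fderiv ℝ h) (volume.restrict B) :=
    (hhs.continuous_fderiv (by simp)).aestronglyMeasurable
  have h3 : eLpNorm (fderiv ℝ h) q volume ≤ eLpNorm (fderiv ℝ h) 2 (volume.restrict B) * c₂ := by
    have h0 : eLpNorm (fderiv ℝ h) q (volume.restrict B) = eLpNorm (fderiv ℝ h) q volume := by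
      rw [← eLpNorm_norm (fderiv ℝ h), ← eLpNorm_norm (fderiv ℝ h)]
      exact eLpNorm_restrict_eq_of_support_subset (f := fun x => ‖fderiv ℝ h x‖)
        fun x hx => hsupp' fun h0 => hx (norm_eq_zero.2 h0)
    rw [← h0]
    have hq2' : (q : ℝ≥0∞) ≤ 2 := by exact_mod_cast hq2.le
    have := eLpNorm_le_eLpNorm_mul_rpow_measure_univ hq2' hfm
    simpa [hc₂] using this
  have h4 : eLpNorm (fderiv ℝ h) 2 (volume.restrict B) ≤
      eLpNorm (fderiv ℝ F) 2 (volume.restrict B) +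
        ENNReal.ofReal Cχ * eLpNorm F 2 (volume.restrict B) := by
    have hFm : AEStronglyMeasurable F (volume.restrict B) := hF.continuous.aestronglyMeasurable
    have hFm' : AEStronglyMeasurable (fderiv ℝ F) (volume.restrict B) :=
      (hF.continuous_fderiv (by simp)).aestronglyMeasurable
    have h5 : eLpNorm (fderiv ℝ h) 2 (volume.restrict B) ≤
        eLpNorm ((fun x => ‖fderiv ℝ F x‖) + fun x => Cχ * ‖F x‖) 2 (volume.restrict B) := by
      refine eLpNorm_mono_real fun x => ?_
      have h6 : fderiv ℝ h x = χ x • fderiv ℝ F x + (fderiv ℝ χ x).smulRight (F x) :=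
        fderiv_fun_smul ((hχs.differentiable (by simp)) x) ((hF.differentiable (by simp)) x)
      rw [h6]
      refine (norm_add_le _ _).trans (add_le_add ?_ ?_)
      · rw [norm_smul, Real.norm_of_nonneg χ.nonneg]
        exact mul_le_of_le_one_left (norm_nonneg _) χ.le_one
      · rw [ContinuousLinearMap.norm_smulRight_apply]
        exact mul_le_mul_of_nonneg_right (hCχ x) (norm_nonneg _)
    refine h5.trans ((eLpNorm_add_le hFm'.norm (hFm.norm.const_mul _) one_le_two).trans ?_)
    have h7 : eLpNorm (fun x => Cχ * ‖F x‖) 2 (volume.restrict B) =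
        ENNReal.ofReal Cχ * eLpNorm F 2 (volume.restrict B) := by
      have := eLpNorm_const_smul Cχ (fun x => ‖F x‖) 2 (volume.restrict B)
      rw [eLpNorm_norm, Real.enorm_of_nonneg hCχ0] at this
      exact this
    rw [h7, eLpNorm_norm]
  calc eLpNorm F p (volume.restrict Γ) ≤ c₁ * ((eLpNorm (fderiv ℝ F) 2 (volume.restrict B) +
        ENNReal.ofReal Cχ * eLpNorm F 2 (volume.restrict B)) * c₂) :=
        h1.trans (h2.trans (by gcongr; exact h3.trans (by gcongr)))
    _ = c₁ * c₂ * (eLpNorm (fderiv ℝ F) 2 (volume.restrict B) +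
        ENNReal.ofReal Cχ * eLpNorm F 2 (volume.restrict B)) := by ring
    _ ≤ c₁ * c₂ * ((1 + ENNReal.ofReal Cχ) * (eLpNorm F 2 (volume.restrict B) +
        eLpNorm (fderiv ℝ F) 2 (volume.restrict B))) := by
        gcongr
        calc _ ≤ eLpNorm (fderiv ℝ F) 2 (volume.restrict B) +
              ENNReal.ofReal Cχ * eLpNorm F 2 (volume.restrict B) +
              (eLpNorm F 2 (volume.restrict B) +
              ENNReal.ofReal Cχ * eLpNorm (fderiv ℝ F) 2 (volume.restrict B)) := le_self_add
          _ = _ := by ring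
    _ = _ := by
        push_cast
        rw [ENNReal.coe_toNNReal hc₂fin, ENNReal.ofReal]
        ring

/-- Periodic functions in `W^{1,2}` of the plane lie in all `L^p`, `p < ∞`. -/
theorem exists_eLpNorm_le_norm (hM : IsUnit M.det) (d : ℕ) {p : ℕ} (hp : 1 ≤ p) :
    ∃ C : ℝ≥0, ∀ v : PeriodicSobolev M d,
      eLpNorm (periodicFun v) p (volume.restrict (unitCell M)) ≤ C * ENNReal.ofReal ‖v‖ := by
  obtain ⟨r, hr⟩ := (isBounded_unitCell M).exists_pos_norm_le
  obtain ⟨C, hC⟩ := exists_eLpNorm_le_of_contDiff d (Γ := unitCell M) hr.1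
    (fun x hx => mem_closedBall_zero_iff.2 (hr.2 x hx)) hp
  set B := Metric.closedBall (0 : Plane) (r + 1) with hB
  obtain ⟨N, hN⟩ := exists_lintegral_average_sq_le hM (B := B) Metric.isBounded_closedBall
  set c : ℝ≥0∞ := (N : ℝ≥0∞) ^ (1 / (2 : ℝ)) with hc
  have hcfin : c ≠ ∞ := ENNReal.rpow_ne_top_of_nonneg (by norm_num) (ENNReal.natCast_ne_top N)
  -- Used for the mollification and for its derivative: both are dominated by averages of periodic
  -- functions, whose `L²` norm on `B` is controlled by that on one cell.
  have havg : ∀ {E E' : Type} [NormedAddCommGroup E] [NormedAddCommGroup E']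
      (φ : ContDiffBump (0 : Plane)) (f : Plane → E) (F : Plane → E'), StronglyMeasurable f →
      IsLatticePeriodic M f →
      (∀ x, ‖F x‖ₑ ≤ ∫⁻ t, ENNReal.ofReal (φ.normed volume t) * ‖f (x - t)‖ₑ) →
      eLpNorm F 2 (volume.restrict B) ≤ c * eLpNorm f 2 (volume.restrict (unitCell M)) := by
    intro E E' _ _ φ f F hf hper hF
    rw [eLpNorm_eq_lintegral_rpow_enorm_toReal two_ne_zero ENNReal.ofNat_ne_top,
      eLpNorm_eq_lintegral_rpow_enorm_toReal two_ne_zero ENNReal.ofNat_ne_top, ENNReal.toReal_ofNat,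
      hc, ← ENNReal.mul_rpow_of_nonneg _ _ (by norm_num)]
    refine ENNReal.rpow_le_rpow ?_ (by norm_num)
    refine le_trans (lintegral_mono fun x => ?_)
      (hN φ (fun x => ‖f x‖ₑ) hf.enorm fun n x => congrArg _ (hper n x))
    exact ENNReal.rpow_le_rpow (hF x) (by norm_num)
  refine ⟨C * (c.toNNReal * 2), fun v => ?_⟩
  have h1 : ∀ n, eLpNorm (mollify (mollifier n) v) p (volume.restrict (unitCell M)) ≤
      C * (c * 2) * ENNReal.ofReal ‖v‖ := by
    intro n
    refine (hC _ (contDiff_mollify hM _ v)).trans ?_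
    have h2 := havg (mollifier n) (periodicFun v) (mollify (mollifier n) v)
      (stronglyMeasurable_periodicFun v) (periodicFun_periodic hM v)
      (fun x => by rw [mollify_apply]; exact norm_integral_bump_smul_le _ _)
    have h3 := havg (mollifier n) (periodicGrad v) (fderiv ℝ (mollify (mollifier n) v))
      (stronglyMeasurable_periodicGrad v) (periodicGrad_periodic hM v)
      (fun x => enorm_fderiv_mollify_le hM _ v x)
    have h4 := h2.trans (mul_le_mul_right (eLpNorm_periodicFun_two_le hM v) c)
    have h5 := h3.trans (mul_le_mul_right (eLpNorm_periodicGrad_two_le hM v) c)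
    refine (mul_le_mul_right (add_le_add h4 h5) _).trans_eq ?_
    ring
  push_cast
  rw [ENNReal.coe_toNNReal hcfin]
  -- The bound is uniform in the mollifier, so Fatou's lemma transfers it to the almost everywhere
  -- limit.
  refine (Lp.eLpNorm_lim_le_liminf_eLpNorm
    (fun n => (contDiff_mollify hM (mollifier n) v).continuous.aestronglyMeasurable) _
    (ae_restrict_of_ae (ae_tendsto_mollify hM v))).trans ?_
  exact liminf_le_of_frequently_le' (Frequently.of_forall h1)

set_option maxHeartbeats 1000000 in
/-- The sup norm of a Lipschitz periodic function is controlled by its `W^{1,2}` norm. -/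
theorem exists_norm_apply_le (hM : IsUnit M.det) (d : ℕ) (Λ : ℝ≥0) {η : ℝ} (hη : 0 < η) :
    ∃ C : ℝ, ∀ (v : PeriodicSobolev M d) (f : Plane → Vec d), LipschitzWith Λ f →
      f =ᵐ[volume] periodicFun v → ∀ x, ‖f x‖ ≤ η + C * ‖v‖ := by
  -- On a ball of this radius a `Λ`-Lipschitz function varies by at most `η`. A value exceeding `η +
  -- C ‖v‖` would then force a large `L²` norm on that ball.
  set r : ℝ := η / (Λ + 1) with hr
  have hr0 : 0 < r := by positivity
  set B := Metric.ball (0 : Plane) r with hB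
  obtain ⟨N, hN⟩ := exists_lintegral_translate_le hM (B := B) Metric.isBounded_ball
  set b := volume.real B with hb
  have hbpos : 0 < b := 
    ENNReal.toReal_pos (Metric.measure_ball_pos volume 0 hr0).ne' measure_ball_lt_top.ne
  -- The constant is read off from `c² b ≤ N ‖v‖²`, where `|f| ≥ c` on a ball of area `b` whose
  -- translates are controlled by `N` cells.
  refine ⟨Real.sqrt (N / b), fun v f hf hfv x => ?_⟩
  by_contra hcon
  set c := ‖f x‖ - η with hc
  have hc0 : √(N / b) * ‖v‖ < c := by linarith
  have hcpos : 0 < c := lt_of_le_of_lt (by positivity) hc0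
  have h1 : ∀ y ∈ B, c ≤ ‖f (y + x)‖ := by
    intro y hy
    have h2 := hf.dist_le_mul x (y + x)
    rw [dist_comm x, dist_eq_norm, dist_eq_norm, add_sub_cancel_right] at h2
    have h3 : ‖y‖ < r := mem_ball_zero_iff.1 hy
    have h4 : (Λ : ℝ) * ‖y‖ ≤ η := by
      have : (Λ + 1 : ℝ) * r = η := by
        rw [hr]
        field_simp
      nlinarith [norm_nonneg y, Λ.2]
    have h5 := norm_sub_norm_le (f x) (f (y + x))
    linarith
  have h2 : ENNReal.ofReal c ^ (2 : ℝ) * volume B ≤ N * ENNReal.ofReal ‖v‖ ^ (2 : ℝ) := by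
    calc ENNReal.ofReal c ^ (2 : ℝ) * volume B = ∫⁻ _ in B, ENNReal.ofReal c ^ (2 : ℝ) := by
          rw [setLIntegral_const]
      _ ≤ ∫⁻ y in B, ‖periodicFun v (y + x)‖ₑ ^ (2 : ℝ) := by
          refine lintegral_mono_ae ?_
          have hae : ∀ᵐ y : Plane, f (y + x) = periodicFun v (y + x) :=
            (measurePreserving_add_right (volume : Measure Plane) x).quasiMeasurePreserving.ae hfv
          filter_upwards [ae_restrict_mem Metric.isOpen_ball.measurableSet, ae_restrict_of_ae hae]
            with y hy hfy
          rw [← hfy, ← ofReal_norm]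
          exact ENNReal.rpow_le_rpow (ENNReal.ofReal_le_ofReal (h1 y hy)) (by norm_num)
      _ ≤ N * ∫⁻ y in unitCell M, ‖periodicFun v y‖ₑ ^ (2 : ℝ) :=
          hN (fun y => ‖periodicFun v y‖ₑ ^ (2 : ℝ))
            ((stronglyMeasurable_periodicFun v).enorm.pow_const _)
            (fun n y => congrArg (fun z => ‖z‖ₑ ^ (2 : ℝ)) (periodicFun_periodic hM v n y)) x
      _ ≤ N * ENNReal.ofReal ‖v‖ ^ (2 : ℝ) := by
          gcongr
          have h3 := eLpNorm_nnreal_pow_eq_lintegral (f := periodicFun v) (p := 2)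
            (μ := volume.restrict (unitCell M)) two_ne_zero
          have h4 := eLpNorm_periodicFun_two_le hM v
          have h5 : ∫⁻ y in unitCell M, ‖periodicFun v y‖ₑ ^ (2 : ℝ) =
              eLpNorm (periodicFun v) 2 (volume.restrict (unitCell M)) ^ (2 : ℝ) := by
            simpa using h3.symm
          rw [h5]
          exact ENNReal.rpow_le_rpow h4 (by norm_num)
  have h3 : c ^ 2 * b ≤ N * ‖v‖ ^ 2 := by
    have h4 := ENNReal.toReal_mono (by finiteness) h2
    rw [ENNReal.toReal_mul, ENNReal.toReal_mul] at h4
    simpa [hb, Measure.real, ENNReal.toReal_ofReal hcpos.le, ENNReal.toReal_ofReal (norm_nonneg v)]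
      using h4
  have h4 : (√(N / b) * ‖v‖) ^ 2 < c ^ 2 := by gcongr
  rw [mul_pow, Real.sq_sqrt (by positivity), div_mul_eq_mul_div, div_lt_iff₀ hbpos] at h4
  linarith

end Embedding

/-! ### Kronecker's theorem by Fourier series -/

section Kronecker

variable {ι : Type*} [Fintype ι]

theorem mFourier_add_apply (n : ι → ℤ) (x y : UnitAddTorus ι) :
    UnitAddTorus.mFourier n (x + y) = UnitAddTorus.mFourier n x * UnitAddTorus.mFourier n y := by
  simp only [UnitAddTorus.mFourier, ContinuousMap.coe_mk, ← Finset.prod_mul_distrib]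
  refine Finset.prod_congr rfl fun i _ => ?_
  simp [fourier_apply, smul_add, AddCircle.toCircle_add]

theorem exists_int_of_mFourier_coe_eq_one (n : ι → ℤ) (a : ι → ℝ)
    (h : UnitAddTorus.mFourier n (fun i => (a i : UnitAddCircle)) = 1) :
    ∃ p : ℤ, ∑ i, n i * a i = p := by
  simp only [UnitAddTorus.mFourier, ContinuousMap.coe_mk, fourier_coe_apply] at h
  rw [← Complex.exp_sum, Complex.exp_eq_one_iff] at h
  obtain ⟨p, hp⟩ := h
  refine ⟨p, ?_⟩
  have h2 : (2 * Real.pi * Complex.I : ℂ) ≠ 0 := Complex.two_pi_I_ne_zero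
  have h3 : ((∑ i, n i * a i : ℝ) : ℂ) * (2 * Real.pi * Complex.I) =
      ((p : ℝ) : ℂ) * (2 * Real.pi * Complex.I) := by
    push_cast
    rw [← hp, Finset.sum_mul]
    refine Finset.sum_congr rfl fun i _ => ?_
    simp
    ring
  exact_mod_cast mul_right_cancel₀ h2 h3

/-- A continuous function on the torus, invariant under translations on which no nontrivial
character is trivial, is constant. -/
theorem eq_apply_zero_of_translation_invariant {f : C(UnitAddTorus ι, ℂ)}
    {H : Set (UnitAddTorus ι)} (hf : ∀ h ∈ H, ∀ x, f (x + h) = f x)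
    (hH : ∀ n : ι → ℤ, (∀ h ∈ H, UnitAddTorus.mFourier n h = 1) → n = 0) (x : UnitAddTorus ι) :
    f x = f 0 := by
  have h0 : ∀ n, n ≠ 0 → UnitAddTorus.mFourierCoeff f n = 0 := by
    intro n hn
    have hn' : ¬ ∀ h ∈ H, UnitAddTorus.mFourier (-n) h = 1 := fun h => hn (by simpa using hH _ h)
    push Not at hn'
    obtain ⟨h, hh, hne⟩ := hn'
    -- Translation by `h` multiplies the coefficient by a character value different from `1`, while
    -- invariance leaves it unchanged.
    have h1 : UnitAddTorus.mFourierCoeff f n =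
        UnitAddTorus.mFourier (-n) h * UnitAddTorus.mFourierCoeff f n := by
      have h2 := integral_add_left_eq_self
        (μ := Measure.pi fun _ : ι => (AddCircle.haarAddCircle : Measure UnitAddCircle))
        (fun t => UnitAddTorus.mFourier (-n) t • f t) h
      rw [UnitAddTorus.mFourierCoeff]
      refine h2.symm.trans ?_
      rw [← integral_const_mul]
      refine integral_congr_ae (Eventually.of_forall fun t => ?_)
      beta_reduce
      rw [mFourier_add_apply, add_comm h t, hf h hh t, smul_eq_mul, smul_eq_mul]
      ring
    have h2 : (UnitAddTorus.mFourier (-n) h - 1) * UnitAddTorus.mFourierCoeff f n = 0 := by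
      rw [sub_mul, one_mul, ← h1, sub_self]
    exact (mul_eq_zero.1 h2).resolve_left (sub_ne_zero.2 hne)
  have hs : Summable (UnitAddTorus.mFourierCoeff f) :=
    summable_of_ne_finset_zero (s := {0}) fun n hn => h0 n (by simpa using hn)
  have h1 : ∀ y, f y = UnitAddTorus.mFourierCoeff f 0 := by
    intro y
    have h2 := UnitAddTorus.hasSum_mFourier_series_apply_of_summable hs y
    have h3 := hasSum_single (f := fun i => UnitAddTorus.mFourierCoeff f i • UnitAddTorus.mFourier i y)
      0 (fun n hn => by simp [h0 n hn])
    rw [h2.unique h3]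
    simp [UnitAddTorus.mFourier_zero]
  rw [h1, h1]

/-- Kronecker's theorem. -/
theorem exists_int_approx (D : Matrix ι ι ℝ)
    (hD : ∀ n p : ι → ℤ, (∀ k, ∑ i, (n i : ℝ) * D i k = p k) → n = 0) (y : ι → ℝ) {ε : ℝ}
    (hε : 0 < ε) : ∃ m p : ι → ℤ, ∀ i, |y i - (∑ k, D i k * m k) - p i| < ε := by
  classical
  let φ : (ι → ℤ) → UnitAddTorus ι := fun m i => ((∑ k, D i k * m k : ℝ) : UnitAddCircle)
  have hφ : ∀ m m', φ (m + m') = φ m + φ m' := by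
    intro m m'
    funext i
    simp [φ, mul_add, Finset.sum_add_distrib]
  have hφ0 : φ 0 = 0 := by
    funext i
    simp [φ]
  -- The distance to the orbit is continuous, invariant because the orbit is a subgroup, and zero at
  -- the origin. If it is constant, the orbit is dense.
  let f : C(UnitAddTorus ι, ℂ) :=
    ⟨fun x => (Metric.infDist x (range φ) : ℂ), by
      exact Complex.continuous_ofReal.comp (Metric.continuous_infDist_pt _)⟩
  have hf : ∀ h ∈ range φ, ∀ x, f (x + h) = f x := by
    rintro _ ⟨m, rfl⟩ x
    have h1 : (fun z => z + φ m) '' range φ = range φ := by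
      ext z
      constructor
      · rintro ⟨_, ⟨m', rfl⟩, rfl⟩
        exact ⟨m' + m, hφ _ _⟩
      · rintro ⟨m', rfl⟩
        exact ⟨_, ⟨m' - m, rfl⟩, (hφ _ _).symm.trans (by rw [sub_add_cancel])⟩
    have h2 := Metric.infDist_image (isometry_add_right (φ m)) (x := x) (t := range φ)
    rw [h1] at h2
    exact congrArg (fun r : ℝ => (r : ℂ)) h2
  have h0 := eq_apply_zero_of_translation_invariant hf (fun n hn => by
    have h1 : ∀ k, ∃ p : ℤ, ∑ i, (n i : ℝ) * D i k = p := by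
      intro k
      refine exists_int_of_mFourier_coe_eq_one n (fun i => D i k) ?_
      -- A character trivial on the orbit is trivial on its generators, the columns of `D`; this is
      -- the integrality that the hypothesis excludes.
      have h2 : φ (Pi.single k 1) = fun i => (D i k : UnitAddCircle) := by
        funext i
        have : ∑ k', D i k' * ((Pi.single k 1 : ι → ℤ) k' : ℝ) = D i k := by simp [Pi.single_apply]
        exact congrArg _ this
      rw [← h2]
      exact hn _ ⟨_, rfl⟩
    choose p hp using h1
    exact hD n p hp) (fun i => (y i : UnitAddCircle))
  have h1 : Metric.infDist (fun i => (y i : UnitAddCircle)) (range φ) = 0 := by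
    have h2 : Metric.infDist (0 : UnitAddTorus ι) (range φ) = 0 :=
      Metric.infDist_zero_of_mem ⟨0, hφ0⟩
    have h3 : ((Metric.infDist (fun i => (y i : UnitAddCircle)) (range φ) : ℝ) : ℂ) =
      (Metric.infDist (0 : UnitAddTorus ι) (range φ) : ℝ) := h0
    rw [h2] at h3
    exact_mod_cast h3
  obtain ⟨_, ⟨m, rfl⟩, hm⟩ := (Metric.infDist_lt_iff (range_nonempty φ)).1 (h1.trans_lt hε)
  -- The norm on the circle is the distance to the nearest integer, so rounding realizes it.
  refine ⟨m, fun i => round (y i - ∑ k, D i k * m k), fun i => ?_⟩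
  rw [← UnitAddCircle.norm_eq, AddCircle.coe_sub, ← dist_eq_norm]
  exact ((dist_pi_lt_iff hε).1 hm) i

end Kronecker

/-! ### Incommensurability and density -/

section Density

variable {𝒜 : Fin 2 → Type*} {d : ℕ} (S : Bilayer 𝒜 d)

theorem latticePoint_apply (M : Matrix (Fin 2) (Fin 2) ℝ) (n : Fin 2 → ℤ) (i : Fin 2) :
    latticePoint M n i = ∑ k, M i k * n k := by
  fin_cases i <;> simp [latticePoint, Matrix.toLpLin_apply]

theorem Bilayer.isUnit_det_moireMatrix : IsUnit S.moire.det :=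
  Matrix.isUnit_nonsing_inv_det _ S.isUnit_det_moire

theorem Bilayer.moire_inv : S.moire⁻¹ = (S.A 0)⁻¹ - (S.A 1)⁻¹ :=
  Matrix.nonsing_inv_nonsing_inv _ S.isUnit_det_moire

theorem Bilayer.eq_zero_of_transpose_eq {n p : Fin 2 → ℤ}
    (h : ∀ k, ∑ i, (n i : ℝ) * (S.A 0)⁻¹ i k = ∑ i, (p i : ℝ) * (S.A 1)⁻¹ i k) :
    n = 0 ∧ p = 0 := by
  have h1 := S.incommensurate n (-p) (by
    ext k
    rw [latticePoint_neg, PiLp.add_apply, PiLp.neg_apply, latticePoint_apply, latticePoint_apply]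
    have h2 := congrArg (fun x => 2 * Real.pi * x) (h k)
    simp only [Fin.sum_univ_two] at h2 ⊢
    simp only [Matrix.smul_apply, Matrix.transpose_apply, smul_eq_mul, PiLp.zero_apply]
    linarith)
  exact ⟨h1.1, by simpa using h1.2⟩

/-- Since `A_ℳ⁻¹ = A₁⁻¹ - A₂⁻¹`, integrality of `n A_ℳ⁻¹ A_j` rearranges into an equality between a
vector of one reciprocal lattice and one of the other, which incommensurability allows only at zero.
-/
theorem Bilayer.eq_zero_of_dual {j : Fin 2} {n p : Fin 2 → ℤ}
    (h : ∀ k, ∑ i, (n i : ℝ) * (S.moire⁻¹ * S.A j) i k = p k) : n = 0 := by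
  have hv : Matrix.vecMul (fun i => (n i : ℝ)) (S.moire⁻¹ * S.A j) = fun k => (p k : ℝ) := by
    funext k
    exact h k
  have hv2 : Matrix.vecMul (fun i => (n i : ℝ)) S.moire⁻¹ =
      Matrix.vecMul (fun k => (p k : ℝ)) (S.A j)⁻¹ := by
    rw [← hv, Matrix.vecMul_vecMul, Matrix.mul_assoc, Matrix.mul_nonsing_inv _ (S.isUnit_det j),
      Matrix.mul_one]
  rw [S.moire_inv, Matrix.vecMul_sub] at hv2
  fin_cases j
  · have h3 : Matrix.vecMul (fun k => ((n - p) k : ℝ)) (S.A 0)⁻¹ =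
        Matrix.vecMul (fun k => (n k : ℝ)) (S.A 1)⁻¹ := by
      have : (fun k => ((n - p) k : ℝ)) = (fun k => (n k : ℝ)) - fun k => (p k : ℝ) := by
        funext k
        simp
      rw [this, Matrix.sub_vecMul, ← sub_eq_zero]
      rw [← sub_eq_zero] at hv2
      rw [← hv2]
      simp only [Fin.zero_eta]
      abel
    exact (S.eq_zero_of_transpose_eq (fun k => congrFun h3 k)).2
  · have h3 : Matrix.vecMul (fun k => (n k : ℝ)) (S.A 0)⁻¹ =
        Matrix.vecMul (fun k => ((n + p) k : ℝ)) (S.A 1)⁻¹ := by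
      have : (fun k => ((n + p) k : ℝ)) = (fun k => (n k : ℝ)) + fun k => (p k : ℝ) := by
        funext k
        simp
      rw [this, Matrix.add_vecMul, ← sub_eq_zero]
      rw [← sub_eq_zero] at hv2
      rw [← hv2]
      simp only [Fin.mk_one]
      abel
    exact (S.eq_zero_of_transpose_eq (fun k => congrFun h3 k)).1

/-- The lattice of a layer and the moiré lattice together are dense in the plane. -/
theorem Bilayer.exists_norm_sub_lt (j : Fin 2) (z : Plane) {ε : ℝ} (hε : 0 < ε) :
    ∃ n m : Fin 2 → ℤ, ‖z - latticePoint (S.A j) n - latticePoint S.moire m‖ < ε := by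
  let T : Plane →L[ℝ] Plane := LinearMap.toContinuousLinearMap S.moire.toEuclideanLin
  have hT : ∀ x, T x = S.moire.toEuclideanLin x := fun _ => rfl
  -- In moiré coordinates the moiré lattice is `ℤ²`, and the claim is approximation modulo integers.
  -- The tolerance accounts for the norm of `T` and for summing two coordinates.
  set y : Plane := S.moire⁻¹.toEuclideanLin z with hy
  obtain ⟨n, m, h⟩ := exists_int_approx (S.moire⁻¹ * S.A j) (fun n p hp => S.eq_zero_of_dual hp) y
    (ε := ε / (2 * (‖T‖ + 1))) (by positivity)
  refine ⟨n, m, ?_⟩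
  set e : Plane := y - S.moire⁻¹.toEuclideanLin (latticePoint (S.A j) n) -
    WithLp.toLp 2 (fun i => (m i : ℝ)) with he
  have h1 : z - latticePoint (S.A j) n - latticePoint S.moire m = T e := by
    rw [he, hT, map_sub, map_sub, toEuclideanLin_inv_apply S.isUnit_det_moireMatrix,
      toEuclideanLin_inv_apply S.isUnit_det_moireMatrix]
    rfl
  have h2 : ∀ i, |e i| < ε / (2 * (‖T‖ + 1)) := by
    intro i
    convert h i using 2
    rw [← latticePoint_apply, he, latticePoint, latticePoint, toEuclideanLin_mul_apply]
    simp only [PiLp.sub_apply]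
  have h3 : ‖e‖ ≤ |e 0| + |e 1| := by
    rw [EuclideanSpace.norm_eq, Real.sqrt_le_left (by positivity), Fin.sum_univ_two]
    simp only [Real.norm_eq_abs]
    nlinarith [abs_nonneg (e 0), abs_nonneg (e 1)]
  rw [h1]
  calc ‖T e‖ ≤ ‖T‖ * ‖e‖ := T.le_opNorm e
    _ ≤ (‖T‖ + 1) * ‖e‖ := by gcongr; linarith
    _ ≤ (‖T‖ + 1) * (|e 0| + |e 1|) := by gcongr
    _ < (‖T‖ + 1) * (ε / (2 * (‖T‖ + 1)) + ε / (2 * (‖T‖ + 1))) := by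
        gcongr
        exacts [h2 0, h2 1]
    _ = ε := by field_simp; ring

end Density

/-! ### Continuous representatives -/

section Representatives

variable {M : Matrix (Fin 2) (Fin 2) ℝ} {d : ℕ}

theorem representative_ae_eq (v : PeriodicSobolev M d) :
    representative v =ᵐ[volume] periodicFun v := by
  unfold representative
  split_ifs with h
  · exact h.choose_spec.2
  · rfl

/-- Continuous functions that agree almost everywhere agree, so the choice in `representative` is
determined. Linearity and periodicity hold at every point by the same principle. -/
theorem representative_eq {v : PeriodicSobolev M d} {f : Plane → Vec d} (hf : Continuous f)
    (hfv : f =ᵐ[volume] periodicFun v) : representative v = f := by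
  have h : ∃ f : Plane → Vec d, Continuous f ∧
      f =ᵐ[volume] fun x => v.1.1 (cellFract M x) := ⟨f, hf, hfv⟩
  have h1 : Continuous (representative v) := by
    unfold representative
    rw [dif_pos h]
    exact h.choose_spec.1
  exact Continuous.ae_eq_iff_eq volume h1 hf |>.1 ((representative_ae_eq v).trans hfv.symm)

theorem periodicFun_add (hM : IsUnit M.det) (v w : PeriodicSobolev M d) :
    periodicFun (v + w) =ᵐ[volume] periodicFun v + periodicFun w := by
  filter_upwards [ae_cellFract hM (Lp.coeFn_add v.1.1 w.1.1)] with x hx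
  exact hx

theorem periodicFun_smul (hM : IsUnit M.det) (c : ℝ) (v : PeriodicSobolev M d) :
    periodicFun (c • v) =ᵐ[volume] c • periodicFun v := by
  filter_upwards [ae_cellFract hM (Lp.coeFn_smul c v.1.1)] with x hx
  exact hx

theorem representative_add_ae (hM : IsUnit M.det) (v w : PeriodicSobolev M d) :
    representative (v + w) =ᵐ[volume] representative v + representative w :=
  (representative_ae_eq _).trans ((periodicFun_add hM v w).trans
    ((representative_ae_eq v).symm.add (representative_ae_eq w).symm))

theorem representative_smul_ae (hM : IsUnit M.det) (c : ℝ) (v : PeriodicSobolev M d) :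
    representative (c • v) =ᵐ[volume] c • representative v :=
  (representative_ae_eq _).trans ((periodicFun_smul hM c v).trans
    ((representative_ae_eq v).symm.fun_comp (c • ·)))

theorem representative_add (hM : IsUnit M.det) {v w : PeriodicSobolev M d}
    (hv : Continuous (representative v)) (hw : Continuous (representative w)) :
    representative (v + w) = representative v + representative w :=
  representative_eq (hv.add hw) ((representative_add_ae hM v w).symm.trans (representative_ae_eq _))

theorem representative_smul (hM : IsUnit M.det) (c : ℝ) {v : PeriodicSobolev M d}
    (hv : Continuous (representative v)) : representative (c • v) = c • representative v :=
  representative_eq (hv.const_smul c)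
    ((representative_smul_ae hM c v).symm.trans (representative_ae_eq _))

theorem representative_sub (hM : IsUnit M.det) {v w : PeriodicSobolev M d}
    (hv : Continuous (representative v)) (hw : Continuous (representative w)) :
    representative (v - w) = representative v - representative w := by
  refine representative_eq (hv.sub hw) ?_
  filter_upwards [representative_ae_eq v, representative_ae_eq w,
    ae_cellFract hM (Lp.coeFn_sub v.1.1 w.1.1)] with x h1 h2 h3
  rw [Pi.sub_apply, h1, h2]
  exact h3.symm

theorem gradient_combination_ae (a b : ℝ) (v w : PeriodicSobolev M d) :
    ⇑(a • v + b • w).1.2 =ᵐ[volume.restrict (unitCell M)]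
      fun x => a • v.1.2 x + b • w.1.2 x := by
  have e : (a • v + b • w).1.2 = a • v.1.2 + b • w.1.2 := rfl
  rw [e]
  filter_upwards [Lp.coeFn_add (a • v.1.2) (b • w.1.2), Lp.coeFn_smul a v.1.2,
    Lp.coeFn_smul b w.1.2] with x h3 h4 h5
  rw [h3, Pi.add_apply, h4, h5]
  rfl

/-- A lattice translate of the continuous representative is again one. -/
theorem representative_periodic (hM : IsUnit M.det) {v : PeriodicSobolev M d}
    (hv : Continuous (representative v)) : IsLatticePeriodic M (representative v) := by
  intro n x
  have h : representative v = fun x => representative v (x + latticePoint M n) := by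
    refine representative_eq (hv.comp (continuous_add_const _)) ?_
    have h1 := (measurePreserving_add_right (volume : Measure Plane)
      (latticePoint M n)).quasiMeasurePreserving.ae (representative_ae_eq v)
    filter_upwards [h1] with y hy
    rw [hy, periodicFun_periodic hM]
  exact (congrFun h x).symm

end Representatives

/-! ### Pointwise bounds for admissible displacements -/

theorem Continuous.le_of_ae_le {X : Type*} [TopologicalSpace X] [MeasurableSpace X] {μ : Measure X}
    [μ.IsOpenPosMeasure] {f : X → ℝ} (hf : Continuous f) {C : ℝ} (h : ∀ᵐ x ∂μ, f x ≤ C) (x : X) :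
    f x ≤ C := by
  have h1 : Dense {x | f x ≤ C} := Measure.dense_of_ae h
  have h2 : IsClosed {x | f x ≤ C} := isClosed_le hf continuous_const
  have h3 := h1.closure_eq
  rw [h2.closure_eq] at h3
  exact (eq_univ_iff_forall.1 h3) x

section Admissible

variable {𝒜 : Fin 2 → Type*} {d : ℕ} {S : Bilayer 𝒜 d} {κ : ℝ}

/-- A Lipschitz constant for the fields of all admissible displacements. -/
noncomputable def fieldLipschitzConstant (d : ℕ) (κ : ℝ) : ℝ≥0 :=
  lipschitzExtensionConstant (Vec d) * κ.toNNReal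

theorem Bilayer.lipschitzWith_representative (hκ : 0 ≤ κ) {u : S.Displacement}
    (hu : u ∈ S.admissible κ) (j : Fin 2) (α : 𝒜 j) :
    LipschitzWith (fieldLipschitzConstant d κ) (representative (u j α)) := by
  obtain ⟨f, hf, hfv⟩ := exists_lipschitz_representative S.isUnit_det_moireMatrix (u j α)
    (κ := κ.toNNReal) (by rw [Real.coe_toNNReal κ hκ]; exact hu.1 j α)
  rw [representative_eq hf.continuous hfv]
  exact hf

theorem Bilayer.continuous_representative (hκ : 0 ≤ κ) {u : S.Displacement}
    (hu : u ∈ S.admissible κ) (j : Fin 2) (α : 𝒜 j) : Continuous (representative (u j α)) :=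
  (Bilayer.lipschitzWith_representative hκ hu j α).continuous

/-- Admissibility gives continuity, which upgrades linearity from almost every point to every point.
The stencils are therefore exactly affine along segments in the admissible set. -/
theorem Bilayer.field_add_smul_sub (hκ : 0 ≤ κ) {u v : S.Displacement} (hu : u ∈ S.admissible κ)
    (hv : v ∈ S.admissible κ) (t : ℝ) (j : Fin 2) (x : Plane) (α : 𝒜 j) :
    S.field (u + t • (v - u)) j x α = S.field u j x α + t • S.field (v - u) j x α := by
  have hu' := Bilayer.continuous_representative hκ hu j α
  have hv' := Bilayer.continuous_representative hκ hv j α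
  have h1 := representative_sub S.isUnit_det_moireMatrix hv' hu'
  have hc : Continuous (representative (v j α - u j α)) := by
    rw [h1]
    exact hv'.sub hu'
  have h2 := representative_smul S.isUnit_det_moireMatrix t hc
  have hc2 : Continuous (representative (t • (v j α - u j α))) := by
    rw [h2]
    exact hc.const_smul t
  have h3 := representative_add S.isUnit_det_moireMatrix hu' hc2
  change representative (u j α + t • (v j α - u j α)) x = _
  rw [h3, h2]
  rfl

theorem Bilayer.field_sub (hκ : 0 ≤ κ) {u v : S.Displacement} (hu : u ∈ S.admissible κ)
    (hv : v ∈ S.admissible κ) (j : Fin 2) (x : Plane) (α : 𝒜 j) :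
    S.field (v - u) j x α = S.field v j x α - S.field u j x α :=
  congrFun (representative_sub S.isUnit_det_moireMatrix
    (Bilayer.continuous_representative hκ hv j α)
    (Bilayer.continuous_representative hκ hu j α)) x

theorem Bilayer.norm_field_sub_same_le (hκ : 0 ≤ κ) {u : S.Displacement}
    (hu : u ∈ S.admissible κ) (j : Fin 2) (n : Fin 2 → ℤ) (α α' : 𝒜 j) (x : Plane) :
    ‖S.field u j (x + S.R j n) α' - S.field u j x α‖ ≤ κ := by
  refine Continuous.le_of_ae_le (μ := (volume : Measure Plane)) (f := fun x =>
    ‖S.field u j (x + S.R j n) α' - S.field u j x α‖) ?_ (hu.2.1 j n α α') x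
  exact (((Bilayer.continuous_representative hκ hu j α').comp (continuous_add_const _)).sub
    (Bilayer.continuous_representative hκ hu j α)).norm

/-- By incommensurability, the differences between the two layers are bounded by `κ` at all pairs
of points. -/
theorem Bilayer.norm_field_sub_opposite_le (hκ : 0 ≤ κ) {u : S.Displacement}
    (hu : u ∈ S.admissible κ) (j : Fin 2) (α : 𝒜 j) (β : 𝒜 (1 - j)) (y z : Plane) :
    ‖S.field u (1 - j) z β - S.field u j y α‖ ≤ κ := by
  have hF := Bilayer.lipschitzWith_representative hκ hu (1 - j) β
  have h1 : ∀ n, ‖S.field u (1 - j) (S.transfer j y + S.R (1 - j) n) β - S.field u j y α‖ ≤ κ := by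
    intro n
    refine Continuous.le_of_ae_le (μ := (volume : Measure Plane)) (f := fun x =>
      ‖S.field u (1 - j) (S.transfer j x + S.R (1 - j) n) β - S.field u j x α‖) ?_
      (hu.2.2 j n α β) y
    exact ((hF.continuous.comp ((continuous_toEuclideanLin _).add_const _)).sub
      (Bilayer.continuous_representative hκ hu j α)).norm
  refine le_of_forall_pos_le_add fun ε hε => ?_
  set Λ := fieldLipschitzConstant d κ with hΛ
  -- Up to a small error, `z` is `A_{3-j} A_j⁻¹ y` plus a vector of the opposite lattice plus a
  -- moiré vector. The admissibility condition covers the lattice vector, periodicity the moiré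
  -- vector, and the Lipschitz bound the error.
  obtain ⟨n, m, h⟩ := S.exists_norm_sub_lt (1 - j) (z - S.transfer j y)
    (ε := ε / (Λ + 1)) (by positivity)
  have h2 : S.field u (1 - j) z β = representative (u (1 - j) β) (z - latticePoint S.moire m) := by
    conv_lhs => rw [← sub_add_cancel z (latticePoint S.moire m)]
    exact representative_periodic S.isUnit_det_moireMatrix hF.continuous m _
  have h3 := hF.dist_le_mul (z - latticePoint S.moire m) (S.transfer j y + S.R (1 - j) n)
  rw [dist_eq_norm, dist_eq_norm] at h3
  have h4 : z - latticePoint S.moire m - (S.transfer j y + S.R (1 - j) n) =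
      z - S.transfer j y - latticePoint (S.A (1 - j)) n - latticePoint S.moire m := by
    rw [Bilayer.R]
    abel
  rw [h4] at h3
  have h5 : (Λ : ℝ) * ‖z - S.transfer j y - latticePoint (S.A (1 - j)) n -
      latticePoint S.moire m‖ ≤ ε := by
    have h6 : ((Λ : ℝ) + 1) * (ε / (Λ + 1)) = ε := by field_simp
    have h7 := mul_le_mul_of_nonneg_left h.le (by positivity : (0 : ℝ) ≤ Λ + 1)
    rw [h6] at h7
    refine le_trans ?_ h7
    gcongr
    linarith
  have h8 := norm_sub_le_norm_sub_add_norm_sub (S.field u (1 - j) z β)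
    (S.field u (1 - j) (S.transfer j y + S.R (1 - j) n) β) (S.field u j y α)
  have h9 : ‖S.field u (1 - j) z β - S.field u (1 - j) (S.transfer j y + S.R (1 - j) n) β‖ ≤ ε := by
    rw [h2]
    exact h3.trans h5
  linarith [h1 n]

theorem Bilayer.convex_admissible (hκ : 0 ≤ κ) : Convex ℝ (S.admissible κ) := by
  intro u hu v hv a b ha hb hab
  -- Each condition confines some vector to a ball of radius `κ`, and balls are convex.
  have hcomb : ∀ {E : Type} [NormedAddCommGroup E] [NormedSpace ℝ E] (p q : E), ‖p‖ ≤ κ → ‖q‖ ≤ κ →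
      ‖a • p + b • q‖ ≤ κ := by
    intro E _ _ p q hp hq
    have h := (convex_closedBall (0 : E) κ) (mem_closedBall_zero_iff.2 hp)
      (mem_closedBall_zero_iff.2 hq) ha hb hab
    exact mem_closedBall_zero_iff.1 h
  have hfield : ∀ (j : Fin 2) (x : Plane) (α : 𝒜 j),
      S.field (a • u + b • v) j x α = a • S.field u j x α + b • S.field v j x α := by
    intro j x α
    have hu' := Bilayer.continuous_representative hκ hu j α
    have hv' := Bilayer.continuous_representative hκ hv j α
    have h1 := representative_smul S.isUnit_det_moireMatrix a hu'
    have h2 := representative_smul S.isUnit_det_moireMatrix b hv'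
    have h3 := representative_add S.isUnit_det_moireMatrix (v := a • u j α) (w := b • v j α)
      (by rw [h1]; exact hu'.const_smul a) (by rw [h2]; exact hv'.const_smul b)
    change representative (a • u j α + b • v j α) x = _
    rw [h3, h1, h2]
    rfl
  refine ⟨fun j α => ?_, fun j n α α' => ?_, fun j n α α' => ?_⟩
  · filter_upwards [hu.1 j α, hv.1 j α, gradient_combination_ae a b (u j α) (v j α)]
      with x h1 h2 h3
    refine (congrArg norm h3).trans_le ?_
    exact hcomb _ _ h1 h2
  · filter_upwards [hu.2.1 j n α α', hv.2.1 j n α α'] with x h1 h2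
    rw [hfield, hfield, add_sub_add_comm, ← smul_sub, ← smul_sub]
    exact hcomb _ _ h1 h2
  · filter_upwards [hu.2.2 j n α α', hv.2.2 j n α α'] with x h1 h2
    rw [hfield, hfield, add_sub_add_comm, ← smul_sub, ← smul_sub]
    exact hcomb _ _ h1 h2

variable [∀ j, Fintype (𝒜 j)]

/-- `W^{1,2}` does not embed into `L^∞` in the plane. Within the admissible set the common Lipschitz
constant makes up for this, and Sobolev convergence becomes uniform convergence. -/
theorem Bilayer.eventually_norm_field_sub_le (hκ : 0 ≤ κ) {u : S.Displacement}
    (hu : u ∈ S.admissible κ) {η : ℝ} (hη : 0 < η) : ∀ᶠ u' in 𝓝[S.admissible κ] u,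
      ∀ (j : Fin 2) (x : Plane) (α : 𝒜 j), ‖S.field u' j x α - S.field u j x α‖ ≤ η := by
  -- A difference of two admissible fields has at most twice the Lipschitz constant; half of `η` is
  -- left for the norm term.
  obtain ⟨C, hC⟩ := exists_norm_apply_le S.isUnit_det_moireMatrix d
    (fieldLipschitzConstant d κ + fieldLipschitzConstant d κ) (half_pos hη)
  have hlim : Tendsto (fun u' : S.Displacement => |C| * ‖u' - u‖) (𝓝[S.admissible κ] u) (𝓝 0) := by
    have : Tendsto (fun u' : S.Displacement => |C| * ‖u' - u‖) (𝓝 u) (𝓝 (|C| * ‖u - u‖)) :=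
      Continuous.tendsto (by fun_prop) u
    rw [sub_self, norm_zero, mul_zero] at this
    exact this.mono_left nhdsWithin_le_nhds
  filter_upwards [hlim.eventually (Iio_mem_nhds (half_pos hη)), self_mem_nhdsWithin]
    with u' h1 h2 j x α
  have hL := (Bilayer.lipschitzWith_representative hκ h2 j α).sub
    (Bilayer.lipschitzWith_representative hκ hu j α)
  have h3 := representative_sub S.isUnit_det_moireMatrix
    (Bilayer.continuous_representative hκ h2 j α) (Bilayer.continuous_representative hκ hu j α)
  have h4 := hC (u' j α - u j α) _ hL (by
    have h5 := representative_ae_eq (u' j α - u j α)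
    rw [h3] at h5
    exact h5) x
  have h6 : ‖u' j α - u j α‖ ≤ ‖u' - u‖ :=
    (norm_le_pi_norm ((u' - u) j) α).trans (norm_le_pi_norm (u' - u) j)
  have h7 : C * ‖u' j α - u j α‖ ≤ |C| * ‖u' - u‖ := by
    gcongr
    exact le_abs_self C
  have h8 : |C| * ‖u' - u‖ < η / 2 := h1
  refine (show ‖S.field u' j x α - S.field u j x α‖ ≤ _ from h4).trans ?_
  linarith

end Admissible

/-! ### Hölder's inequality and bounded convergence -/

section IntegralInequalities

variable {X : Type*} [MeasurableSpace X] {μ : Measure X}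

theorem eLpNorm_natCast_eq {E : Type*} [NormedAddCommGroup E] (f : X → E) {p : ℕ} (hp : 1 ≤ p) :
    eLpNorm f p μ = (∫⁻ x, ‖f x‖ₑ ^ (p : ℝ) ∂μ) ^ (1 / (p : ℝ)) := by
  rw [eLpNorm_eq_lintegral_rpow_enorm_toReal (by exact_mod_cast (by omega : p ≠ 0))
    (ENNReal.natCast_ne_top p), ENNReal.toReal_natCast]

/-- Generalized Hölder with exponent `2` for `g` and `2ℓ` for each of the `ℓ` factors: `1/2 + ℓ ·
1/(2ℓ) = 1`. -/
theorem lintegral_enorm_mul_prod_le {ℓ : ℕ} (hℓ : 1 ≤ ℓ) {g : X → ℝ} {f : Fin ℓ → X → ℝ}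
    (hg : AEStronglyMeasurable g μ) (hf : ∀ n, AEStronglyMeasurable (f n) μ) :
    ∫⁻ x, ‖g x * ∏ n, f n x‖ₑ ∂μ ≤ eLpNorm g 2 μ * ∏ n, eLpNorm (f n) (2 * ℓ : ℕ) μ := by
  have hℓ0 : (0 : ℝ) < ℓ := by exact_mod_cast hℓ
  have h := ENNReal.lintegral_mul_prod_norm_pow_le (μ := μ) Finset.univ
    (g := fun x => ‖g x‖ₑ ^ (2 : ℝ)) (f := fun n x => ‖f n x‖ₑ ^ ((2 * ℓ : ℕ) : ℝ))
    (hg.enorm.pow_const _) (fun n _ => (hf n).enorm.pow_const _) (1 / 2)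
    (p := fun _ => 1 / ((2 * ℓ : ℕ) : ℝ)) (by
      rw [Finset.sum_const, Finset.card_univ, Fintype.card_fin, nsmul_eq_mul]
      push_cast
      field_simp
      norm_num) (by norm_num) (fun _ _ => by positivity)
  have h2 : eLpNorm g 2 μ = (∫⁻ x, ‖g x‖ₑ ^ (2 : ℝ) ∂μ) ^ (1 / (2 : ℝ)) := by
    simpa using eLpNorm_natCast_eq (μ := μ) g one_le_two
  simp only [eLpNorm_natCast_eq (μ := μ) _ (by omega : 1 ≤ 2 * ℓ), h2]
  refine le_trans (lintegral_mono fun x => ?_) h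
  refine le_of_eq ?_
  rw [enorm_mul, ← ENNReal.rpow_mul]
  congr 1
  · norm_num
  · simp only [enorm_eq_nnnorm, nnnorm_prod, ENNReal.ofNNReal_finsetProd]
    refine Finset.prod_congr rfl fun n _ => ?_
    rw [← ENNReal.rpow_mul, mul_one_div_cancel (by positivity), ENNReal.rpow_one]

/-- Dominated convergence along sequences, which suffices for a countably generated filter; the
bounds hold only eventually, so an initial piece of each sequence is dropped. -/
theorem tendsto_eLpNorm_two_of_bounded [IsFiniteMeasure μ] {ι : Type*} {l : Filter ι}
    [l.IsCountablyGenerated] {f : ι → X → ℝ} {C : ℝ}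
    (hm : ∀ᶠ i in l, AEStronglyMeasurable (f i) μ) (hb : ∀ᶠ i in l, ∀ᵐ x ∂μ, |f i x| ≤ C)
    (hlim : ∀ᵐ x ∂μ, Tendsto (fun i => f i x) l (𝓝 0)) :
    Tendsto (fun i => eLpNorm (f i) 2 μ) l (𝓝 0) := by
  have h2 : ∀ i, eLpNorm (f i) 2 μ = (∫⁻ x, ‖f i x‖ₑ ^ (2 : ℝ) ∂μ) ^ (1 / (2 : ℝ)) := fun i => by
    simpa using eLpNorm_natCast_eq (μ := μ) (f i) one_le_two
  simp only [h2]
  have h0 : Tendsto (fun i => ∫⁻ x, ‖f i x‖ₑ ^ (2 : ℝ) ∂μ) l (𝓝 (∫⁻ _, 0 ∂μ)) := by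
    refine tendsto_of_seq_tendsto fun x hx => ?_
    obtain ⟨N, hN⟩ := eventually_atTop.1 (hx.eventually (hm.and hb))
    rw [← tendsto_add_atTop_iff_nat N]
    refine tendsto_lintegral_of_dominated_convergence' (fun _ => ENNReal.ofReal C ^ (2 : ℝ))
      (fun n => (hN _ (Nat.le_add_left N n)).1.enorm.pow_const _) (fun n => ?_) ?_ ?_
    · filter_upwards [(hN _ (Nat.le_add_left N n)).2] with y hy
      gcongr
      rw [← ofReal_norm]
      exact ENNReal.ofReal_le_ofReal hy
    · rw [lintegral_const]
      finiteness
    · filter_upwards [hlim] with y hy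
      have h3 := tendsto_zero_iff_enorm_tendsto_zero.1
        ((hy.comp hx).comp (tendsto_add_atTop_nat N))
      have h4 := ((ENNReal.continuous_rpow_const (y := 2)).tendsto 0).comp h3
      rw [ENNReal.zero_rpow_of_pos (by norm_num)] at h4
      exact h4
  have h5 := ((ENNReal.continuous_rpow_const (y := 1 / 2)).tendsto _).comp h0
  rw [lintegral_zero, ENNReal.zero_rpow_of_pos (by norm_num)] at h5
  exact h5

end IntegralInequalities

/-! ### Uniform bounds under affine substitutions -/

section Translates

variable {M : Matrix (Fin 2) (Fin 2) ℝ} {d : ℕ}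

theorem quasiMeasurePreserving_affine {T : Plane →ₗ[ℝ] Plane} (hT : LinearMap.det T ≠ 0)
    (z : Plane) : Measure.QuasiMeasurePreserving (fun x => T x + z)
      (volume : Measure Plane) (volume : Measure Plane) :=
  (measurePreserving_add_right (volume : Measure Plane) z).quasiMeasurePreserving.comp
    (Measure.LinearMap.quasiMeasurePreserving (volume : Measure Plane) T hT)

theorem aestronglyMeasurable_representative (v : PeriodicSobolev M d) :
    AEStronglyMeasurable (representative v) volume :=
  (stronglyMeasurable_periodicFun v).aestronglyMeasurable.congr (representative_ae_eq v).symm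

-- The constant must not depend on `z`, which later runs over all lattice vectors of the stencil.
-- After a linear change of variables the cell lies in a fixed ball, and periodicity bounds
-- integrals over all translates of that ball at once.
set_option maxHeartbeats 1000000 in
theorem exists_eLpNorm_comp_affine_le (hM : IsUnit M.det) (d : ℕ) {T : Plane →ₗ[ℝ] Plane}
    (hT : LinearMap.det T ≠ 0) {p : ℕ} (hp : 1 ≤ p) :
    ∃ C : ℝ≥0, ∀ (v : PeriodicSobolev M d) (z : Plane),
      eLpNorm (fun x => representative v (T x + z)) p (volume.restrict (unitCell M)) ≤
        C * ENNReal.ofReal ‖v‖ := by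
  obtain ⟨C, hC⟩ := exists_eLpNorm_le_norm hM d hp
  let T' : Plane →L[ℝ] Plane := LinearMap.toContinuousLinearMap T
  have hTm : Measurable T := T'.continuous.measurable
  obtain ⟨r, hr⟩ := (isBounded_unitCell M).exists_norm_le
  set B := Metric.closedBall (0 : Plane) (‖T'‖ * r) with hB
  obtain ⟨N, hN⟩ := exists_lintegral_translate_le hM (B := B) Metric.isBounded_closedBall
  set c : ℝ≥0∞ := ENNReal.ofReal |(LinearMap.det T)⁻¹| * N with hc
  have hcfin : c ^ (1 / (p : ℝ)) ≠ ∞ :=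
    ENNReal.rpow_ne_top_of_nonneg (by positivity)
      (ENNReal.mul_ne_top ENNReal.ofReal_ne_top (ENNReal.natCast_ne_top N))
  refine ⟨(c ^ (1 / (p : ℝ))).toNNReal * C, fun v z => ?_⟩
  have h1 : eLpNorm (fun x => representative v (T x + z)) p (volume.restrict (unitCell M)) =
      eLpNorm (fun x => periodicFun v (T x + z)) p (volume.restrict (unitCell M)) :=
    eLpNorm_congr_ae (ae_restrict_of_ae
      ((quasiMeasurePreserving_affine hT z).ae (representative_ae_eq v)))
  set g : Plane → ℝ≥0∞ := fun x => ‖periodicFun v x‖ₑ ^ (p : ℝ) with hg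
  have hgm : Measurable g := (stronglyMeasurable_periodicFun v).enorm.pow_const _
  have h2 : ∫⁻ x in unitCell M, g (T x + z) ≤ c * ∫⁻ x in unitCell M, g x := by
    calc ∫⁻ x in unitCell M, g (T x + z) =
          ∫⁻ x, (unitCell M).indicator (fun x => g (T x + z)) x :=
          (lintegral_indicator (measurableSet_unitCell hM) _).symm
      _ ≤ ∫⁻ x, B.indicator (fun y => g (y + z)) (T x) := by
          refine lintegral_mono fun x => ?_
          by_cases hx : x ∈ unitCell M
          · have : T x ∈ B := mem_closedBall_zero_iff.2
              ((T'.le_opNorm x).trans (mul_le_mul_of_nonneg_left (hr x hx) (norm_nonneg _)))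
            rw [indicator_of_mem hx, indicator_of_mem this]
          · rw [indicator_of_notMem hx]
            exact zero_le
      _ = ∫⁻ y, B.indicator (fun y => g (y + z)) y ∂(Measure.map T volume) :=
          (lintegral_map ((hgm.comp (measurable_add_const z)).indicator
            Metric.isClosed_closedBall.measurableSet) hTm).symm
      _ = ENNReal.ofReal |(LinearMap.det T)⁻¹| * ∫⁻ y in B, g (y + z) := by
          rw [Measure.map_linearMap_addHaar_eq_smul_addHaar _ hT, lintegral_smul_measure,
            lintegral_indicator Metric.isClosed_closedBall.measurableSet, smul_eq_mul]
      _ ≤ ENNReal.ofReal |(LinearMap.det T)⁻¹| * (N * ∫⁻ x in unitCell M, g x) := by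
          gcongr
          exact hN g hgm (fun n y => congrArg (fun z => ‖z‖ₑ ^ (p : ℝ))
            (periodicFun_periodic hM v n y)) z
      _ = _ := by rw [hc, mul_assoc]
  rw [h1, eLpNorm_natCast_eq _ hp]
  push_cast
  rw [ENNReal.coe_toNNReal hcfin, mul_assoc]
  refine (ENNReal.rpow_le_rpow h2 (by positivity)).trans ?_
  rw [ENNReal.mul_rpow_of_nonneg _ _ (by positivity), ← eLpNorm_natCast_eq _ hp]
  gcongr
  exact hC v

end Translates

/-! ### Displacement stencils in a common form -/

section DifferenceStencils

variable {𝒜 : Fin 2 → Type*} {d : ℕ} {S : Bilayer 𝒜 d} {κ : ℝ}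

/-- The common form of the displacement part of the monolayer and interlayer stencils. -/
noncomputable def Bilayer.diffStencil (S : Bilayer 𝒜 d) (i j : Fin 2) (T : Plane →ₗ[ℝ] Plane)
    (z y : Plane) (U : ∀ j, Plane → 𝒜 j → Vec d) (x : Plane) (α : 𝒜 j) : Site 𝒜 i → Vec d :=
  fun ω => U i (T x + (S.R i ω.1 + z)) ω.2 - U j (x + y) α

theorem Bilayer.monoStencil_eq (j : Fin 2) (U : ∀ j, Plane → 𝒜 j → Vec d) (x : Plane) (α : 𝒜 j) :
    S.monoStencil j (U j) x α = S.diffStencil j j LinearMap.id 0 0 U x α := by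
  funext ω
  simp [Bilayer.monoStencil, Bilayer.diffStencil, add_comm]

/-- This separates the reference stencil, which is not bounded in `ω`, from the displacement part,
which is linear in `U` and for admissible fields bounded by `κ`. -/
theorem Bilayer.interStencil_eq (j : Fin 2) (U : ∀ j, Plane → 𝒜 j → Vec d) (x : Plane) (α : 𝒜 j) :
    S.interStencil j U x α = S.interStencil j 0 x α +
      S.diffStencil (1 - j) j (S.transfer j) (S.γ (1 - j)) (S.γ j) U x α := by
  funext ω
  have h : S.transfer j x + (S.R (1 - j) ω.1 + S.γ (1 - j)) =
      S.R (1 - j) ω.1 + S.transfer j x + S.γ (1 - j) := by abel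
  simp only [Bilayer.interStencil, Bilayer.diffStencil, Bilayer.position, Pi.add_apply,
    Pi.zero_apply, add_zero, h]
  abel

theorem Bilayer.continuous_interStencil_zero (j : Fin 2) (α : 𝒜 j) :
    Continuous fun x => S.interStencil j 0 x α := by
  refine continuous_pi fun ω => ?_
  have hT : Continuous (S.transfer j) := continuous_toEuclideanLin _
  have hP : Continuous S.plane := S.plane.continuous
  simp only [Bilayer.interStencil, Bilayer.position, Pi.zero_apply, add_zero]
  fun_prop

theorem Bilayer.det_transfer_ne_zero (j : Fin 2) : LinearMap.det (S.transfer j) ≠ 0 := by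
  have h : (S.transfer j).comp (S.A j * (S.A (1 - j))⁻¹).toEuclideanLin = LinearMap.id := by
    refine LinearMap.ext fun x => ?_
    rw [LinearMap.comp_apply, Bilayer.transfer, ← toEuclideanLin_mul_apply, Matrix.mul_assoc,
      ← Matrix.mul_assoc (S.A j)⁻¹, Matrix.nonsing_inv_mul _ (S.isUnit_det j), Matrix.one_mul,
      Matrix.mul_nonsing_inv _ (S.isUnit_det (1 - j)), toEuclideanLin_one_apply, LinearMap.id_apply]
  intro h0
  have h1 := congrArg LinearMap.det h
  rw [LinearMap.det_comp, h0, zero_mul, LinearMap.det_id] at h1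
  exact zero_ne_one h1

theorem Bilayer.mono_diffStencil_le (hκ : 0 ≤ κ) {u : S.Displacement} (hu : u ∈ S.admissible κ)
    (j : Fin 2) (x : Plane) (α : 𝒜 j) (ω : Site 𝒜 j) :
    ‖S.diffStencil j j LinearMap.id 0 0 (S.field u) x α ω‖ ≤ κ := by
  simp only [Bilayer.diffStencil, add_zero, LinearMap.id_apply]
  exact Bilayer.norm_field_sub_same_le hκ hu j ω.1 α ω.2 x

theorem Bilayer.inter_diffStencil_le (hκ : 0 ≤ κ) {u : S.Displacement} (hu : u ∈ S.admissible κ)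
    (j : Fin 2) (T : Plane →ₗ[ℝ] Plane) (z y : Plane) (x : Plane) (α : 𝒜 j)
    (ω : Site 𝒜 (1 - j)) : ‖S.diffStencil (1 - j) j T z y (S.field u) x α ω‖ ≤ κ :=
  Bilayer.norm_field_sub_opposite_le hκ hu j α ω.2 _ _

theorem Bilayer.mem_stencils_of_norm_le (hκ : 0 ≤ κ) {i : Fin 2} {a : Site 𝒜 i → Vec d}
    (ha : ∀ ω, ‖a ω‖ ≤ κ) : a ∈ S.stencils κ 0 i := fun ω => by
  rw [add_zero]
  exact (ha ω).trans (le_mul_of_one_le_right hκ (le_max_left _ _))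

theorem Bilayer.measurableSet_moireCell (S : Bilayer 𝒜 d) : MeasurableSet S.moireCell :=
  measurableSet_unitCell S.isUnit_det_moireMatrix

instance Bilayer.isFiniteMeasure_moireCell (S : Bilayer 𝒜 d) :
    IsFiniteMeasure (volume.restrict S.moireCell) :=
  isFiniteMeasure_unitCell S.moire

theorem mem_stencilBox_add_iff {i : Fin 2} {b a : Site 𝒜 i → Vec d} :
    b + a ∈ stencilBox b (fun ω => κ * max 1 ‖S.R i ω.1‖ + 0) ↔ a ∈ S.stencils κ 0 i := by
  simp only [stencilBox, Bilayer.stencils, mem_ofPred_eq, Pi.add_apply, add_sub_cancel_left]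

variable {i j : Fin 2} {T : Plane →ₗ[ℝ] Plane} {z y : Plane} {α : 𝒜 j}

theorem Bilayer.continuous_diffStencil (hκ : 0 ≤ κ) {u : S.Displacement}
    (hu : u ∈ S.admissible κ) :
    Continuous fun x => S.diffStencil i j T z y (S.field u) x α := by
  refine continuous_pi fun ω => ?_
  have hT : Continuous T := LinearMap.continuous_of_finiteDimensional _
  exact ((Bilayer.continuous_representative hκ hu i ω.2).comp (hT.add_const _)).sub
    ((Bilayer.continuous_representative hκ hu j α).comp (continuous_add_const _))

theorem Bilayer.diffStencil_add_smul_sub (hκ : 0 ≤ κ) {u v : S.Displacement}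
    (hu : u ∈ S.admissible κ) (hv : v ∈ S.admissible κ) (t : ℝ) (x : Plane) :
    S.diffStencil i j T z y (S.field (u + t • (v - u))) x α =
      S.diffStencil i j T z y (S.field u) x α +
        t • S.diffStencil i j T z y (S.field (v - u)) x α := by
  funext ω
  simp only [Bilayer.diffStencil, Pi.add_apply, Pi.smul_apply,
    Bilayer.field_add_smul_sub hκ hu hv]
  rw [smul_sub (M := ℝ) (A := Vec d)]
  abel

theorem Bilayer.diffStencil_sub (hκ : 0 ≤ κ) {u v : S.Displacement}
    (hu : u ∈ S.admissible κ) (hv : v ∈ S.admissible κ) (x : Plane) :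
    S.diffStencil i j T z y (S.field (v - u)) x α =
      S.diffStencil i j T z y (S.field v) x α - S.diffStencil i j T z y (S.field u) x α := by
  funext ω
  simp only [Bilayer.diffStencil, Pi.sub_apply, Bilayer.field_sub hκ hu hv]
  abel

theorem quasiMeasurePreserving_add (y : Plane) : Measure.QuasiMeasurePreserving (fun x => x + y)
    (volume : Measure Plane) (volume : Measure Plane) :=
  (measurePreserving_add_right (volume : Measure Plane) y).quasiMeasurePreserving

theorem Bilayer.aestronglyMeasurable_diffStencil (hT : LinearMap.det T ≠ 0) (v : S.Displacement)
    (ω : Site 𝒜 i) :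
    AEStronglyMeasurable (fun x => S.diffStencil i j T z y (S.field v) x α ω) volume :=
  ((aestronglyMeasurable_representative (v i ω.2)).comp_quasiMeasurePreserving
    (quasiMeasurePreserving_affine hT _)).sub
  ((aestronglyMeasurable_representative (v j α)).comp_quasiMeasurePreserving
    (quasiMeasurePreserving_add y))

variable [∀ j, Fintype (𝒜 j)]

/-- General displacements have no continuous representative, so additivity holds almost everywhere
only; one null set serves all sites because these are countable. -/
theorem Bilayer.diffStencil_add_ae (hT : LinearMap.det T ≠ 0) (v w : S.Displacement) :
    ∀ᵐ x : Plane, S.diffStencil i j T z y (S.field (v + w)) x α =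
      S.diffStencil i j T z y (S.field v) x α + S.diffStencil i j T z y (S.field w) x α := by
  have h1 : ∀ ω : Site 𝒜 i, ∀ᵐ x : Plane, representative ((v + w) i ω.2) (T x + (S.R i ω.1 + z)) =
      representative (v i ω.2) (T x + (S.R i ω.1 + z)) +
        representative (w i ω.2) (T x + (S.R i ω.1 + z)) := fun ω =>
    (quasiMeasurePreserving_affine hT _).ae
      (representative_add_ae S.isUnit_det_moireMatrix (v i ω.2) (w i ω.2))
  have h2 : ∀ᵐ x : Plane, representative ((v + w) j α) (x + y) =
      representative (v j α) (x + y) + representative (w j α) (x + y) :=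
    (quasiMeasurePreserving_add y).ae
      (representative_add_ae S.isUnit_det_moireMatrix (v j α) (w j α))
  filter_upwards [ae_all_iff.2 h1, h2] with x h1 h2
  funext ω
  refine (congrArg₂ (· - ·) (h1 ω) h2).trans ?_
  exact add_sub_add_comm _ _ _ _

theorem Bilayer.diffStencil_smul_ae (hT : LinearMap.det T ≠ 0) (c : ℝ) (v : S.Displacement) :
    ∀ᵐ x : Plane, S.diffStencil i j T z y (S.field (c • v)) x α =
      c • S.diffStencil i j T z y (S.field v) x α := by
  have h1 : ∀ ω : Site 𝒜 i, ∀ᵐ x : Plane, representative ((c • v) i ω.2) (T x + (S.R i ω.1 + z)) =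
      c • representative (v i ω.2) (T x + (S.R i ω.1 + z)) := fun ω =>
    (quasiMeasurePreserving_affine hT _).ae
      (representative_smul_ae S.isUnit_det_moireMatrix c (v i ω.2))
  have h2 : ∀ᵐ x : Plane, representative ((c • v) j α) (x + y) =
      c • representative (v j α) (x + y) :=
    (quasiMeasurePreserving_add y).ae
      (representative_smul_ae S.isUnit_det_moireMatrix c (v j α))
  filter_upwards [ae_all_iff.2 h1, h2] with x h1 h2
  funext ω
  refine (congrArg₂ (· - ·) (h1 ω) h2).trans ?_
  exact (smul_sub _ _ _).symm

theorem Bilayer.norm_apply_le (v : S.Displacement) (j : Fin 2) (α : 𝒜 j) : ‖v j α‖ ≤ ‖v‖ :=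
  (norm_le_pi_norm (v j) α).trans (norm_le_pi_norm v j)

theorem Bilayer.exists_eLpNorm_diffStencil_le (S : Bilayer 𝒜 d) (i j : Fin 2) {T : Plane →ₗ[ℝ] Plane}
    (hT : LinearMap.det T ≠ 0) (z y : Plane) (α : 𝒜 j) {p : ℕ} (hp : 1 ≤ p) :
    ∃ C : ℝ≥0, ∀ (v : S.Displacement) (ω : Site 𝒜 i),
      eLpNorm (fun x => S.diffStencil i j T z y (S.field v) x α ω) p
        (volume.restrict S.moireCell) ≤ C * ENNReal.ofReal ‖v‖ := by
  obtain ⟨C₁, hC₁⟩ := exists_eLpNorm_comp_affine_le S.isUnit_det_moireMatrix d hT hp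
  obtain ⟨C₂, hC₂⟩ := exists_eLpNorm_comp_affine_le S.isUnit_det_moireMatrix d
    (T := LinearMap.id) (by simp) hp
  refine ⟨C₁ + C₂, fun v ω => ?_⟩
  have h1 : AEStronglyMeasurable (fun x => representative (v i ω.2) (T x + (S.R i ω.1 + z)))
      (volume.restrict S.moireCell) :=
    ((aestronglyMeasurable_representative (v i ω.2)).comp_quasiMeasurePreserving
      (quasiMeasurePreserving_affine hT _)).restrict
  have h2 : AEStronglyMeasurable (fun x => representative (v j α) (x + y))
      (volume.restrict S.moireCell) :=
    ((aestronglyMeasurable_representative (v j α)).comp_quasiMeasurePreserving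
      (quasiMeasurePreserving_add y)).restrict
  refine (eLpNorm_sub_le h1 h2 (by exact_mod_cast hp)).trans ?_
  push_cast
  rw [add_mul]
  gcongr
  · refine (hC₁ _ _).trans ?_
    gcongr
    exact Bilayer.norm_apply_le v i ω.2
  · refine (hC₂ _ _).trans ?_
    gcongr
    exact Bilayer.norm_apply_le v j α

theorem Bilayer.tendsto_diffStencil (hκ : 0 ≤ κ) {u : S.Displacement} (hu : u ∈ S.admissible κ)
    (x : Plane) : Tendsto (fun u' => S.diffStencil i j T z y (S.field u') x α)
      (𝓝[S.admissible κ] u) (𝓝 (S.diffStencil i j T z y (S.field u) x α)) := by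
  have h : ∀ (j : Fin 2) (x : Plane) (α : 𝒜 j),
      Tendsto (fun u' => S.field u' j x α) (𝓝[S.admissible κ] u) (𝓝 (S.field u j x α)) := by
    intro j x α
    refine Metric.tendsto_nhds.2 fun η hη => ?_
    filter_upwards [Bilayer.eventually_norm_field_sub_le hκ hu (half_pos hη)] with u' h
    rw [dist_eq_norm]
    exact (h j x α).trans_lt (half_lt_self hη)
  exact tendsto_pi_nhds.2 fun ω => (h _ _ _).sub (h _ _ _)

end DifferenceStencils

/-! ### Regularity of integrals over the moiré cell -/

section EnergyDensity

variable {𝒜 : Fin 2 → Type*} {d : ℕ} {S : Bilayer 𝒜 d} {κ : ℝ} [∀ j, Fintype (𝒜 j)]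

theorem lintegral_enorm_mul_prod_le_of_le {X : Type*} [MeasurableSpace X] {μ : Measure X} {ℓ : ℕ}
    (hℓ : 1 ≤ ℓ) {g : X → ℝ} {f : Fin ℓ → X → ℝ} (hg : AEStronglyMeasurable g μ)
    (hf : ∀ n, AEStronglyMeasurable (f n) μ) {C : ℝ≥0} {N : Fin ℓ → ℝ≥0∞}
    (hb : ∀ n, eLpNorm (f n) (2 * ℓ : ℕ) μ ≤ C * N n) :
    ∫⁻ x, ‖g x * ∏ n, f n x‖ₑ ∂μ ≤ (C ^ ℓ : ℝ≥0) * eLpNorm g 2 μ * ∏ n, N n := by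
  refine (lintegral_enorm_mul_prod_le hℓ hg hf).trans ?_
  refine (mul_le_mul_right (Finset.prod_le_prod' fun n _ => hb n) _).trans_eq ?_
  rw [Finset.prod_mul_distrib, Finset.prod_const, Finset.card_univ, Fintype.card_fin,
    ENNReal.coe_pow, mul_left_comm, mul_assoc]

theorem abs_coord_le {d : ℕ} (v : Vec d) (i : Fin d) : |v i| ≤ ‖v‖ := by
  simpa using PiLp.norm_apply_le v i

variable {i j : Fin 2} {T : Plane →ₗ[ℝ] Plane} {z y : Plane} {α : 𝒜 j}

/-- Hölder's inequality combined with the Sobolev bound in `L^{2ℓ}`. Nonzero weights are at least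
`c`, so each division costs a factor `c⁻¹`; the result is uniform over the sites. -/
theorem Bilayer.exists_hoelder_diffStencil (S : Bilayer 𝒜 d) (i j : Fin 2) {T : Plane →ₗ[ℝ] Plane}
    (hT : LinearMap.det T ≠ 0) (z y : Plane) (α : 𝒜 j) {w : Site 𝒜 i → ℝ} {c : ℝ} (hc : 0 < c)
    (hwc : ∀ s, w s = 0 ∨ c ≤ w s) {ℓ : ℕ} (hℓ : 1 ≤ ℓ) :
    ∃ C : ℝ≥0, ∀ (ω : Fin ℓ → Site 𝒜 i × Fin d) (v : Fin ℓ → S.Displacement) (g : Plane → ℝ),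
      AEStronglyMeasurable g (volume.restrict S.moireCell) →
      ∫⁻ x in S.moireCell, ‖g x * ∏ n, (S.diffStencil i j T z y (S.field (v n)) x α
        (ω n).1 (ω n).2 / w (ω n).1)‖ₑ ≤
        C * eLpNorm g 2 (volume.restrict S.moireCell) * ∏ n, ‖v n‖ₑ := by
  obtain ⟨C, hC⟩ := S.exists_eLpNorm_diffStencil_le i j hT z y α (p := 2 * ℓ) (by omega)
  refine ⟨(c⁻¹.toNNReal * C) ^ ℓ, fun ω v g hg => ?_⟩
  have hm : ∀ n, AEStronglyMeasurable (fun x => S.diffStencil i j T z y (S.field (v n)) x α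
      (ω n).1 (ω n).2 / w (ω n).1) (volume.restrict S.moireCell) := by
    intro n
    have h1 := (Bilayer.aestronglyMeasurable_diffStencil hT (z := z) (y := y) (α := α) (v n)
      (ω n).1).restrict (s := S.moireCell)
    have h2 := (EuclideanSpace.proj (𝕜 := ℝ) (ω n).2 : Vec d →L[ℝ] ℝ).continuous
    simp only [div_eq_mul_inv]
    exact (h2.comp_aestronglyMeasurable h1).mul_const _
  have hb : ∀ n, eLpNorm (fun x => S.diffStencil i j T z y (S.field (v n)) x α
      (ω n).1 (ω n).2 / w (ω n).1) (2 * ℓ : ℕ) (volume.restrict S.moireCell) ≤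
      (c⁻¹.toNNReal * C : ℝ≥0) * ‖v n‖ₑ := by
    intro n
    have h1 : ∀ x, ‖S.diffStencil i j T z y (S.field (v n)) x α (ω n).1 (ω n).2 / w (ω n).1‖ ≤
        c⁻¹.toNNReal * ‖S.diffStencil i j T z y (S.field (v n)) x α (ω n).1‖ := by
      intro x
      rw [Real.coe_toNNReal _ (by positivity)]
      rcases hwc (ω n).1 with h0 | h0
      · rw [h0, div_zero, norm_zero]
        positivity
      · rw [norm_div, Real.norm_eq_abs, div_eq_inv_mul, Real.norm_eq_abs,
          abs_of_pos (hc.trans_le h0)]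
        gcongr
        exact abs_coord_le _ _
    refine (eLpNorm_le_nnreal_smul_eLpNorm_of_ae_le_mul (Eventually.of_forall h1) _).trans ?_
    rw [ENNReal.smul_def, smul_eq_mul, ENNReal.coe_mul, mul_assoc]
    refine mul_le_mul_right ((hC (v n) (ω n).1).trans_eq ?_) _
    exact congrArg _ (ofReal_norm (v n))
  exact lintegral_enorm_mul_prod_le_of_le hℓ hg hm hb

/-- Integrals over the moiré cell of a potential evaluated at the stencils of `u` are `C^k` on the
set of admissible displacements. -/
theorem Bilayer.contDiffOn_integral_diffStencil (hκ : 0 ≤ κ) {k : ℕ} (hk : 1 ≤ k)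
    (hT : LinearMap.det T ≠ 0) {w : Site 𝒜 i → ℝ} {c : ℝ} (hc : 0 < c)
    (hwc : ∀ s, w s = 0 ∨ c ≤ w s) {V : (Site 𝒜 i → Vec d) → ℝ}
    {base : Plane → Site 𝒜 i → Vec d} (hbase : Continuous base) {𝔖 : Set (Site 𝒜 i → Vec d)}
    (hV : StencilSmoothOn k V 𝔖)
    (h𝔖 : ∀ x ∈ S.moireCell, ∀ a ∈ S.stencils κ 0 i, base x + a ∈ 𝔖)
    {m : ∀ ℓ, (Fin ℓ → Site 𝒜 i) → ℝ≥0∞} (hm : ∀ ℓ, 1 ≤ ℓ → ℓ ≤ k → ∑' ω, m ℓ ω < ∞)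
    (hbound : ∀ ℓ, 1 ≤ ℓ → ℓ ≤ k → ∀ (ω : Fin ℓ → Site 𝒜 i × Fin d), ∀ y ∈ 𝔖,
      |coordPartial V w ω y| ≤ (m ℓ fun n => (ω n).1).toReal)
    {C₀ : ℝ} (hC₀ : ∀ x ∈ S.moireCell, ∀ a ∈ S.stencils κ 0 i, |V (base x + a)| ≤ C₀)
    (hle : ∀ u ∈ S.admissible κ, ∀ x ω, ‖S.diffStencil i j T z y (S.field u) x α ω‖ ≤ κ)
    (hw0 : ∀ s, w s = 0 → ∀ (v : S.Displacement) x,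
      S.diffStencil i j T z y (S.field v) x α s = 0) :
    (∀ u ∈ S.admissible κ, IntegrableOn
      (fun x => V (base x + S.diffStencil i j T z y (S.field u) x α)) S.moireCell) ∧
    ContDiffOn ℝ k (fun u : S.Displacement =>
      ∫ x in S.moireCell, V (base x + S.diffStencil i j T z y (S.field u) x α))
      (S.admissible κ) := by
  have hcell := S.measurableSet_moireCell
  have hmem := fun u (hu : u ∈ S.admissible κ) x =>
    Bilayer.mem_stencils_of_norm_le (S := S) hκ (hle u hu x)
  have hmaps : ∀ u ∈ S.admissible κ, MapsTo
      (fun x => base x + S.diffStencil i j T z y (S.field u) x α) S.moireCell 𝔖 :=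
    fun u hu x hx => h𝔖 x hx _ (hmem u hu x)
  have hcont : ∀ ℓ ≤ k, ∀ (ω : Fin ℓ → Site 𝒜 i × Fin d), ∀ u ∈ S.admissible κ, ContinuousOn
      (fun x => coordPartial V w ω (base x + S.diffStencil i j T z y (S.field u) x α))
      S.moireCell := fun ℓ hℓ ω u hu =>
    (continuousOn_coordPartial hV w hℓ ω).comp
      (hbase.add (Bilayer.continuous_diffStencil hκ hu)).continuousOn (hmaps u hu)
  have hint : ∀ u ∈ S.admissible κ, IntegrableOn
      (fun x => V (base x + S.diffStencil i j T z y (S.field u) x α)) S.moireCell := by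
    intro u hu
    have h1 := hcont 0 (Nat.zero_le k) Fin.elim0 u hu
    simp only [coordPartial_zero] at h1
    refine Integrable.of_bound (h1.aestronglyMeasurable hcell) C₀ ?_
    filter_upwards [ae_restrict_mem hcell] with x hx
    exact hC₀ x hx _ (hmem u hu x)
  refine ⟨hint, ?_⟩
  -- The abstract theorem asks for a base point in its domain.
  rcases (S.admissible κ).eq_empty_or_nonempty with h0 | ⟨u₀, hu₀⟩
  · rw [h0]
    exact contDiffOn_empty
  have H : SmoothIntegrand (volume.restrict S.moireCell) (S.admissible κ) k 2 _ _ _ :=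
    smoothIntegrand_of_stencils (V := V) (w := w)
      (st := fun u x => base x + S.diffStencil i j T z y (S.field u) x α)
      (lin := fun v x => S.diffStencil i j T z y (S.field v) x α) (r := fun _ => 0)
      (X₀ := S.moireCell) (ae_restrict_mem hcell) (z := base)
      (ρ := fun ω => κ * max 1 ‖S.R i ω.1‖ + 0) (𝔖 := 𝔖) (m := m)
      (Bilayer.convex_admissible hκ) ?_ hV ?_ ?_ ?_ ?_ ?_ hm hbound ?_ ?_ ?_ ?_ ?_ ?_ ?_ ?_
  · refine (H.contDiffOn_integral hk).congr fun u _ => ?_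
    simp only [coordPartial_zero, if_true, sub_zero]
  · exact (memLp_const (p := 2) (μ := volume.restrict S.moireCell) (1 : ℝ)).2.ne
  · intro x hx b hb
    have h1 := h𝔖 x hx (b - base x) ?_
    · rwa [add_sub_cancel] at h1
    · rw [← mem_stencilBox_add_iff (b := base x), add_sub_cancel]
      exact hb
  · exact fun u hu x _ => mem_stencilBox_add_iff.2 (hmem u hu x)
  · intro u hu v hv x _ t _
    rw [Bilayer.diffStencil_add_smul_sub hκ hu hv, add_assoc]
  · exact fun u _ v _ x _ s hs => hw0 s hs _ x
  · intro u hu v hv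
    -- A difference of two admissible stencils has entries at most `2κ`.
    refine ⟨(κ + κ) / c, fun x _ p => ?_⟩
    rcases hwc p.1 with h0 | h0
    · rw [h0, div_zero, abs_zero]
      positivity
    · rw [abs_div, abs_of_pos (hc.trans_le h0)]
      refine div_le_div₀ (by positivity) ((abs_coord_le _ _).trans ?_) hc h0
      rw [Bilayer.diffStencil_sub hκ hu hv]
      exact (norm_sub_le _ _).trans (add_le_add (hle v hv x p.1) (hle u hu x p.1))
  · exact fun ℓ hℓ ω u hu => (hcont ℓ hℓ ω u hu).aestronglyMeasurable hcell
  · exact aestronglyMeasurable_const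
  · intro p v
    have h1 := (Bilayer.aestronglyMeasurable_diffStencil hT (z := z) (y := y) (α := α) v
      p.1).restrict (s := S.moireCell)
    have h2 := (EuclideanSpace.proj (𝕜 := ℝ) p.2 : Vec d →L[ℝ] ℝ).continuous
    simp only [div_eq_mul_inv]
    exact (h2.comp_aestronglyMeasurable h1).mul_const _
  · exact fun u v => ae_restrict_of_ae (Bilayer.diffStencil_add_ae hT u v)
  · exact fun c v => ae_restrict_of_ae (Bilayer.diffStencil_smul_ae hT c v)
  · exact fun ℓ h1 _ => S.exists_hoelder_diffStencil i j hT z y α hc hwc h1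
  · exact ⟨u₀, hu₀, by simpa [IntegrableOn] using hint u₀ hu₀⟩
  · intro ℓ h1 h2 ω u hu
    refine tendsto_eLpNorm_two_of_bounded (C := (m ℓ fun n => (ω n).1).toReal +
      (m ℓ fun n => (ω n).1).toReal) ?_ ?_ ?_
    · filter_upwards [self_mem_nhdsWithin] with u' hu'
      exact ((hcont ℓ h2 ω u' hu').aestronglyMeasurable hcell).sub
        ((hcont ℓ h2 ω u hu).aestronglyMeasurable hcell)
    · filter_upwards [self_mem_nhdsWithin] with u' hu'
      filter_upwards [ae_restrict_mem hcell] with x hx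
      exact (abs_sub _ _).trans (add_le_add (hbound ℓ h1 h2 ω _ (hmaps u' hu' hx))
        (hbound ℓ h1 h2 ω _ (hmaps u hu hx)))
    · filter_upwards [ae_restrict_mem hcell] with x hx
      -- Sobolev convergence gives uniform, hence coordinatewise, convergence of the stencils, for
      -- which the partial derivatives are continuous.
      have h3 : Tendsto (fun u' => base x + S.diffStencil i j T z y (S.field u') x α)
          (𝓝[S.admissible κ] u) (𝓝[𝔖] (base x + S.diffStencil i j T z y (S.field u) x α)) := by
        refine tendsto_nhdsWithin_iff.2 ⟨(Bilayer.tendsto_diffStencil hκ hu x).const_add _, ?_⟩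
        filter_upwards [self_mem_nhdsWithin] with u' hu'
        exact hmaps u' hu' hx
      have h4 := (continuousOn_coordPartial hV w h2 ω _ (hmaps u hu hx)).tendsto.comp h3
      have h5 := h4.sub_const (coordPartial V w ω
        (base x + S.diffStencil i j T z y (S.field u) x α))
      rw [sub_self] at h5
      exact h5

end EnergyDensity

/-! ### Regularity of the energy density -/

section EnergyRegularity

variable {𝒜 : Fin 2 → Type*} {d : ℕ}

theorem one_le_norm_of_ne_zero {n : Fin 2 → ℤ} (hn : n ≠ 0) : ∃ i, (1 : ℝ) ≤ |(n i : ℝ)| := by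
  obtain ⟨i, hi⟩ := Function.ne_iff.1 hn
  exact ⟨i, by exact_mod_cast Int.one_le_abs hi⟩

theorem Bilayer.R_zero (S : Bilayer 𝒜 d) (j : Fin 2) : S.R j 0 = 0 := latticePoint_zero _

/-- Nonzero lattice vectors are bounded away from zero, so a weight can be small only by vanishing,
at the atom itself. -/
theorem Bilayer.exists_weight_ge (S : Bilayer 𝒜 d) (j : Fin 2) : ∃ c : ℝ, 0 < c ∧
    ∀ (α : 𝒜 j) (s : Site 𝒜 j), s = (0, α) ∨ c ≤ S.weight j α s := by
  obtain ⟨c, hc, h⟩ := exists_norm_latticePoint_ge (S.isUnit_det j)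
  refine ⟨min 1 c, by positivity, fun α s => ?_⟩
  unfold Bilayer.weight
  split_ifs with h1 h2
  · exact Or.inl (Prod.ext h1 h2)
  · exact Or.inr (min_le_left _ _)
  · obtain ⟨i, hi⟩ := one_le_norm_of_ne_zero h1
    exact Or.inr ((min_le_right _ _).trans ((le_mul_of_one_le_right hc.le hi).trans (h s.1 i)))

theorem Bilayer.weight_self (S : Bilayer 𝒜 d) (j : Fin 2) (α : 𝒜 j) : S.weight j α (0, α) = 0 := by
  simp [Bilayer.weight]

theorem isCompact_stencilBox {σ : Type*} (z : σ → Vec d) (ρ : σ → ℝ) :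
    IsCompact (stencilBox z ρ) := by
  have : stencilBox z ρ = univ.pi fun s => Metric.closedBall (z s) (ρ s) := by
    ext a
    simp [stencilBox, dist_eq_norm]
  rw [this]
  exact isCompact_univ_pi fun s => isCompact_closedBall _ _

theorem Bilayer.stencils_eq_stencilBox (S : Bilayer 𝒜 d) (κ r : ℝ) (j : Fin 2) :
    S.stencils κ r j = stencilBox 0 fun ω => κ * max 1 ‖S.R j ω.1‖ + r := by
  simp [Bilayer.stencils, stencilBox]

theorem Bilayer.isCompact_stencils (S : Bilayer 𝒜 d) (κ r : ℝ) (j : Fin 2) :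
    IsCompact (S.stencils κ r j) := by
  rw [S.stencils_eq_stencilBox]
  exact isCompact_stencilBox _ _

theorem StencilSmoothOn.continuousOn {σ : Type*} {k : ℕ} {V : (σ → Vec d) → ℝ}
    {𝔖 : Set (σ → Vec d)} (hV : StencilSmoothOn k V 𝔖) : ContinuousOn V 𝔖 := by
  have h := continuousOn_coordPartial hV (fun _ => 1) (Nat.zero_le k) Fin.elim0
  exact h.congr fun a _ => (coordPartial_zero V (fun _ => 1) Fin.elim0 a).symm

variable [∀ j, Fintype (𝒜 j)] {S : Bilayer 𝒜 d} {V : SitePotentials 𝒜 d} {κ : ℝ} {k : ℕ}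

/-- The potential is bounded on the monolayer stencils automatically: the stencil set is compact for
coordinatewise convergence, by Tychonoff's theorem, and the potential is continuous on it. -/
theorem Bilayer.Decay.contDiffOn_integral_mono (hD : S.Decay V κ 0 k) (hκ : 0 ≤ κ) (hk : 1 ≤ k)
    (j : Fin 2) (α : 𝒜 j) :
    (∀ u ∈ S.admissible κ, IntegrableOn
      (fun x => V.mono j α (S.monoStencil j (S.field u j) x α)) S.moireCell) ∧
    ContDiffOn ℝ k (fun u : S.Displacement =>
      ∫ x in S.moireCell, V.mono j α (S.monoStencil j (S.field u j) x α)) (S.admissible κ) := by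
  obtain ⟨c, hc, hw⟩ := S.exists_weight_ge j
  obtain ⟨C, hC⟩ := (S.isCompact_stencils κ 0 j).exists_bound_of_continuousOn
    (hD.mono_smooth j α).continuousOn
  have h := Bilayer.contDiffOn_integral_diffStencil (S := S) (T := LinearMap.id) (z := 0) (y := 0)
    (α := α) hκ hk (by simp) (w := S.weight j α) hc
    (fun s => (hw α s).imp_left fun h => by rw [h, S.weight_self]) (V := V.mono j α)
    (base := fun _ => 0) continuous_const (𝔖 := S.stencils κ 0 j) (hD.mono_smooth j α)
    (fun x _ a ha => by rwa [zero_add]) (m := fun ℓ ω => S.monoNorm V κ 0 j ω)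
    (hD.mono_summable j) (fun ℓ h1 h2 ω y hy => hD.mono_bound j α h1 h2 ω hy) (C₀ := C)
    (fun x _ a ha => by rw [zero_add]; exact hC a ha)
    (fun u hu x ω => Bilayer.mono_diffStencil_le hκ hu j x α ω)
    (fun s hs v x => by
      rcases hw α s with rfl | h
      · simp [Bilayer.diffStencil, S.R_zero]
      · exact absurd hs (hc.trans_le h).ne')
  simpa only [zero_add, ← Bilayer.monoStencil_eq] using h

/-- The base stencil moves with `x` over the half-open moiré cell, so boundedness is taken from the
decay conditions. All weights are `1`, as no entry vanishes identically. -/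
theorem Bilayer.Decay.contDiffOn_integral_inter (hD : S.Decay V κ 0 k) (hκ : 0 ≤ κ) (hk : 1 ≤ k)
    (j : Fin 2) (α : 𝒜 j) :
    (∀ u ∈ S.admissible κ, IntegrableOn
      (fun x => V.inter j α (S.interStencil j (S.field u) x α)) S.moireCell) ∧
    ContDiffOn ℝ k (fun u : S.Displacement =>
      ∫ x in S.moireCell, V.inter j α (S.interStencil j (S.field u) x α)) (S.admissible κ) := by
  obtain ⟨C, hC⟩ := hD.inter_bounded j α
  have h := Bilayer.contDiffOn_integral_diffStencil (S := S) (T := S.transfer j)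
    (z := S.γ (1 - j)) (y := S.γ j) (α := α) hκ hk (Bilayer.det_transfer_ne_zero j)
    (w := fun _ => 1) one_pos (fun s => Or.inr le_rfl) (V := V.inter j α)
    (base := fun x => S.interStencil j 0 x α) (Bilayer.continuous_interStencil_zero j α)
    (𝔖 := S.interStencils κ 0 j α) (hD.inter_smooth j α)
    (fun x hx a ha => ⟨x, hx, a, ha, rfl⟩) (m := fun ℓ ω => S.interNorm V κ 0 j ω)
    (hD.inter_summable j) (fun ℓ h1 h2 ω y hy => hD.inter_bound j α h1 h2 ω hy) (C₀ := C)
    (fun x hx a ha => hC _ ⟨x, hx, a, ha, rfl⟩)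
    (fun u hu x ω => Bilayer.inter_diffStencil_le hκ hu j _ _ _ x α ω)
    (fun s hs v x => absurd hs one_ne_zero)
  simpa only [← Bilayer.interStencil_eq] using h

theorem Bilayer.Decay.integrableOn_monoDensity (hD : S.Decay V κ 0 k) (hκ : 0 ≤ κ) (hk : 1 ≤ k)
    {u : S.Displacement} (hu : u ∈ S.admissible κ) (j : Fin 2) :
    IntegrableOn (S.monoDensity V u j) S.moireCell :=
  (integrable_finsetSum _ fun α _ => (hD.contDiffOn_integral_mono hκ hk j α).1 u hu).const_mul _

theorem Bilayer.Decay.integrableOn_interDensity (hD : S.Decay V κ 0 k) (hκ : 0 ≤ κ) (hk : 1 ≤ k)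
    {u : S.Displacement} (hu : u ∈ S.admissible κ) (j : Fin 2) :
    IntegrableOn (S.interDensity V u j) S.moireCell :=
  (integrable_finsetSum _ fun α _ => (hD.contDiffOn_integral_inter hκ hk j α).1 u hu).const_mul _

theorem Bilayer.Decay.contDiffOn_energyDensity (hD : S.Decay V κ 0 k) (hκ : 0 ≤ κ) (hk : 1 ≤ k) :
    ContDiffOn ℝ k (S.energyDensity V) (S.admissible κ) := by
  have h1 : ContDiffOn ℝ k (fun u : S.Displacement => ∑ j : Fin 2,
      ((volume.real S.moireCell)⁻¹ * ((volume.real (unitCell (S.A j)))⁻¹ *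
        ∑ α : 𝒜 j, ∫ x in S.moireCell, V.mono j α (S.monoStencil j (S.field u j) x α)) +
      (volume.real S.moireCell)⁻¹ * ((volume.real (unitCell (S.A j)))⁻¹ *
        ∑ α : 𝒜 j, ∫ x in S.moireCell, V.inter j α (S.interStencil j (S.field u) x α))))
      (S.admissible κ) := by
    refine ContDiffOn.sum fun j _ => ContDiffOn.add ?_ ?_
    · exact contDiffOn_const.mul (contDiffOn_const.mul
        (ContDiffOn.sum fun α _ => (hD.contDiffOn_integral_mono hκ hk j α).2))
    · exact contDiffOn_const.mul (contDiffOn_const.mul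
        (ContDiffOn.sum fun α _ => (hD.contDiffOn_integral_inter hκ hk j α).2))
  refine h1.congr fun u hu => ?_
  refine Finset.sum_congr rfl fun j _ => ?_
  rw [setAverage_eq, setAverage_eq, smul_eq_mul, smul_eq_mul]
  simp only [Bilayer.monoDensity, Bilayer.interDensity, integral_const_mul]
  rw [integral_finsetSum _ fun α _ => (hD.contDiffOn_integral_mono hκ hk j α).1 u hu,
    integral_finsetSum _ fun α _ => (hD.contDiffOn_integral_inter hκ hk j α).1 u hu]

end EnergyRegularity

/-! ### Sums along finite-to-one maps -/

section Fibers

/-- The preimages of points under `φ` are contained in translates of the finite set `P`. -/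
theorem tsum_comp_le_card_mul {G β : Type*} [AddGroup G] {ψ : G → β} (P : Finset G)
    (hP : ∀ n n', ψ n = ψ n' → n - n' ∈ P) (f : β → ℝ≥0∞) :
    ∑' n, f (ψ n) ≤ P.card * ∑' y, f y := by
  classical
  have h1 : ∀ n, f (ψ n) = ∑' y, if ψ n = y then f y else 0 := fun n => by
    rw [tsum_eq_single (ψ n) fun y hy => if_neg (Ne.symm hy), if_pos rfl]
  simp only [h1]
  rw [ENNReal.tsum_comm, ← ENNReal.tsum_mul_left]
  refine ENNReal.tsum_le_tsum fun y => ?_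
  by_cases hy : ∃ n₀, ψ n₀ = y
  · obtain ⟨n₀, rfl⟩ := hy
    calc ∑' n, (if ψ n = ψ n₀ then f (ψ n₀) else 0) ≤
          ∑' n, (if n - n₀ ∈ P then f (ψ n₀) else 0) := by
          refine ENNReal.tsum_le_tsum fun n => ?_
          split_ifs with h1 h2 h2
          · exact le_rfl
          · exact absurd (hP _ _ h1) h2
          · exact zero_le
          · exact le_rfl
      _ = ∑' n, (if n ∈ P then f (ψ n₀) else 0) :=
          (Equiv.subRight n₀).tsum_eq fun n => if n ∈ P then f (ψ n₀) else 0
      _ = P.card * f (ψ n₀) := by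
          rw [tsum_eq_sum (s := P) fun n hn => if_neg hn, Finset.sum_congr rfl fun n hn => if_pos hn,
            Finset.sum_const, nsmul_eq_mul]
  · push Not at hy
    simp [hy]

variable {𝒜 : Fin 2 → Type*} {d : ℕ}

theorem tsum_enorm_site_le {i : Fin 2} {φ : (Fin 2 → ℤ) → Fin 2 → ℤ} (P : Finset (Fin 2 → ℤ))
    (hP : ∀ n n', φ n = φ n' → n - n' ∈ P) (δ : AllSites 𝒜 → Vec d) (ω : Site 𝒜 i) :
    ∑' n, ‖δ ⟨i, (ω.1 + φ n, ω.2)⟩‖ₑ ≤ P.card * ∑' x, ‖δ x‖ₑ :=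
  tsum_comp_le_card_mul (ψ := fun n => (⟨i, (ω.1 + φ n, ω.2)⟩ : AllSites 𝒜)) P
    (fun n n' h => hP n n' (by simpa using h)) fun x => ‖δ x‖ₑ

/-- The common form of the offsets of the monolayer and interlayer stencils. -/
def siteOffset (i j : Fin 2) (φ : (Fin 2 → ℤ) → Fin 2 → ℤ) (α : 𝒜 j) (δ : AllSites 𝒜 → Vec d)
    (n : Fin 2 → ℤ) : Site 𝒜 i → Vec d :=
  fun ω => δ ⟨i, (ω.1 + φ n, ω.2)⟩ - δ ⟨j, (n, α)⟩

theorem monoOffset_eq (δ : AllSites 𝒜 → Vec d) (j : Fin 2) (n : Fin 2 → ℤ) (α : 𝒜 j) :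
    monoOffset δ j n α = siteOffset j j id α δ n := rfl

end Fibers

/-! ### Moiré translations and the reduction to the moiré cell -/

section MoireShift

variable {𝒜 : Fin 2 → Type*} {d : ℕ} (S : Bilayer 𝒜 d)

/-- The sign with which the shifts of layer `j` by moiré lattice vectors act on the other layer. -/
def layerSign (j : Fin 2) : ℤ := if j = 0 then 1 else -1

/-- From the definition of `A_ℳ`, `A_{3-j} A_j⁻¹ = 1 ± A_{3-j} A_ℳ⁻¹`; on `A_ℳ m` the second term is
a lattice vector of the opposite layer. -/
theorem Bilayer.transfer_moire (j : Fin 2) (m : Fin 2 → ℤ) :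
    S.transfer j (latticePoint S.moire m) =
      latticePoint S.moire m + S.R (1 - j) (layerSign j • m) := by
  have key : ∀ i l : Fin 2, ∀ B : Matrix (Fin 2) (Fin 2) ℝ, (S.A i)⁻¹ = B + (S.A l)⁻¹ →
      S.A l * (S.A i)⁻¹ = S.A l * B + 1 := by
    intro i l B h
    rw [h, mul_add, Matrix.mul_nonsing_inv _ (S.isUnit_det l)]
  have hm : S.moire⁻¹.toEuclideanLin (latticePoint S.moire m) =
      WithLp.toLp 2 fun i => (m i : ℝ) :=
    inv_toEuclideanLin_apply S.isUnit_det_moireMatrix _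
  fin_cases j
  · have h1 := key 0 1 S.moire⁻¹ (by rw [S.moire_inv, sub_add_cancel])
    change (S.A 1 * (S.A 0)⁻¹).toEuclideanLin _ = _ + latticePoint (S.A 1) ((1 : ℤ) • m)
    rw [h1, map_add, LinearMap.add_apply, toEuclideanLin_mul_apply, hm, toEuclideanLin_one_apply,
      one_smul, add_comm]
    rfl
  · have h1 := key 1 0 (-S.moire⁻¹) (by rw [S.moire_inv]; abel)
    change (S.A 0 * (S.A 1)⁻¹).toEuclideanLin _ = _ + latticePoint (S.A 0) ((-1 : ℤ) • m)
    rw [h1, map_add, LinearMap.add_apply, toEuclideanLin_mul_apply, map_neg, LinearMap.neg_apply, hm,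
      toEuclideanLin_one_apply, neg_smul, one_smul, add_comm, latticePoint_neg, map_neg]
    rfl

/-- Periodicity moves both atoms rigidly by the same moiré vector, which cancels in the difference.
What is left is a relabelling of the opposite layer, to which the interlayer potential is
insensitive. -/
theorem Bilayer.interStencil_add_moire {j : Fin 2} {U : ∀ j, Plane → 𝒜 j → Vec d}
    (hU : ∀ i (β : 𝒜 i), IsLatticePeriodic S.moire fun x => U i x β) (x : Plane) (m : Fin 2 → ℤ)
    (α : 𝒜 j) (ω : Site 𝒜 (1 - j)) :
    S.interStencil j U (x + latticePoint S.moire m) α ω =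
      S.interStencil j U x α (ω.1 + layerSign j • m, ω.2) := by
  have hpos : ∀ i x (β : 𝒜 i), S.position U i (x + latticePoint S.moire m) β =
      S.position U i x β + S.plane (latticePoint S.moire m) := by
    intro i x β
    have h1 : U i (x + latticePoint S.moire m) β = U i x β := hU i β m x
    simp only [Bilayer.position, h1, map_add]
    abel
  have h1 : S.R (1 - j) ω.1 + S.transfer j (x + latticePoint S.moire m) + S.γ (1 - j) =
      S.R (1 - j) (ω.1 + layerSign j • m) + S.transfer j x + S.γ (1 - j) +
        latticePoint S.moire m := by
    rw [map_add, S.transfer_moire, Bilayer.R, Bilayer.R, Bilayer.R, latticePoint_add]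
    abel
  have h2 : x + latticePoint S.moire m + S.γ j = x + S.γ j + latticePoint S.moire m := by abel
  simp only [Bilayer.interStencil, h1, h2, hpos]
  abel

/-- The lattice vector of the opposite layer next to which the atom `R_j n` lies, up to a bounded
error. -/
noncomputable def Bilayer.moireIndex (j : Fin 2) (n : Fin 2 → ℤ) : Fin 2 → ℤ :=
  n - layerSign j • cellFloor S.moire (S.R j n)

theorem Bilayer.transfer_R (j : Fin 2) (n : Fin 2 → ℤ) :
    S.transfer j (S.R j n) = S.R (1 - j) n := by
  rw [Bilayer.transfer, toEuclideanLin_mul_apply, Bilayer.R, Bilayer.R, latticePoint,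
    inv_toEuclideanLin_apply (S.isUnit_det j)]
  rfl

theorem Bilayer.R_moireIndex (j : Fin 2) (n : Fin 2 → ℤ) : S.R (1 - j) (S.moireIndex j n) =
    S.R j n + (S.transfer j (cellFract S.moire (S.R j n)) - cellFract S.moire (S.R j n)) := by
  have h1 := cellFract_eq_sub S.isUnit_det_moireMatrix (S.R j n)
  have h2 := S.transfer_moire j (cellFloor S.moire (S.R j n))
  rw [Bilayer.moireIndex, Bilayer.R, latticePoint_sub, h1, map_sub, S.transfer_R, h2, Bilayer.R,
    Bilayer.R]
  abel

/-- The lattice vector indexed by `S.moireIndex j n` stays within a fixed distance of `S.R j n`. Two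
values of `n` with the same index have close lattice vectors, hence differ by an element of a fixed
finite set. -/
theorem Bilayer.exists_finset_moireIndex (j : Fin 2) : ∃ P : Finset (Fin 2 → ℤ),
    ∀ n n', S.moireIndex j n = S.moireIndex j n' → n - n' ∈ P := by
  let T : Plane →L[ℝ] Plane := LinearMap.toContinuousLinearMap (S.transfer j)
  obtain ⟨r, hr⟩ := (isBounded_unitCell S.moire).exists_norm_le
  set D := ‖T‖ * r + r with hD
  have hb : ∀ n, ‖S.transfer j (cellFract S.moire (S.R j n)) -
      cellFract S.moire (S.R j n)‖ ≤ D := by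
    intro n
    have h1 := hr _ (cellFract_mem S.moire (S.R j n))
    exact (norm_sub_le _ _).trans (add_le_add ((T.le_opNorm _).trans
      (mul_le_mul_of_nonneg_left h1 (norm_nonneg _))) h1)
  refine ⟨(finite_latticePoint_norm_le (S.isUnit_det j) (D + D)).toFinset, fun n n' h => ?_⟩
  rw [Finite.mem_toFinset, mem_ofPred_eq, latticePoint_sub]
  have h1 := S.R_moireIndex j n
  have h2 := S.R_moireIndex j n'
  rw [h, h2] at h1
  have h3 : latticePoint (S.A j) n - latticePoint (S.A j) n' =
      (S.transfer j (cellFract S.moire (S.R j n')) - cellFract S.moire (S.R j n')) -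
      (S.transfer j (cellFract S.moire (S.R j n)) - cellFract S.moire (S.R j n)) := by
    rw [sub_eq_sub_iff_add_eq_add, ← Bilayer.R, ← Bilayer.R, ← h1]
    exact add_comm _ _
  rw [h3]
  exact (norm_sub_le _ _).trans (add_le_add (hb n') (hb n))

/-- By translation invariance, the interlayer site energies at lattice points are those of stencils
centred in the moiré cell. -/
theorem Bilayer.inter_offset_eq (V : SitePotentials 𝒜 d) {j : Fin 2}
    {U : ∀ j, Plane → 𝒜 j → Vec d} (hU : ∀ i (β : 𝒜 i), IsLatticePeriodic S.moire fun x => U i x β)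
    (δ : AllSites 𝒜 → Vec d) (n : Fin 2 → ℤ) (α : 𝒜 j) :
    V.inter j α (S.interStencil j U (S.R j n) α + interOffset δ j n α) =
      V.inter j α (S.interStencil j U (cellFract S.moire (S.R j n)) α +
        siteOffset (1 - j) j (S.moireIndex j) α δ n) := by
  refine Eq.trans ?_ (V.inter_translation j α _ (layerSign j • cellFloor S.moire (S.R j n)))
  congr 1
  funext ω
  rw [Pi.add_apply, Pi.add_apply, ← S.interStencil_add_moire hU,
    cellFract_add_floor S.isUnit_det_moireMatrix]
  congr 1
  simp only [interOffset, siteOffset, Bilayer.moireIndex]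
  rw [show ω.1 + layerSign j • cellFloor S.moire (S.R j n) +
    (n - layerSign j • cellFloor S.moire (S.R j n)) = ω.1 + n by abel]

theorem siteOffset_zero (i j : Fin 2) (φ : (Fin 2 → ℤ) → Fin 2 → ℤ) (α : 𝒜 j) (n : Fin 2 → ℤ) :
    siteOffset i j φ α (0 : AllSites 𝒜 → Vec d) n = 0 := by
  funext ω
  simp [siteOffset]

theorem Bilayer.inter_eq (V : SitePotentials 𝒜 d) {j : Fin 2}
    {U : ∀ j, Plane → 𝒜 j → Vec d} (hU : ∀ i (β : 𝒜 i), IsLatticePeriodic S.moire fun x => U i x β)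
    (n : Fin 2 → ℤ) (α : 𝒜 j) : V.inter j α (S.interStencil j U (S.R j n) α) =
      V.inter j α (S.interStencil j U (cellFract S.moire (S.R j n)) α) := by
  have h := S.inter_offset_eq V hU 0 n α
  have h0 : interOffset (0 : AllSites 𝒜 → Vec d) j n α = 0 := by
    funext ω
    simp [interOffset]
  rwa [siteOffset_zero, h0, add_zero, add_zero] at h

end MoireShift

/-! ### Summability for finitely supported perturbations -/

section FinitelySupportedPerturbations

variable {𝒜 : Fin 2 → Type*} {d : ℕ} {i j : Fin 2} {φ : (Fin 2 → ℤ) → Fin 2 → ℤ} {α : 𝒜 j}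

theorem abs_coord_div_le {v : Vec d} {l : Fin d} {w c : ℝ} (hc : 0 < c) (hw : w = 0 ∨ c ≤ w) :
    |v l / w| ≤ c⁻¹ * ‖v‖ := by
  rcases hw with rfl | h
  · rw [div_zero, abs_zero]
    positivity
  · rw [abs_div, abs_of_pos (hc.trans_le h), div_eq_inv_mul]
    gcongr
    exact abs_coord_le v l

/-- The sum over all sites of the changes of a site potential, caused by a perturbation, in terms
of a bound of its first derivatives. -/
theorem tsum_tsum_enorm_mul_lt_top {P : Finset (Fin 2 → ℤ)}
    (hP : ∀ n n', φ n = φ n' → n - n' ∈ P) {B : Site 𝒜 i × Fin d → ℝ≥0∞}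
    (hB : ∑' p, B p ≠ ∞) {δ : AllSites 𝒜 → Vec d} (hδ : ∑' x, ‖δ x‖ₑ ≠ ∞) :
    ∑' n, ∑' p : Site 𝒜 i × Fin d, ‖δ ⟨i, (p.1.1 + φ n, p.1.2)⟩‖ₑ * B p ≠ ∞ := by
  rw [ENNReal.tsum_comm]
  refine ne_top_of_le_ne_top (b := ∑' p, (P.card * ∑' x, ‖δ x‖ₑ) * B p) ?_
    (ENNReal.tsum_le_tsum fun p => ?_)
  · rw [ENNReal.tsum_mul_left]
    exact ENNReal.mul_ne_top (ENNReal.mul_ne_top (ENNReal.natCast_ne_top _) hδ) hB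
  · rw [ENNReal.tsum_mul_right]
    gcongr
    exact tsum_enorm_site_le P hP δ p.1

variable [∀ j, Fintype (𝒜 j)] {S : Bilayer 𝒜 d} {κ : ℝ}

/-- For a finitely supported perturbation, the changes of the site potentials are summable. -/
theorem Bilayer.summable_abs_sub_siteOffset (hκ : 0 < κ) {k : ℕ} (hk : 1 ≤ k)
    {P : Finset (Fin 2 → ℤ)} (hP : ∀ n n', φ n = φ n' → n - n' ∈ P) {w : Site 𝒜 i → ℝ} {c : ℝ}
    (hc : 0 < c) (hwc : ∀ s, w s = 0 ∨ c ≤ w s) {V : (Site 𝒜 i → Vec d) → ℝ}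
    {𝔖 : Set (Site 𝒜 i → Vec d)} (hV : StencilSmoothOn k V 𝔖)
    {b a : (Fin 2 → ℤ) → Site 𝒜 i → Vec d} (h𝔖 : ∀ n, ∀ y ∈ S.stencils κ 0 i, b n + y ∈ 𝔖)
    {m : (Fin 1 → Site 𝒜 i) → ℝ≥0∞} (hm : ∑' ω, m ω < ∞)
    (hbound : ∀ (ω : Fin 1 → Site 𝒜 i × Fin d), ∀ y ∈ 𝔖,
      |coordPartial V w ω y| ≤ (m fun n => (ω n).1).toReal)
    (ha : ∀ n ω, ‖a n ω‖ ≤ κ) {δ : AllSites 𝒜 → Vec d}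
    (hw0 : ∀ s, w s = 0 → ∀ n, siteOffset i j φ α δ n s = 0)
    (hδ : (Function.support δ).Finite) :
    Summable fun n => |V (b n + a n + siteOffset i j φ α δ n) - V (b n + a n)| := by
  classical
  set M : (Fin 1 → Site 𝒜 i × Fin d) → ℝ := fun ω => (m fun n => (ω n).1).toReal with hM
  have hM0 : ∀ ω, 0 ≤ M ω := fun ω => ENNReal.toReal_nonneg
  have hMs : Summable fun p : Site 𝒜 i × Fin d => c⁻¹ * M fun _ => p :=
    ((summable_comp_fst hm).comp_injective (i := fun (p : Site 𝒜 i × Fin d) (_ : Fin 1) => p)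
      (fun p q h => congrFun h 0)).mul_left _
  have hB : ∑' p : Site 𝒜 i × Fin d, ENNReal.ofReal (c⁻¹ * M fun _ => p) ≠ ∞ :=
    hMs.tsum_ofReal_ne_top
  have hδ1 : ∑' x, ‖δ x‖ₑ ≠ ∞ := by
    rw [tsum_eq_sum (s := hδ.toFinset) fun x hx => by simpa using hx]
    exact ENNReal.sum_ne_top.2 fun x _ => enorm_ne_top
  have hE := tsum_tsum_enorm_mul_lt_top (φ := φ) hP hB hδ1
  set E : (Fin 2 → ℤ) → ℝ≥0∞ := fun n => ∑' p : Site 𝒜 i × Fin d,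
    ‖δ ⟨i, (p.1.1 + φ n, p.1.2)⟩‖ₑ * ENNReal.ofReal (c⁻¹ * M fun _ => p)
  set b₀ : ℝ := ∑ x ∈ hδ.toFinset, ‖δ x‖ with hb₀
  have hb₀le : ∀ x, ‖δ x‖ ≤ b₀ := by
    intro x
    by_cases hx : δ x = 0
    · rw [hx, norm_zero]
      positivity
    · exact Finset.single_le_sum (f := fun x => ‖δ x‖) (fun _ _ => norm_nonneg _) (by simpa using hx)
  -- At distance beyond `r` the bound `κ ‖R‖` exceeds `κ + b₀`, the largest possible size of a
  -- perturbed entry.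
  set r : ℝ := (κ + b₀) / κ with hr
  have hfin : {n | ‖latticePoint (S.A i) n‖ ≤ r}.Finite := finite_latticePoint_norm_le (S.isUnit_det i) r
  have hφfin : ∀ l, (φ ⁻¹' {l}).Finite := by
    intro l
    rcases (φ ⁻¹' {l}).eq_empty_or_nonempty with h | ⟨n₀, hn₀⟩
    · rw [h]
      exact finite_empty
    · refine (P.finite_toSet.image fun p => p + n₀).subset fun n hn => ?_
      exact ⟨n - n₀, hP _ _ (Eq.trans hn (Eq.symm hn₀)), sub_add_cancel _ _⟩
  -- Exceptional are the sites whose own atom is moved, which shifts every entry of the stencil, and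
  -- those that see a moved atom within distance `r`. The latter are finite in number because `φ`
  -- has finite fibres.
  have hexc1 : {n | δ ⟨j, (n, α)⟩ ≠ 0}.Finite :=
    hδ.preimage (f := fun n => (⟨j, (n, α)⟩ : AllSites 𝒜)) fun n _ n' _ h => by simpa using h
  have hexc2 : {n | ∃ ω : Site 𝒜 i, δ ⟨i, (ω.1 + φ n, ω.2)⟩ ≠ 0 ∧
      ‖S.R i ω.1‖ ≤ r}.Finite := by
    have hsub : {n | ∃ ω : Site 𝒜 i, δ ⟨i, (ω.1 + φ n, ω.2)⟩ ≠ 0 ∧ ‖S.R i ω.1‖ ≤ r} ⊆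
        φ ⁻¹' (⋃ q ∈ {n | ‖latticePoint (S.A i) n‖ ≤ r},
          (fun l => q + l) ⁻¹' {l | ∃ β, δ ⟨i, (l, β)⟩ ≠ 0}) := by
      rintro n ⟨ω, h1, h2⟩
      exact mem_iUnion₂.2 ⟨ω.1, h2, ω.2, h1⟩
    refine (Finite.preimage' (hfin.biUnion fun q _ => ?_) fun l _ => hφfin l).subset hsub
    refine Finite.preimage (fun l _ l' _ h => add_left_cancel h) ?_
    have : {l | ∃ β, δ ⟨i, (l, β)⟩ ≠ 0} = ⋃ β, {l | δ ⟨i, (l, β)⟩ ≠ 0} := by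
      ext l
      simp
    rw [this]
    exact finite_iUnion fun β => hδ.preimage (f := fun l => (⟨i, (l, β)⟩ : AllSites 𝒜))
      fun l _ l' _ h => by simpa using h
  -- At the exceptional sites the perturbed stencil may leave `𝔇^{κ,0}` and no estimate is
  -- available, but finitely many terms do not affect summability.
  refine Summable.of_norm_bounded_eventually (ENNReal.summable_toReal hE) ?_
  filter_upwards [hexc1.compl_mem_cofinite, hexc2.compl_mem_cofinite] with n h1 h2
  have h1' : δ ⟨j, (n, α)⟩ = 0 := by simpa using h1
  have hoff : ∀ ω, siteOffset i j φ α δ n ω = δ ⟨i, (ω.1 + φ n, ω.2)⟩ := fun ω => by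
    rw [siteOffset, h1', sub_zero]
  have hEn : E n ≠ ∞ := ENNReal.ne_top_of_tsum_ne_top hE n
  have hterm : ∀ p : Site 𝒜 i × Fin d, |siteOffset i j φ α δ n p.1 p.2 / w p.1| * M (fun _ => p) ≤
      (‖δ ⟨i, (p.1.1 + φ n, p.1.2)⟩‖ₑ * ENNReal.ofReal (c⁻¹ * M fun _ => p)).toReal := by
    intro p
    rw [ENNReal.toReal_mul, toReal_enorm, ENNReal.toReal_ofReal (mul_nonneg (by positivity) (hM0 _)),
      ← hoff, mul_left_comm, ← mul_assoc]
    exact mul_le_mul_of_nonneg_right (abs_coord_div_le hc (hwc p.1)) (hM0 _)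
  have hS : Summable fun p : Site 𝒜 i × Fin d =>
      |siteOffset i j φ α δ n p.1 p.2 / w p.1| * M fun _ => p :=
    Summable.of_nonneg_of_le (fun p => mul_nonneg (abs_nonneg _) (hM0 _)) hterm
      (ENNReal.summable_toReal hEn)
  have hbox : stencilBox (b n) (fun ω => κ * max 1 ‖S.R i ω.1‖ + 0) ⊆ 𝔖 := by
    intro y hy
    have h3 := h𝔖 n (y - b n) (by
      rw [← mem_stencilBox_add_iff (b := b n), add_sub_cancel]
      exact hy)
    rwa [add_sub_cancel] at h3
  have hmem2 : b n + a n + siteOffset i j φ α δ n ∈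
      stencilBox (b n) (fun ω => κ * max 1 ‖S.R i ω.1‖ + 0) := by
    rw [add_assoc, mem_stencilBox_add_iff]
    intro ω
    rw [add_zero, Pi.add_apply, hoff]
    by_cases h3 : δ ⟨i, (ω.1 + φ n, ω.2)⟩ = 0
    · rw [h3, add_zero]
      exact (ha n ω).trans (le_mul_of_one_le_right hκ.le (le_max_left _ _))
    · have h4 : r < ‖S.R i ω.1‖ := by
        by_contra h5
        exact h2 ⟨ω, h3, not_lt.1 h5⟩
      rw [hr, div_lt_iff₀' hκ] at h4
      refine (norm_add_le _ _).trans ((add_le_add (ha n ω) (hb₀le _)).trans (h4.le.trans ?_))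
      gcongr
      exact le_max_right _ _
  have hmain := abs_sub_le_tsum_coordPartial hk hV w hbox
    (M := M) (fun ω y hy => hbound ω y (hbox hy))
    (mem_stencilBox_add_iff.2 (Bilayer.mem_stencils_of_norm_le hκ.le (ha n))) hmem2
    (fun s hs => hw0 s hs n) hS
  rw [Real.norm_of_nonneg (abs_nonneg _)]
  refine hmain.trans ?_
  rw [ENNReal.tsum_toReal_eq fun p => ENNReal.ne_top_of_tsum_ne_top hEn p]
  exact hS.tsum_le_tsum hterm (ENNReal.summable_toReal hEn)

end FinitelySupportedPerturbations

/-! ### Summability of the offset potentials -/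

section OffsetSummability

variable {𝒜 : Fin 2 → Type*} {d : ℕ} {S : Bilayer 𝒜 d} {κ : ℝ}

theorem Bilayer.field_periodic (hκ : 0 ≤ κ) {u : S.Displacement} (hu : u ∈ S.admissible κ)
    (i : Fin 2) (β : 𝒜 i) : IsLatticePeriodic S.moire fun x => S.field u i x β :=
  representative_periodic S.isUnit_det_moireMatrix (Bilayer.continuous_representative hκ hu i β)

theorem mono_siteOffset_self (δ : AllSites 𝒜 → Vec d) (j : Fin 2) (α : 𝒜 j) (n : Fin 2 → ℤ) :
    siteOffset j j id α δ n (0, α) = 0 := by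
  simp [siteOffset]

variable [∀ j, Fintype (𝒜 j)] {V : SitePotentials 𝒜 d} {k : ℕ}

theorem Bilayer.Decay.summable_mono_offset (hD : S.Decay V κ 0 k) (hκ : 0 < κ) (hk : 1 ≤ k)
    {u : S.Displacement} (hu : u ∈ S.admissible κ) {δ : AllSites 𝒜 → Vec d}
    (hδ : (Function.support δ).Finite) (j : Fin 2) (α : 𝒜 j) :
    Summable fun n => |V.mono j α (S.monoStencil j (S.field u j) (S.R j n) α + monoOffset δ j n α) -
      V.mono j α (S.monoStencil j (S.field u j) (S.R j n) α)| := by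
  obtain ⟨c, hc, hw⟩ := S.exists_weight_ge j
  have h := Bilayer.summable_abs_sub_siteOffset (S := S) (i := j) (j := j) (φ := id) (α := α) hκ hk
    (P := {0}) (fun n n' h => by simpa [sub_eq_zero] using h) (w := S.weight j α) hc
    (fun s => (hw α s).imp_left fun h => by rw [h, S.weight_self]) (V := V.mono j α)
    (hD.mono_smooth j α) (b := fun _ => 0)
    (a := fun n => S.diffStencil j j LinearMap.id 0 0 (S.field u) (S.R j n) α)
    (fun n y hy => by rwa [zero_add]) (m := fun ω => S.monoNorm V κ 0 j ω)
    (hD.mono_summable j 1 le_rfl hk) (fun ω y hy => hD.mono_bound j α le_rfl hk ω hy)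
    (fun n ω => Bilayer.mono_diffStencil_le hκ.le hu j _ α ω) (δ := δ)
    (fun s hs n => by
      rcases hw α s with rfl | h
      · exact mono_siteOffset_self δ j α n
      · exact absurd hs (hc.trans_le h).ne') hδ
  simpa only [zero_add, ← Bilayer.monoStencil_eq, ← monoOffset_eq] using h

theorem Bilayer.Decay.summable_inter_offset (hD : S.Decay V κ 0 k) (hκ : 0 < κ) (hk : 1 ≤ k)
    {u : S.Displacement} (hu : u ∈ S.admissible κ) {δ : AllSites 𝒜 → Vec d}
    (hδ : (Function.support δ).Finite) (j : Fin 2) (α : 𝒜 j) :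
    Summable fun n => |V.inter j α (S.interStencil j (S.field u) (S.R j n) α +
      interOffset δ j n α) - V.inter j α (S.interStencil j (S.field u) (S.R j n) α)| := by
  obtain ⟨P, hP⟩ := S.exists_finset_moireIndex j
  have h := Bilayer.summable_abs_sub_siteOffset (S := S) (i := 1 - j) (j := j)
    (φ := S.moireIndex j) (α := α) hκ hk hP (w := fun _ => 1) one_pos (fun s => Or.inr le_rfl)
    (V := V.inter j α) (hD.inter_smooth j α)
    (b := fun n => S.interStencil j 0 (cellFract S.moire (S.R j n)) α)
    (a := fun n => S.diffStencil (1 - j) j (S.transfer j) (S.γ (1 - j)) (S.γ j) (S.field u)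
      (cellFract S.moire (S.R j n)) α)
    (fun n y hy => ⟨_, cellFract_mem _ _, y, hy, rfl⟩) (m := fun ω => S.interNorm V κ 0 j ω)
    (hD.inter_summable j 1 le_rfl hk) (fun ω y hy => hD.inter_bound j α le_rfl hk ω hy)
    (fun n ω => Bilayer.inter_diffStencil_le hκ.le hu j _ _ _ _ α ω) (δ := δ)
    (fun s hs n => absurd hs one_ne_zero) hδ
  have hper := Bilayer.field_periodic (S := S) hκ.le hu
  simpa only [← Bilayer.interStencil_eq, ← S.inter_offset_eq V hper, ← S.inter_eq V hper] using h

theorem memℓp_one_of_summable_abs {ι β : Type*} [Fintype β] {f : β → ι → ℝ}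
    (hf : ∀ b, Summable fun n => |f b n|) : Memℓp (fun n => ∑ b, f b n) 1 := by
  refine memℓp_gen ?_
  simp only [ENNReal.toReal_one, Real.rpow_one]
  exact Summable.of_nonneg_of_le (fun _ => norm_nonneg _) (fun n => norm_sum_le _ _)
    (summable_sum fun b _ => hf b)

theorem Bilayer.Decay.memℓp_monoOffsetPotential (hD : S.Decay V κ 0 k) (hκ : 0 < κ) (hk : 1 ≤ k)
    {u : S.Displacement} (hu : u ∈ S.admissible κ) {δ : AllSites 𝒜 → Vec d}
    (hδ : (Function.support δ).Finite) (j : Fin 2) : Memℓp (S.monoOffsetPotential V u δ j) 1 :=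
  memℓp_one_of_summable_abs fun α => hD.summable_mono_offset hκ hk hu hδ j α

theorem Bilayer.Decay.memℓp_interOffsetPotential (hD : S.Decay V κ 0 k) (hκ : 0 < κ) (hk : 1 ≤ k)
    {u : S.Displacement} (hu : u ∈ S.admissible κ) {δ : AllSites 𝒜 → Vec d}
    (hδ : (Function.support δ).Finite) (j : Fin 2) : Memℓp (S.interOffsetPotential V u δ j) 1 :=
  memℓp_one_of_summable_abs fun α => hD.summable_inter_offset hκ hk hu hδ j α

end OffsetSummability

/-! ### Offsets of summable perturbations -/

section SummablePerturbations

variable {𝒜 : Fin 2 → Type*} {d : ℕ}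

theorem tsum_enorm_eq (v : SummablePerturbation 𝒜 d) : ∑' x, ‖v x‖ₑ = ENNReal.ofReal ‖v‖ := by
  have h := lp.hasSum_norm (p := 1) (by simp) v
  simp only [ENNReal.toReal_one, Real.rpow_one] at h
  rw [← h.tsum_eq, ENNReal.ofReal_tsum_of_nonneg (fun _ => norm_nonneg _) h.summable]
  simp only [ofReal_norm]

/-- Two distinct entries together are bounded by the `ℓ¹` norm, so no factor `2` arises. Hence the
closed ball of radius `r` stays within `𝔇^{κ,r}`. -/
theorem norm_siteOffset_le {i j : Fin 2} {φ : (Fin 2 → ℤ) → Fin 2 → ℤ} {α : 𝒜 j}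
    (v : SummablePerturbation 𝒜 d) (n : Fin 2 → ℤ) (ω : Site 𝒜 i) :
    ‖siteOffset i j φ α v n ω‖ ≤ ‖v‖ := by
  classical
  rw [siteOffset]
  by_cases h : (⟨i, (ω.1 + φ n, ω.2)⟩ : AllSites 𝒜) = ⟨j, (n, α)⟩
  · rw [h, sub_self, norm_zero]
    exact norm_nonneg v
  · have h1 := lp.sum_rpow_le_norm_rpow (p := 1) (by simp) v {⟨i, (ω.1 + φ n, ω.2)⟩, ⟨j, (n, α)⟩}
    rw [Finset.sum_pair h] at h1
    simp only [ENNReal.toReal_one, Real.rpow_one] at h1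
    exact (norm_sub_le _ _).trans h1

theorem siteOffset_add (i j : Fin 2) (φ : (Fin 2 → ℤ) → Fin 2 → ℤ) (α : 𝒜 j)
    (v w : SummablePerturbation 𝒜 d) (n : Fin 2 → ℤ) :
    siteOffset i j φ α (v + w : SummablePerturbation 𝒜 d) n =
      siteOffset i j φ α v n + siteOffset i j φ α w n := by
  funext ω
  simp only [siteOffset, lp.coeFn_add, Pi.add_apply]
  abel

theorem siteOffset_smul (i j : Fin 2) (φ : (Fin 2 → ℤ) → Fin 2 → ℤ) (α : 𝒜 j) (c : ℝ)
    (v : SummablePerturbation 𝒜 d) (n : Fin 2 → ℤ) :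
    siteOffset i j φ α (c • v : SummablePerturbation 𝒜 d) n = c • siteOffset i j φ α v n := by
  funext ω
  simp only [siteOffset, lp.coeFn_smul, Pi.smul_apply, smul_sub]

theorem tsum_enorm_siteOffset_le {i j : Fin 2} {φ : (Fin 2 → ℤ) → Fin 2 → ℤ} {α : 𝒜 j}
    {P : Finset (Fin 2 → ℤ)} (hP : ∀ n n', φ n = φ n' → n - n' ∈ P)
    (v : SummablePerturbation 𝒜 d) (ω : Site 𝒜 i) :
    ∑' n, ‖siteOffset i j φ α v n ω‖ₑ ≤ (P.card + 1) * ENNReal.ofReal ‖v‖ := by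
  have h1 : ∑' n, ‖v ⟨j, (n, α)⟩‖ₑ ≤ ∑' x, ‖v x‖ₑ :=
    ENNReal.tsum_comp_le_tsum_of_injective (f := fun n => (⟨j, (n, α)⟩ : AllSites 𝒜))
      (fun n n' h => by simpa using h) fun x => ‖v x‖ₑ
  calc ∑' n, ‖siteOffset i j φ α v n ω‖ₑ ≤
        ∑' n, (‖v ⟨i, (ω.1 + φ n, ω.2)⟩‖ₑ + ‖v ⟨j, (n, α)⟩‖ₑ) :=
        ENNReal.tsum_le_tsum fun n => enorm_sub_le
    _ ≤ P.card * ∑' x, ‖v x‖ₑ + ∑' x, ‖v x‖ₑ := by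
        rw [ENNReal.tsum_add]
        exact add_le_add (tsum_enorm_site_le P hP v ω) h1
    _ = _ := by rw [tsum_enorm_eq, add_mul, one_mul]

/-- The product uniformity controls only finitely many entries at a time, so it is coarser than
closeness uniform in all entries; the latter is what the `ℓ¹` norm provides. -/
theorem exists_pos_of_uniformContinuousOn {σ : Type*} {f : (σ → Vec d) → ℝ} {C : Set (σ → Vec d)}
    (hf : UniformContinuousOn f C) {ε : ℝ} (hε : 0 < ε) : ∃ η > 0, ∀ a ∈ C, ∀ b ∈ C,
      (∀ s, ‖a s - b s‖ ≤ η) → |f a - f b| ≤ ε := by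
  by_contra hcon
  push Not at hcon
  choose a ha b hb hab hlt using fun n : ℕ => hcon (1 / ((n : ℝ) + 1)) (by positivity)
  have h1 : Tendsto (fun n => (a n, b n)) atTop (uniformity (σ → Vec d) ⊓ 𝓟 (C ×ˢ C)) := by
    refine tendsto_inf.2 ⟨?_, tendsto_principal.2 (Eventually.of_forall fun n => ⟨ha n, hb n⟩)⟩
    rw [Pi.uniformity, tendsto_iInf]
    intro s
    rw [tendsto_comap_iff]
    refine tendsto_uniformity_iff_dist_tendsto_zero.2 ?_
    refine squeeze_zero (fun _ => dist_nonneg) (fun n => ?_) tendsto_one_div_add_atTop_nhds_zero_nat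
    rw [dist_eq_norm]
    exact hab n s
  have h2 := tendsto_uniformity_iff_dist_tendsto_zero.1 (Tendsto.comp hf h1)
  obtain ⟨n, hn⟩ := (h2.eventually (Iio_mem_nhds hε)).exists
  exact absurd (hlt n) (not_lt.2 (le_of_lt hn))

end SummablePerturbations

/-! ### Regularity of lattice sums -/

section OffsetEnergy

variable {𝒜 : Fin 2 → Type*} {d : ℕ} {i j : Fin 2} {φ : (Fin 2 → ℤ) → Fin 2 → ℤ} {α : 𝒜 j}

theorem abs_siteOffset_div_le {w : Site 𝒜 i → ℝ} {c : ℝ} (hc : 0 < c)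
    (hwc : ∀ s, w s = 0 ∨ c ≤ w s) (v : AllSites 𝒜 → Vec d) (n : Fin 2 → ℤ)
    (p : Site 𝒜 i × Fin d) :
    |siteOffset i j φ α v n p.1 p.2 / w p.1| ≤ c⁻¹ * ‖siteOffset i j φ α v n p.1‖ :=
  abs_coord_div_le hc (hwc p.1)

/-- The first stencil factor is summed over the sites in `ℓ¹`, the remaining ones are bounded by
their norms, and the coefficient enters through its supremum. -/
theorem exists_hoelder_siteOffset {P : Finset (Fin 2 → ℤ)}
    (hP : ∀ n n', φ n = φ n' → n - n' ∈ P) {w : Site 𝒜 i → ℝ} {c : ℝ} (hc : 0 < c)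
    (hwc : ∀ s, w s = 0 ∨ c ≤ w s) {ℓ : ℕ} (hℓ : 1 ≤ ℓ) :
    ∃ C : ℝ≥0, ∀ (ω : Fin ℓ → Site 𝒜 i × Fin d) (v : Fin ℓ → SummablePerturbation 𝒜 d)
      (g : (Fin 2 → ℤ) → ℝ), AEStronglyMeasurable g Measure.count →
      ∫⁻ n, ‖g n * ∏ l, (siteOffset i j φ α (v l) n (ω l).1 (ω l).2 / w (ω l).1)‖ₑ
        ∂Measure.count ≤ C * eLpNorm g ∞ Measure.count * ∏ l, ‖v l‖ₑ := by
  obtain ⟨ℓ, rfl⟩ : ∃ ℓ', ℓ = ℓ' + 1 := ⟨ℓ - 1, by omega⟩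
  refine ⟨c⁻¹.toNNReal ^ (ℓ + 1) * (P.card + 1), fun ω v g _ => ?_⟩
  rw [lintegral_count]
  set c' : ℝ≥0∞ := (c⁻¹.toNNReal : ℝ≥0∞) with hc'
  set G := eLpNorm g ∞ Measure.count with hG
  have hg : ∀ n, ‖g n‖ₑ ≤ G := by
    have := enorm_ae_le_eLpNormEssSup g (Measure.count : Measure (Fin 2 → ℤ))
    rw [Measure.ae_count_iff] at this
    intro n
    rw [hG, eLpNorm_exponent_top]
    exact this n
  have hL : ∀ l n, ‖siteOffset i j φ α (v l) n (ω l).1 (ω l).2 / w (ω l).1‖ₑ ≤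
      c' * ‖siteOffset i j φ α (v l) n (ω l).1‖ₑ := by
    intro l n
    rw [← ofReal_norm, ← ofReal_norm, hc', ← ENNReal.ofReal, ← ENNReal.ofReal_mul (by positivity)]
    exact ENNReal.ofReal_le_ofReal (abs_siteOffset_div_le hc hwc (v l) n (ω l))
  have hL' : ∀ l n, ‖siteOffset i j φ α (v l) n (ω l).1 (ω l).2 / w (ω l).1‖ₑ ≤
      c' * ENNReal.ofReal ‖v l‖ := by
    intro l n
    refine (hL l n).trans (mul_le_mul_right ?_ _)
    rw [← ofReal_norm]
    exact ENNReal.ofReal_le_ofReal (norm_siteOffset_le (v l) n _)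
  have hterm : ∀ n, ‖g n * ∏ l, (siteOffset i j φ α (v l) n (ω l).1 (ω l).2 / w (ω l).1)‖ₑ ≤
      G * (c' * ‖siteOffset i j φ α (v 0) n (ω 0).1‖ₑ *
        ∏ l : Fin ℓ, (c' * ENNReal.ofReal ‖v l.succ‖)) := by
    intro n
    rw [enorm_mul, Fin.prod_univ_succ, enorm_mul]
    refine mul_le_mul' (hg n) (mul_le_mul' (hL 0 n) ?_)
    simp only [enorm_eq_nnnorm, nnnorm_prod, ENNReal.ofNNReal_finsetProd]
    exact Finset.prod_le_prod' fun l _ => hL' l.succ n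
  refine (ENNReal.tsum_le_tsum hterm).trans ?_
  rw [ENNReal.tsum_mul_left, ENNReal.tsum_mul_right, ENNReal.tsum_mul_left]
  have hprod : ∏ l, ‖v l‖ₑ =
      ENNReal.ofReal ‖v 0‖ * ∏ l : Fin ℓ, ENNReal.ofReal ‖v l.succ‖ := by
    rw [Fin.prod_univ_succ, ofReal_norm]
    simp only [ofReal_norm]
  rw [hprod, Finset.prod_mul_distrib, Finset.prod_const, Finset.card_univ, Fintype.card_fin]
  push_cast
  rw [← hc']
  calc _ ≤ G * (c' * ((P.card + 1) * ENNReal.ofReal ‖v 0‖) *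
        (c' ^ ℓ * ∏ l : Fin ℓ, ENNReal.ofReal ‖v l.succ‖)) :=
        mul_le_mul_right (mul_le_mul_left
          (mul_le_mul_right (tsum_enorm_siteOffset_le hP (v 0) _) _) _) _
    _ = _ := by ring

variable [∀ j, Fintype (𝒜 j)] {S : Bilayer 𝒜 d} {κ : ℝ}

/-- Sums of changes of a site potential, caused by summable perturbations, are `C^k`. -/
theorem Bilayer.contDiffOn_tsum_siteOffset (hκ : 0 ≤ κ) {k : ℕ} (hk : 1 ≤ k)
    {P : Finset (Fin 2 → ℤ)} (hP : ∀ n n', φ n = φ n' → n - n' ∈ P) {w : Site 𝒜 i → ℝ} {c : ℝ}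
    (hc : 0 < c) (hwc : ∀ s, w s = 0 ∨ c ≤ w s) {V : (Site 𝒜 i → Vec d) → ℝ}
    {𝔖 C : Set (Site 𝒜 i → Vec d)} (hV : StencilSmoothOn k V 𝔖) (hC : IsCompact C)
    (h𝔖C : 𝔖 ⊆ C) (hcont : ∀ ℓ ≤ k, ∀ ω : Fin ℓ → Site 𝒜 i × Fin d,
      ContinuousOn (coordPartial V w ω) C) {r : ℝ} (hr : 0 ≤ r)
    {b a : (Fin 2 → ℤ) → Site 𝒜 i → Vec d} (h𝔖 : ∀ n, ∀ y ∈ S.stencils κ r i, b n + y ∈ 𝔖)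
    {m : ∀ ℓ, (Fin ℓ → Site 𝒜 i) → ℝ≥0∞} (hm : ∀ ℓ, 1 ≤ ℓ → ℓ ≤ k → ∑' ω, m ℓ ω < ∞)
    (hbound : ∀ ℓ, 1 ≤ ℓ → ℓ ≤ k → ∀ (ω : Fin ℓ → Site 𝒜 i × Fin d), ∀ y ∈ 𝔖,
      |coordPartial V w ω y| ≤ (m ℓ fun n => (ω n).1).toReal)
    (ha : ∀ n ω, ‖a n ω‖ ≤ κ)
    (hw0 : ∀ s, w s = 0 → ∀ (δ : AllSites 𝒜 → Vec d) n, siteOffset i j φ α δ n s = 0) :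
    (∀ δ ∈ Metric.closedBall (0 : SummablePerturbation 𝒜 d) r,
      Summable fun n => V (b n + a n + siteOffset i j φ α δ n) - V (b n + a n)) ∧
    ContDiffOn ℝ k (fun δ : SummablePerturbation 𝒜 d =>
      ∑' n, (V (b n + a n + siteOffset i j φ α δ n) - V (b n + a n)))
      (Metric.closedBall 0 r) := by
  have hball : ∀ δ ∈ Metric.closedBall (0 : SummablePerturbation 𝒜 d) r, ‖δ‖ ≤ r :=
    fun δ hδ => mem_closedBall_zero_iff.1 hδ
  have hst : ∀ δ ∈ Metric.closedBall (0 : SummablePerturbation 𝒜 d) r, ∀ n,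
      a n + siteOffset i j φ α δ n ∈ S.stencils κ r i := by
    intro δ hδ n ω
    refine (norm_add_le _ _).trans (add_le_add ((ha n ω).trans
      (le_mul_of_one_le_right hκ (le_max_left _ _))) ?_)
    exact (norm_siteOffset_le δ n ω).trans (hball δ hδ)
  have hst𝔖 : ∀ δ ∈ Metric.closedBall (0 : SummablePerturbation 𝒜 d) r, ∀ n,
      b n + a n + siteOffset i j φ α δ n ∈ 𝔖 := by
    intro δ hδ n
    rw [add_assoc]
    exact h𝔖 n _ (hst δ hδ n)
  have hbox : ∀ n y, b n + y ∈ stencilBox (b n) (fun ω => κ * max 1 ‖S.R i ω.1‖ + r) ↔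
      y ∈ S.stencils κ r i := fun n y => by
    simp only [stencilBox, Bilayer.stencils, mem_ofPred_eq, Pi.add_apply, add_sub_cancel_left]
  have hlin : ∀ u v : SummablePerturbation 𝒜 d, ∀ n, siteOffset i j φ α u n =
      siteOffset i j φ α v n + siteOffset i j φ α (u - v : SummablePerturbation 𝒜 d) n := by
    intro u v n
    rw [← siteOffset_add, add_sub_cancel]
  have H : SmoothIntegrand (Measure.count : Measure (Fin 2 → ℤ))
      (Metric.closedBall (0 : SummablePerturbation 𝒜 d) r) k ∞ _ _ _ :=
    smoothIntegrand_of_stencils (V := V) (w := w)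
      (st := fun (δ : SummablePerturbation 𝒜 d) n => b n + a n + siteOffset i j φ α δ n)
      (lin := fun (δ : SummablePerturbation 𝒜 d) n => siteOffset i j φ α δ n) (r := fun n => V (b n + a n))
      (X₀ := univ) (Eventually.of_forall fun _ => mem_univ _) (z := b)
      (ρ := fun ω => κ * max 1 ‖S.R i ω.1‖ + r) (𝔖 := 𝔖) (m := m)
      (convex_closedBall _ _) ?_ hV ?_ ?_ ?_ ?_ ?_ hm hbound ?_ ?_ ?_ ?_ ?_ ?_ ?_ ?_
  · have hint : ∀ δ ∈ Metric.closedBall (0 : SummablePerturbation 𝒜 d) r, Integrable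
        (fun n => V (b n + a n + siteOffset i j φ α δ n) - V (b n + a n)) Measure.count := by
      intro δ hδ
      have h1 := H.integrable_zero hk hδ
      simpa only [coordPartial_zero, if_true] using h1
    refine ⟨fun δ hδ => (integrable_count_iff.1 (hint δ hδ)).of_norm, ?_⟩
    refine (H.contDiffOn_integral hk).congr fun δ hδ => ?_
    simp only [coordPartial_zero, if_true]
    rw [integral_countable (hint δ hδ)]
    simp
  · have := (memLp_top_const (μ := (Measure.count : Measure (Fin 2 → ℤ))) (1 : ℝ)).2
    exact this.ne
  · intro n _ y hy
    have h1 := h𝔖 n (y - b n) (by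
      rw [← hbox n, add_sub_cancel]
      exact hy)
    rwa [add_sub_cancel] at h1
  · intro δ hδ n _
    rw [add_assoc, hbox]
    exact hst δ hδ n
  · intro u _ v _ n _ t _
    rw [siteOffset_add, siteOffset_smul, add_assoc, add_assoc, add_assoc]
  · exact fun u _ v _ n _ s hs => hw0 s hs _ n
  · intro u _ v _
    refine ⟨c⁻¹ * ‖v - u‖, fun n _ p => (abs_siteOffset_div_le hc hwc _ n p).trans ?_⟩
    gcongr
    exact norm_siteOffset_le (v - u) n p.1
  · exact fun ℓ _ ω u _ => (Measurable.of_discrete).aestronglyMeasurable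
  · exact (Measurable.of_discrete).aestronglyMeasurable
  · exact fun p v => (Measurable.of_discrete).aestronglyMeasurable
  · exact fun u v => Eventually.of_forall fun n => siteOffset_add i j φ α u v n
  · exact fun c v => Eventually.of_forall fun n => siteOffset_smul i j φ α c v n
  · exact fun ℓ h1 _ => exists_hoelder_siteOffset hP hc hwc h1
  -- At the zero perturbation every subtracted site energy vanishes, which gives the integrable base
  -- point.
  · refine ⟨0, Metric.mem_closedBall_self hr, ?_⟩
    have h0 : ∀ n, siteOffset i j φ α (0 : SummablePerturbation 𝒜 d) n = 0 := fun n => by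
      rw [lp.coeFn_zero, siteOffset_zero]
    simp only [h0, add_zero, sub_self]
    exact integrable_zero _ _ _
  · intro ℓ h1 h2 ω u hu
    rw [ENNReal.tendsto_nhds_zero]
    intro ε hε
    obtain ⟨ε', hε'0, hε'⟩ : ∃ ε' : ℝ, 0 < ε' ∧ ENNReal.ofReal ε' ≤ ε := by
      rcases eq_or_ne ε ∞ with rfl | h
      · exact ⟨1, one_pos, le_top⟩
      · exact ⟨ε.toReal, ENNReal.toReal_pos hε.ne' h, (ENNReal.ofReal_toReal h).le⟩
    -- Convergence in `L^∞` over all sites needs one `η` for infinitely many base stencils;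
    -- compactness of `C` provides it.
    obtain ⟨η, hη, hη'⟩ := exists_pos_of_uniformContinuousOn
      (hC.uniformContinuousOn_of_continuous (hcont ℓ h2 ω)) hε'0
    have hnear : ∀ᶠ u' in 𝓝[Metric.closedBall (0 : SummablePerturbation 𝒜 d) r] u,
        ‖u' - u‖ ≤ η := by
      refine nhdsWithin_le_nhds ?_
      filter_upwards [Metric.closedBall_mem_nhds u hη] with u' hu'
      rwa [← dist_eq_norm]
    filter_upwards [hnear, self_mem_nhdsWithin] with u' h3 h4
    rw [eLpNorm_exponent_top]
    refine le_trans (eLpNormEssSup_le_of_ae_bound (C := ε') (Eventually.of_forall fun n => ?_)) hε'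
    refine hη' _ (h𝔖C (hst𝔖 u' h4 n)) _ (h𝔖C (hst𝔖 u hu n)) fun s => ?_
    have h5 : (b n + a n + siteOffset i j φ α u' n) s - (b n + a n + siteOffset i j φ α u n) s =
        siteOffset i j φ α (u' - u : SummablePerturbation 𝒜 d) n s := by
      rw [hlin u' u n]
      simp only [Pi.add_apply]
      abel
    rw [h5]
    exact (norm_siteOffset_le (u' - u) n s).trans h3

end OffsetEnergy

/-! ### Extension by density -/

section Extension

variable {𝒜 : Fin 2 → Type*} {d k : ℕ}

/-- The finitely supported perturbations are dense in every open set of perturbations. -/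
theorem mem_closure_finite_support {U : Set (SummablePerturbation 𝒜 d)} (hU : IsOpen U)
    {δ : SummablePerturbation 𝒜 d} (hδ : δ ∈ U) : δ ∈ closure
      {ε | ε ∈ U ∧ (Function.support (ε : AllSites 𝒜 → Vec d)).Finite} := by
  classical
  have h := lp.hasSum_single (p := 1) ENNReal.one_ne_top δ
  refine mem_closure_of_tendsto h ?_
  filter_upwards [h.eventually (hU.mem_nhds hδ)] with s hs
  refine ⟨hs, s.finite_toSet.subset fun x hx => ?_⟩
  by_contra hxs
  refine hx ?_
  rw [lp.coeFn_sum, Finset.sum_apply]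
  refine Finset.sum_eq_zero fun y hy => ?_
  rw [lp.single_apply]
  refine Pi.single_eq_of_ne ?_ _
  rintro rfl
  exact hxs hy

/-- `E` itself, evaluated on summable perturbations, is the extension. Any other one agrees with it
on a dense subset of the open set `U`. -/
theorem hasUniqueSmoothExtensionOn_of_contDiffOn {E : (AllSites 𝒜 → Vec d) → ℝ}
    {U : Set (SummablePerturbation 𝒜 d)} (hU : IsOpen U)
    (hE : ContDiffOn ℝ k (fun δ : SummablePerturbation 𝒜 d => E δ) U) :
    HasUniqueSmoothExtensionOn k E U := by
  refine ⟨fun δ => E δ, ⟨hE.continuousOn, fun _ _ _ => rfl⟩, fun G hG δ hδ => ?_, hE⟩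
  have h1 := mem_closure_finite_support hU hδ
  have h2 : ContinuousAt (fun δ => G δ - E δ) δ :=
    ((hG.1 δ hδ).continuousAt (hU.mem_nhds hδ)).sub
      ((hE.continuousOn δ hδ).continuousAt (hU.mem_nhds hδ))
  have h3 := h2.continuousWithinAt.mem_closure (t := {0}) h1 fun ε hε =>
    mem_singleton_iff.2 (sub_eq_zero.2 (hG.2 ε hε.1 hε.2))
  rw [closure_singleton, mem_singleton_iff] at h3
  exact sub_eq_zero.1 h3

end Extension

/-! ### Compact sets of interlayer stencils -/

section ClosedStencils

variable {𝒜 : Fin 2 → Type*} {d : ℕ} {S : Bilayer 𝒜 d} {κ : ℝ}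

theorem Bilayer.interStencil_zero_sub (j : Fin 2) (x y : Plane) (α : 𝒜 j) (ω : Site 𝒜 (1 - j)) :
    S.interStencil j 0 x α ω - S.interStencil j 0 y α ω =
      S.plane (S.transfer j (x - y)) - S.plane (x - y) := by
  simp only [Bilayer.interStencil, Bilayer.position, Pi.zero_apply, add_zero, map_add, map_sub]
  abel

/-- The interlayer stencils are contained in a compact set of slightly larger stencils. -/
theorem Bilayer.exists_isCompact_interStencils (S : Bilayer 𝒜 d) (κ : ℝ) {r r' : ℝ} (hr : r < r')
    (j : Fin 2) (α : 𝒜 j) : ∃ C, IsCompact C ∧ S.interStencils κ r j α ⊆ C ∧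
      C ⊆ S.interStencils κ r' j α := by
  let T : Plane →L[ℝ] Plane := LinearMap.toContinuousLinearMap (S.transfer j)
  refine ⟨(fun p : Plane × (Site 𝒜 (1 - j) → Vec d) => S.interStencil j 0 p.1 α + p.2) ''
    (closure S.moireCell ×ˢ S.stencils κ r (1 - j)), ?_, ?_, ?_⟩
  · refine IsCompact.image ((isBounded_unitCell S.moire).isCompact_closure.prod
      (S.isCompact_stencils κ r (1 - j))) ?_
    exact ((Bilayer.continuous_interStencil_zero j α).comp continuous_fst).add continuous_snd
  · rintro _ ⟨x, hx, a, ha, rfl⟩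
    exact ⟨(x, a), ⟨subset_closure hx, ha⟩, rfl⟩
  · rintro _ ⟨⟨x, a⟩, ⟨hx, ha⟩, rfl⟩
    -- A boundary point of the half-open cell is replaced by a nearby point of the cell. The
    -- reference stencils then differ by a vector independent of the site, of norm at most `(‖T‖ +
    -- 1) * dist x y`, which fits into the gap `r' - r`.
    obtain ⟨y, hy, hxy⟩ := Metric.mem_closure_iff.1 hx ((r' - r) / (‖T‖ + 1))
      (div_pos (sub_pos.2 hr) (by positivity))
    refine ⟨y, hy, fun ω => S.interStencil j 0 x α ω - S.interStencil j 0 y α ω + a ω, ?_, ?_⟩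
    · intro ω
      have h1 : ‖S.interStencil j 0 x α ω - S.interStencil j 0 y α ω‖ ≤ r' - r := by
        rw [Bilayer.interStencil_zero_sub]
        refine (norm_sub_le _ _).trans ?_
        rw [S.plane.norm_map, S.plane.norm_map, ← dist_eq_norm x y]
        rw [lt_div_iff₀ (by positivity)] at hxy
        have h2 : ‖S.transfer j (x - y)‖ ≤ ‖T‖ * dist x y := by
          rw [dist_eq_norm]
          exact T.le_opNorm _
        linarith
      have h3 := ha ω
      refine (norm_add_le _ _).trans ?_
      linarith
    · funext ω
      simp only [Pi.add_apply]
      abel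

end ClosedStencils

/-! ### Regularity of the offset energy -/

section OffsetRegularity

variable {𝒜 : Fin 2 → Type*} {d : ℕ} [∀ j, Fintype (𝒜 j)] {S : Bilayer 𝒜 d}
  {V : SitePotentials 𝒜 d} {κ r r' : ℝ} {k : ℕ}

theorem Bilayer.Decay.contDiffOn_mono_offset (hD : S.Decay V κ r k) (hκ : 0 ≤ κ) (hr : 0 ≤ r)
    (hk : 1 ≤ k) {u : S.Displacement} (hu : u ∈ S.admissible κ) (j : Fin 2) (α : 𝒜 j) :
    (∀ δ ∈ Metric.closedBall (0 : SummablePerturbation 𝒜 d) r, Summable fun n =>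
      V.mono j α (S.monoStencil j (S.field u j) (S.R j n) α + monoOffset δ j n α) -
      V.mono j α (S.monoStencil j (S.field u j) (S.R j n) α)) ∧
    ContDiffOn ℝ k (fun δ : SummablePerturbation 𝒜 d => ∑' n,
      (V.mono j α (S.monoStencil j (S.field u j) (S.R j n) α + monoOffset δ j n α) -
      V.mono j α (S.monoStencil j (S.field u j) (S.R j n) α))) (Metric.closedBall 0 r) := by
  obtain ⟨c, hc, hw⟩ := S.exists_weight_ge j
  have h := Bilayer.contDiffOn_tsum_siteOffset (S := S) (i := j) (j := j) (φ := id) (α := α) hκ hk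
    (P := {0}) (fun n n' h => by simpa [sub_eq_zero] using h) (w := S.weight j α) hc
    (fun s => (hw α s).imp_left fun h => by rw [h, S.weight_self]) (V := V.mono j α)
    (hD.mono_smooth j α) (S.isCompact_stencils κ r j) Subset.rfl
    (fun ℓ hℓ ω => continuousOn_coordPartial (hD.mono_smooth j α) _ hℓ ω) hr (b := fun _ => 0)
    (a := fun n => S.diffStencil j j LinearMap.id 0 0 (S.field u) (S.R j n) α)
    (fun n y hy => by rwa [zero_add]) (m := fun ℓ ω => S.monoNorm V κ r j ω)
    (hD.mono_summable j) (fun ℓ h1 h2 ω y hy => hD.mono_bound j α h1 h2 ω hy)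
    (fun n ω => Bilayer.mono_diffStencil_le hκ hu j _ α ω)
    (fun s hs δ n => by
      rcases hw α s with rfl | h
      · exact mono_siteOffset_self δ j α n
      · exact absurd hs (hc.trans_le h).ne')
  simpa only [zero_add, ← Bilayer.monoStencil_eq, ← monoOffset_eq] using h

/-- Decay at the larger radius `r'` is used only for continuity on a compact set containing the
interlayer stencils of radius `r`; the summable bounds are those at `r`. -/
theorem Bilayer.Decay.contDiffOn_inter_offset (hD : S.Decay V κ r k) (hD' : S.Decay V κ r' k)
    (hκ : 0 ≤ κ) (hr : 0 ≤ r) (hr' : r < r') (hk : 1 ≤ k) {u : S.Displacement}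
    (hu : u ∈ S.admissible κ) (j : Fin 2) (α : 𝒜 j) :
    (∀ δ ∈ Metric.closedBall (0 : SummablePerturbation 𝒜 d) r, Summable fun n =>
      V.inter j α (S.interStencil j (S.field u) (S.R j n) α + interOffset δ j n α) -
      V.inter j α (S.interStencil j (S.field u) (S.R j n) α)) ∧
    ContDiffOn ℝ k (fun δ : SummablePerturbation 𝒜 d => ∑' n,
      (V.inter j α (S.interStencil j (S.field u) (S.R j n) α + interOffset δ j n α) -
      V.inter j α (S.interStencil j (S.field u) (S.R j n) α))) (Metric.closedBall 0 r) := by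
  obtain ⟨P, hP⟩ := S.exists_finset_moireIndex j
  obtain ⟨C, hC, h1, h2⟩ := S.exists_isCompact_interStencils κ hr' j α
  have h := Bilayer.contDiffOn_tsum_siteOffset (S := S) (i := 1 - j) (j := j)
    (φ := S.moireIndex j) (α := α) hκ hk hP (w := fun _ => 1) one_pos (fun s => Or.inr le_rfl)
    (V := V.inter j α) (hD.inter_smooth j α) hC h1
    (fun ℓ hℓ ω => (continuousOn_coordPartial (hD'.inter_smooth j α) _ hℓ ω).mono h2) hr
    (b := fun n => S.interStencil j 0 (cellFract S.moire (S.R j n)) α)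
    (a := fun n => S.diffStencil (1 - j) j (S.transfer j) (S.γ (1 - j)) (S.γ j) (S.field u)
      (cellFract S.moire (S.R j n)) α)
    (fun n y hy => ⟨_, cellFract_mem _ _, y, hy, rfl⟩) (m := fun ℓ ω => S.interNorm V κ r j ω)
    (hD.inter_summable j) (fun ℓ h1 h2 ω y hy => hD.inter_bound j α h1 h2 ω hy)
    (fun n ω => Bilayer.inter_diffStencil_le hκ hu j _ _ _ _ α ω)
    (fun s hs δ n => absurd hs one_ne_zero)
  have hper := Bilayer.field_periodic (S := S) hκ hu
  simpa only [← Bilayer.interStencil_eq, ← S.inter_offset_eq V hper, ← S.inter_eq V hper] using h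

theorem Bilayer.Decay.contDiffOn_offsetEnergy (hD : S.Decay V κ r k) (hD' : S.Decay V κ r' k)
    (hκ : 0 ≤ κ) (hr : 0 ≤ r) (hr' : r < r') (hk : 1 ≤ k) {u : S.Displacement}
    (hu : u ∈ S.admissible κ) : ContDiffOn ℝ k
      (fun δ : SummablePerturbation 𝒜 d => S.offsetEnergy V u δ) (Metric.closedBall 0 r) := by
  have hmono := fun j α => hD.contDiffOn_mono_offset hκ hr hk hu j α
  have hinter := fun j α => hD.contDiffOn_inter_offset hD' hκ hr hr' hk hu j α
  have h1 : ContDiffOn ℝ k (fun δ : SummablePerturbation 𝒜 d => ∑ j : Fin 2,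
      ((∑ α : 𝒜 j, ∑' n,
        (V.mono j α (S.monoStencil j (S.field u j) (S.R j n) α + monoOffset δ j n α) -
        V.mono j α (S.monoStencil j (S.field u j) (S.R j n) α))) +
      ∑ α : 𝒜 j, ∑' n,
        (V.inter j α (S.interStencil j (S.field u) (S.R j n) α + interOffset δ j n α) -
        V.inter j α (S.interStencil j (S.field u) (S.R j n) α)))) (Metric.closedBall 0 r) :=
    ContDiffOn.sum fun j _ => (ContDiffOn.sum fun α _ => (hmono j α).2).add
      (ContDiffOn.sum fun α _ => (hinter j α).2)
  refine h1.congr fun δ hδ => ?_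
  refine Finset.sum_congr rfl fun j _ => ?_
  congr 1
  · exact Summable.tsum_finsetSum fun α _ => (hmono j α).1 δ hδ
  · exact Summable.tsum_finsetSum fun α _ => (hinter j α).1 δ hδ

/-- Smoothness is local: each `δ` is interior to a closed ball on which the offset energy is already
known to be `C^k`. -/
theorem Bilayer.hasUniqueSmoothExtensionOn_offsetEnergy (hκ : 0 ≤ κ) (hk : 1 ≤ k)
    {u : S.Displacement} (hu : u ∈ S.admissible κ) {U : Set (SummablePerturbation 𝒜 d)}
    (hU : IsOpen U) (hD : ∀ δ ∈ U, ∃ r r', ‖δ‖ < r ∧ r < r' ∧ S.Decay V κ r k ∧ S.Decay V κ r' k) :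
    HasUniqueSmoothExtensionOn k (S.offsetEnergy V u) U := by
  refine hasUniqueSmoothExtensionOn_of_contDiffOn hU fun δ hδ => ?_
  obtain ⟨r, r', h1, h2, h3, h4⟩ := hD δ hδ
  have h5 := h3.contDiffOn_offsetEnergy h4 hκ ((norm_nonneg _).trans h1.le) h2 hk hu
  refine (h5.contDiffAt ?_).contDiffWithinAt
  exact Filter.mem_of_superset (Metric.isOpen_ball.mem_nhds (mem_ball_zero_iff.2 h1))
    Metric.ball_subset_closedBall

end OffsetRegularity

/-! ### The proposition -/

theorem mainTheorem5 {𝒜 : Fin 2 → Type*} [∀ j, Fintype (𝒜 j)] {d : ℕ}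
    (S : Bilayer 𝒜 d) (V : SitePotentials 𝒜 d) (κ : ℝ) (hκ : 0 < κ) (k : ℕ) (hk : 5 ≤ k)
    (hdecay : S.Decay V κ 0 k) :
    -- regularity of the energy density
    (∀ u ∈ S.admissible κ, ∀ j : Fin 2,
      IntegrableOn (S.monoDensity V u j) S.moireCell ∧
      IntegrableOn (S.interDensity V u j) S.moireCell) ∧
    ContDiffOn ℝ k (S.energyDensity V) (S.admissible κ) ∧
    ∀ u ∈ S.admissible κ,
      -- the displacements at the lattice sites are those of the continuous representative
      (∀ (j : Fin 2) (α : 𝒜 j), Continuous (representative (u j α))) ∧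
      -- summability of the offset site potentials
      (∀ δ : AllSites 𝒜 → Vec d, (Function.support δ).Finite → ∀ j : Fin 2,
        Memℓp (S.monoOffsetPotential V u δ j) 1 ∧ Memℓp (S.interOffsetPotential V u δ j) 1) ∧
      -- extension of the offset energy to all of `ℓ¹`, and its regularity
      ((∀ r : ℝ, 0 ≤ r → S.Decay V κ r k) →
        HasUniqueSmoothExtensionOn k (S.offsetEnergy V u) univ) ∧
      -- the same on a ball, under the corresponding decay
      (∀ ρ : ℝ, (∀ r : ℝ, 0 ≤ r → r < ρ → S.Decay V κ r k) →
        HasUniqueSmoothExtensionOn k (S.offsetEnergy V u) (Metric.ball 0 ρ)) := by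
  have hk1 : 1 ≤ k := by omega
  refine ⟨fun u hu j => ⟨hdecay.integrableOn_monoDensity hκ.le hk1 hu j,
    hdecay.integrableOn_interDensity hκ.le hk1 hu j⟩,
    hdecay.contDiffOn_energyDensity hκ.le hk1, fun u hu => ⟨fun j α =>
      Bilayer.continuous_representative hκ.le hu j α, fun δ hδ j =>
      ⟨hdecay.memℓp_monoOffsetPotential hκ hk1 hu hδ j,
        hdecay.memℓp_interOffsetPotential hκ hk1 hu hδ j⟩, fun hD => ?_, fun ρ hD => ?_⟩⟩
  · refine Bilayer.hasUniqueSmoothExtensionOn_offsetEnergy hκ.le hk1 hu isOpen_univ fun δ _ => ?_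
    have h0 := norm_nonneg δ
    exact ⟨‖δ‖ + 1, ‖δ‖ + 2, by linarith, by linarith, hD _ (by linarith), hD _ (by linarith)⟩
  · refine Bilayer.hasUniqueSmoothExtensionOn_offsetEnergy hκ.le hk1 hu Metric.isOpen_ball
      fun δ hδ => ?_
    have h0 := norm_nonneg δ
    rw [mem_ball_zero_iff] at hδ
    -- Two radii between `‖δ‖` and `ρ`: the first puts `δ` in the interior of a ball, the second is
    -- the slack for the compact set of interlayer stencils.
    obtain ⟨r, h1, h2⟩ := exists_between hδ
    obtain ⟨r', h3, h4⟩ := exists_between h2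
    exact ⟨r, r', h1, h3, hD _ (by linarith) h2, hD _ (by linarith) h4⟩
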